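/- Let $\mathbb T^2=(\mathbb R/2\pi\mathbb Z)^2$, let $U:\mathbb R\to\mathbb R$ be smooth and $2\pi$-periodic, $U_s(x,y)=(U(y),0)$, $\Omega_s=-U'$. For a smooth zero-mean function $\omega$ on $\mathbb T^2$ put $u=\nabla^\perp\Delta^{-1}\omega$ with $\nabla^\perp=(-\partial_y,\partial_x)$, $$\mathcal L\omega=U_s\cdot\nabla\omega+u\cdot\nabla\Omega_s,\qquad Q(u,\omega)=-(u\cdot\nabla)\omega .$$ Consider the vorticity form of the Euler equations around $U_s$, $$\partial_t\omega+\mathcal L\omega=Q(u,\omega).\tag{1}$$ For $f(x,y)=\sum_{k\in\mathbb Z}e^{ikx}f_k(y)$ and $z_1,z_2\ge0$ define the generator function $$\mathrm{Gen}(f)(z_1,z_2)=\sum_{k\in\mathbb Z}\sum_{\ell\ge0}e^{|k|z_1}\,\|\partial_y^\ell f_k\|_{L^\infty}\frac{z_2^\ell}{\ell!}\in[0,\infty].$$ For $N\ge0$ let $X_N$ be the set of smooth complex-valued zero-mean functions $f$ on $\mathbb T^2$ such that $\mathrm{Gen}(f)(r,r)<\infty$ for some $r>0$ and $f_k=0$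 for $|k|>N$. Theorem. Let $\alpha\in\mathbb C$ with $\operatorname{Re}\alpha>0$, let $K\in\mathbb N$, and let $\omega_1\in X_K$, $\omega_1\ne0$, be an unstable eigenmode: $(\alpha+\mathcal L)\omega_1=0$. Assume (H1) there are $C,z_0>0$ such that for every $\lambda\in\mathbb C$ with $\operatorname{Re}\lambda>\frac32\operatorname{Re}\alpha$ and every $f\in X_{K\operatorname{Re}\lambda/\operatorname{Re}\alpha}$ the equation $(\lambda+\mathcal L)g=f$ has exactly one solution $g=(\lambda+\mathcal L)^{-1}f\in X_{K\operatorname{Re}\lambda/\operatorname{Re}\alpha}$, and $\mathrm{Gen}(g)(z_1,z_2)\le\frac{C}{|\lambda|}\mathrm{Gen}(f)(z_1,z_2)$ for all $z_1,z_2\in[0,z_0]$. Then the following hold. (a) There is exactly one sequence $(\omega_n)_{n\ge0}$ with $\omega_0=0$, first term the given $\omega_1$, $\omega_n\in X_{nK}$, and $$(n\alpha+\mathcal L)\omega_n=\sum_{1\le j\le n-1}Q(u_j,\omega_{n-j}),\qquad u_j=\nabla^\perp\Delta^{-1}\omega_j,\quad n\ge2,$$ and there is $T_0\in\mathbb R$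 such that for all $t\le T_0$ the series $\sum_{n\ge0}e^{n\alpha t}\omega_n$ converges (absolutely pointwise, and $\sum_n e^{n\operatorname{Re}\alpha\,t}\,\mathrm{Gen}(\omega_n)(\rho,\rho)<\infty$ for some $\rho>0$ independent of $t$) and its sum is a smooth solution of (1) on $(-\infty,T_0]$. (b) The time is positive if the eigenmode is normalized to be small: there is $c_0>0$ such that for every $c\in\mathbb C$ with $|c|\le c_0$ the conclusion (a) holds for the eigenmode $c\,\omega_1$ in place of $\omega_1$ with some $T_0>0$. (c) If $\alpha$ and $\omega_1$ are real, then all $\omega_n$ are real. (d) $U_s$ is nonlinearly unstable in $L^\infty$: there are $\delta,\rho>0$ such that for every $\varepsilon>0$ there are $T>0$ and a smooth real-valued solution $\omega$ of (1) on $[0,T]$, with velocity $u$, such that $\mathrm{Gen}(\omega(0))(\rho,\rho)\le\varepsilon$, $\|u(0)\|_{L^\infty}\le\varepsilon$ and $\|u(T)\|_{L^\infty}\ge\delta$. -/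

import Mathlib

open scoped ContDiff ENNReal

noncomputable section

namespace ShearFlow

/-- Partial derivative in the first variable `x`. -/
def dx (f : ℝ × ℝ → ℂ) : ℝ × ℝ → ℂ := fun p => deriv (fun s => f (s, p.2)) p.1

/-- Partial derivative in the second variable `y`. -/
def dy (f : ℝ × ℝ → ℂ) : ℝ × ℝ → ℂ := fun p => deriv (fun s => f (p.1, s)) p.2

/-- Functions on the torus `𝕋² = (ℝ / 2πℤ)²`, as `2π`-periodic functions of two real variables:
smooth and with zero mean (so that `Δ⁻¹` makes sense on them). -/
structure IsTorusField (f : ℝ × ℝ → ℂ) : Prop where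
  smooth : ContDiff ℝ ∞ f
  periodic_x : ∀ x y, f (x + 2 * Real.pi, y) = f (x, y)
  periodic_y : ∀ x y, f (x, y + 2 * Real.pi) = f (x, y)
  mean_zero : ∫ y in (0 : ℝ)..(2 * Real.pi), ∫ x in (0 : ℝ)..(2 * Real.pi), f (x, y) = 0

/-- The `k`-th Fourier coefficient in `x`, a function of `y`; `f (x, y) = ∑ₖ exp (i k x) fₖ(y)`. -/
def fourierX (f : ℝ × ℝ → ℂ) (k : ℤ) (y : ℝ) : ℂ :=
  ((2 * Real.pi : ℝ) : ℂ)⁻¹ *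
    ∫ x in (0 : ℝ)..(2 * Real.pi), f (x, y) * Complex.exp (-(Complex.I * k * x))

/-- The `(k, l)` Fourier coefficient on the torus. -/
def fourierXY (f : ℝ × ℝ → ℂ) (k l : ℤ) : ℂ :=
  ((2 * Real.pi : ℝ) : ℂ)⁻¹ *
    ∫ y in (0 : ℝ)..(2 * Real.pi), fourierX f k y * Complex.exp (-(Complex.I * l * y))

/-- The inverse Laplacian `Δ⁻¹` on zero mean functions, as a Fourier series:
`- ∑_{(k, l) ≠ 0} f̂(k, l) / (k² + l²) exp (i (k x + l y))` (the `(0, 0)` term below is `0`). -/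
def invLaplacian (f : ℝ × ℝ → ℂ) : ℝ × ℝ → ℂ := fun p =>
  ∑' m : ℤ × ℤ, -(fourierXY f m.1 m.2 / ((m.1 : ℂ) ^ 2 + (m.2 : ℂ) ^ 2)) *
    Complex.exp (Complex.I * (m.1 * p.1 + m.2 * p.2))

/-- Biot–Savart law: the velocity `u = ∇^⊥ Δ⁻¹ v` of the vorticity `v`, with `∇^⊥ = (-∂_y, ∂_x)`. -/
def velocity (v : ℝ × ℝ → ℂ) : ℝ × ℝ → ℂ × ℂ := fun p =>
  (-dy (invLaplacian v) p, dx (invLaplacian v) p)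

/-- The transport term `(u · ∇) f`. -/
def transport (u : ℝ × ℝ → ℂ × ℂ) (f : ℝ × ℝ → ℂ) : ℝ × ℝ → ℂ := fun p =>
  (u p).1 * dx f p + (u p).2 * dy f p

/-- The shear flow `U_s (x, y) = (U y, 0)`. -/
def shear (U : ℝ → ℝ) : ℝ × ℝ → ℂ × ℂ := fun p => ((U p.2 : ℂ), 0)

/-- The vorticity `Ω_s = ∂_x 0 - ∂_y U = -U'` of the shear flow. -/
def shearVorticity (U : ℝ → ℝ) : ℝ × ℝ → ℂ := fun p => -((deriv U p.2 : ℝ) : ℂ)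

/-- The linearized operator `ℒ v = (U_s · ∇) v + (u · ∇) Ω_s`, `u = ∇^⊥ Δ⁻¹ v`. -/
def linearized (U : ℝ → ℝ) (v : ℝ × ℝ → ℂ) : ℝ × ℝ → ℂ := fun p =>
  transport (shear U) v p + transport (velocity v) (shearVorticity U) p

/-- The nonlinear term `Q(u, v) = -(u · ∇) v`. -/
def Q (u : ℝ × ℝ → ℂ × ℂ) (v : ℝ × ℝ → ℂ) : ℝ × ℝ → ℂ := fun p => -transport u v p

/-- The generator function
`Gen f (z₁, z₂) = ∑_{k ∈ ℤ} ∑_{l ≥ 0} exp (|k| z₁) (sup_y |∂_y^l fₖ(y)|) z₂^l / l!`,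
used for `z₁, z₂ ≥ 0`, with values in `[0, ∞]`. -/
def Gen (f : ℝ × ℝ → ℂ) (z₁ z₂ : ℝ) : ℝ≥0∞ :=
  ∑' k : ℤ, ∑' l : ℕ,
    ENNReal.ofReal (Real.exp (|(k : ℝ)| * z₁) * z₂ ^ l / (l.factorial : ℝ)) *
      ⨆ y : ℝ, ‖iteratedDeriv l (fourierX f k) y‖ₑ

/-- Zero mean analytic functions on the torus (the generator function is finite near `0`)
all of whose frequencies in `x` are at most `N` in absolute value. -/
structure IsAdmissible (N : ℝ) (f : ℝ × ℝ → ℂ) : Prop where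
  torusField : IsTorusField f
  analytic : ∃ r : ℝ, 0 < r ∧ Gen f r r ≠ ⊤
  frequencies : ∀ k : ℤ, N < |(k : ℝ)| → ∀ y, fourierX f k y = 0

/-- Assumption (H1): for `Re λ > (3/2) Re α`, the operator `λ + ℒ` is invertible and
`Gen ((λ + ℒ)⁻¹ f) ≤ (C / |λ|) Gen f` near `0`, with `C` independent of `λ` and `f`. It is
imposed only on the `f` with frequencies in `x` of size at most `K Re λ / Re α`. -/
def ResolventBound (U : ℝ → ℝ) (α : ℂ) (K : ℕ) : Prop :=
  ∃ C : ℝ, 0 < C ∧ ∃ z₀ : ℝ, 0 < z₀ ∧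
    ∀ lam : ℂ, 3 / 2 * α.re < lam.re →
      ∀ f : ℝ × ℝ → ℂ, IsAdmissible (K * (lam.re / α.re)) f →
        ∃ g : ℝ × ℝ → ℂ, IsAdmissible (K * (lam.re / α.re)) g ∧
          (∀ p, lam * g p + linearized U g p = f p) ∧
          (∀ h : ℝ × ℝ → ℂ, IsAdmissible (K * (lam.re / α.re)) h →
            (∀ p, lam * h p + linearized U h p = f p) → h = g) ∧
          ∀ z₁ ∈ Set.Icc 0 z₀, ∀ z₂ ∈ Set.Icc 0 z₀,
            Gen g z₁ z₂ ≤ ENNReal.ofReal (C / ‖lam‖) * Gen f z₁ z₂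

/-- `W = (ωₙ)` is the sequence that starts with `ω₁ = v₁` and is constructed iteratively by
`(n α + ℒ) ωₙ = ∑_{1 ≤ j ≤ n-1} Q(u_j, ω_{n-j})`, `u_j = ∇^⊥ Δ⁻¹ ω_j`. -/
structure IsModeExpansion (U : ℝ → ℝ) (α : ℂ) (K : ℕ) (v₁ : ℝ × ℝ → ℂ)
    (W : ℕ → ℝ × ℝ → ℂ) : Prop where
  zero : W 0 = 0
  one : W 1 = v₁
  admissible : ∀ n : ℕ, IsAdmissible ((n : ℝ) * K) (W n)
  recurrence : ∀ n : ℕ, 2 ≤ n → ∀ p,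
    (n : ℂ) * α * W n p + linearized U (W n) p =
      ∑ j ∈ Finset.Icc 1 (n - 1), Q (velocity (W j)) (W (n - j)) p

/-- The sum `∑ₙ exp (n α t) ωₙ`. -/
def seriesSum (α : ℂ) (W : ℕ → ℝ × ℝ → ℂ) (t : ℝ) (p : ℝ × ℝ) : ℂ :=
  ∑' n : ℕ, Complex.exp (n * α * t) * W n p

/-- `w` is a smooth solution on the time interval `I` of the vorticity equation
`∂_t ω + ℒ ω = Q(u, ω)`, `u = ∇^⊥ Δ⁻¹ ω`, i.e. `U_s + u` solves the Euler equations. -/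
structure IsEulerPerturbation (U : ℝ → ℝ) (I : Set ℝ) (w : ℝ → ℝ × ℝ → ℂ) : Prop where
  smooth : ContDiffOn ℝ ∞ (fun q : ℝ × (ℝ × ℝ) => w q.1 q.2) (I ×ˢ Set.univ)
  torusField : ∀ t ∈ I, IsTorusField (w t)
  equation : ∀ t ∈ I, ∀ p, HasDerivWithinAt (fun s => w s p)
    (-linearized U (w t) p + Q (velocity (w t)) (w t) p) I t

/-- The iteration starting from `ω₁ = v₁` is well defined, and for all `t ≤ T₀` the series
`∑ₙ exp (n α t) ωₙ` converges (absolutely, in an analytic norm that does not depend on `t`)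
and its sum solves the vorticity equation. -/
def SeriesSolves (U : ℝ → ℝ) (α : ℂ) (K : ℕ) (v₁ : ℝ × ℝ → ℂ) (T₀ : ℝ) : Prop :=
  ∃ W : ℕ → ℝ × ℝ → ℂ, IsModeExpansion U α K v₁ W ∧
    (∀ W', IsModeExpansion U α K v₁ W' → W' = W) ∧
    (∃ ρ : ℝ, 0 < ρ ∧ ∀ t ≤ T₀,
      ∑' n : ℕ, ENNReal.ofReal (Real.exp (n * α.re * t)) * Gen (W n) ρ ρ ≠ ⊤) ∧
    (∀ t ≤ T₀, ∀ p, Summable fun n : ℕ => Complex.exp (n * α * t) * W n p) ∧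
    IsEulerPerturbation U (Set.Iic T₀) (seriesSum α W)

/-- Nonlinear instability of the shear flow in `L^∞`: arbitrarily small real perturbations (small
in `L^∞`, and even in an analytic norm) reach a size `δ` in `L^∞` that does not depend on their
initial size. -/
def NonlinearlyUnstable (U : ℝ → ℝ) : Prop :=
  ∃ δ : ℝ, 0 < δ ∧ ∃ ρ : ℝ, 0 < ρ ∧ ∀ ε : ℝ, 0 < ε →
    ∃ T : ℝ, 0 < T ∧ ∃ w : ℝ → ℝ × ℝ → ℂ,
      IsEulerPerturbation U (Set.Icc 0 T) w ∧
      (∀ t ∈ Set.Icc 0 T, ∀ p, (w t p).im = 0) ∧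
      Gen (w 0) ρ ρ ≤ ENNReal.ofReal ε ∧
      (∀ p, ‖velocity (w 0) p‖ ≤ ε) ∧
      ∃ p, δ ≤ ‖velocity (w T) p‖

end ShearFlow

end

/-!
The theorem is a Cauchy-Kovalevskaya argument in powers of `exp (α t)`, in which the generator
function plays the part of an analytic norm.

*The norm.* `Gen f z₁ z₂` is increasing in `z₁, z₂`, submultiplicative (`Gen_mul_le`: the Leibniz
rule in `y` and the convolution of the Fourier coefficients in `x`), and a derivative costs a factor
`1 / (z' - z)` when passing from `z` to `z'` (`Gen_dx_le`, `Gen_dy_le`), or just the largest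
frequency for `∂ₓ` on functions with finitely many frequencies in `x`. The Biot-Savart law is
bounded for it (`IsMultiplier.Gen_mult_le`): its symbol is square summable in the frequency in `y`,
uniformly in the frequency in `x`, so that the Bessel and Cauchy-Schwarz inequalities bound the
absolute sum of the Fourier coefficients of the velocity by the supremum of the vorticity.

*The expansion.* Inserting `∑ᵢ exp (lam i t) Wᵢ` into the equation gives a recurrence on the degree,
which (H1) solves uniquely. The nonlinear term loses one derivative, but the exponent of a term of
degree `n` has real part `n Re α`, so (H1) gains a factor `1 / n`. In degree `m` a derivative in `x`
costs the factor `m K`. For the derivative in `y`, keep `z₁ = r` fixed and let `z₂ = z` vary: with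
the bound `A (D A / (r - z)) ^ (n - 1) Cat (n - 1)` on the generator functions in degree `n`, moving
from `z` to `z + (r - z) / (m + 1)` in degree `m` costs a factor of order `m / (r - z)` too. As
`m ≤ n`, the gain `1 / n` pays for this, and what is left is the convolution recursion of the
Catalan numbers (`majorant_succ`). Hence the coefficients grow at most geometrically, with a ratio
proportional to the size `A` of the eigenmode (`ResolventBound.exists_degSum_le`). The series
converges while `exp (Re α t) A` is small: up to some time in general, and beyond time zero for
small eigenmodes.

*The sum.* The class of such sums is closed under `∂ₜ`, `∂ₓ`, `∂_y`, so they are smooth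
(`IsConvergent.contDiffOn`), and summing the recurrence with Cauchy products gives the equation
(`IsExpansion.modeSum_equation`). Complex conjugation maps expansions to expansions, so uniqueness
shows that the coefficients are real if the data are.

*Instability.* For complex `α` the real solution is the one generated by `c v` and its complex
conjugate together, an expansion with exponents `n α + m ᾱ` indexed by `(n, m)`. For this reason the
expansion is set up over an index monoid with a degree. For small `c` of suitable phase, at a point
where `v` does not vanish the terms of degree one add up and dominate the sum of all the others, so
the solution is not zero at time zero, nor is its velocity (`exists_real_solution`). Since it tends
to zero as `t → -∞` in the analytic norm, its time translates start arbitrarily small and all reach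
the same size.
-/

open Finset.HasAntidiagonal (antidiagonal)

noncomputable section

namespace ShearFlow

/-! ### Fourier coefficients of periodic functions of one variable -/

/-- The `k`-th Fourier coefficient of a function on `ℝ / 2πℤ`. -/
def coef (g : ℝ → ℂ) (k : ℤ) : ℂ :=
  ((2 * Real.pi : ℝ) : ℂ)⁻¹ *
    ∫ x in (0 : ℝ)..(2 * Real.pi), g x * Complex.exp (-(Complex.I * k * x))

theorem norm_exp_I_mul (r : ℝ) : ‖Complex.exp (Complex.I * r)‖ = 1 := by
  rw [mul_comm]; exact Complex.norm_exp_ofReal_mul_I r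

theorem norm_exp_neg_I_mul (k : ℤ) (x : ℝ) : ‖Complex.exp (-(Complex.I * k * x))‖ = 1 := by
  have := norm_exp_I_mul (-(k * x))
  rw [← this]; congr 2; push_cast; ring

theorem fourier_two_pi_apply (k : ℤ) (x : ℝ) :
    fourier k (x : AddCircle (2 * Real.pi)) = Complex.exp (Complex.I * k * x) := by
  rw [fourier_coe_apply]
  congr 1
  have : (Real.pi : ℂ) ≠ 0 := by exact_mod_cast Real.pi_ne_zero
  push_cast
  field_simp

theorem coef_eq_fourierCoeffOn (g : ℝ → ℂ) (k : ℤ) :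
    coef g k = fourierCoeffOn (a := 0) (b := 2 * Real.pi) Real.two_pi_pos g k := by
  rw [fourierCoeffOn_eq_integral, coef]
  simp only [sub_zero, one_div, Complex.real_smul, Complex.ofReal_inv, smul_eq_mul]
  congr 1
  apply intervalIntegral.integral_congr
  intro x _
  simp only
  rw [fourier_coe_apply, mul_comm]
  congr 2
  have : (Real.pi : ℂ) ≠ 0 := by exact_mod_cast Real.pi_ne_zero
  push_cast
  rw [sub_zero]
  field_simp

theorem norm_coef_le {g : ℝ → ℂ} {C : ℝ} (hC : ∀ x, ‖g x‖ ≤ C) (k : ℤ) : ‖coef g k‖ ≤ C := by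
  rw [coef, norm_mul, norm_inv, Complex.norm_real, Real.norm_of_nonneg Real.two_pi_pos.le]
  have h := intervalIntegral.norm_integral_le_of_norm_le_const (a := 0) (b := 2 * Real.pi)
    (f := fun x : ℝ => g x * Complex.exp (-(Complex.I * k * x))) (C := C) (fun x _ => by
      rw [norm_mul, norm_exp_neg_I_mul, mul_one]; exact hC x)
  rw [sub_zero, abs_of_pos Real.two_pi_pos] at h
  rw [inv_mul_le_iff₀ Real.two_pi_pos]
  linarith

theorem intervalIntegrable_mul_exp {g : ℝ → ℂ} (hg : Continuous g) (k : ℤ) (a b : ℝ) :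
    IntervalIntegrable (fun x : ℝ => g x * Complex.exp (-(Complex.I * k * x)))
      MeasureTheory.volume a b :=
  Continuous.intervalIntegrable (by fun_prop) _ _

theorem coef_add {f g : ℝ → ℂ} (hf : Continuous f) (hg : Continuous g) (k : ℤ) :
    coef (fun x => f x + g x) k = coef f k + coef g k := by
  simp only [coef, add_mul]
  rw [intervalIntegral.integral_add (intervalIntegrable_mul_exp hf k _ _)
    (intervalIntegrable_mul_exp hg k _ _), mul_add]

theorem coef_const_mul (c : ℂ) (g : ℝ → ℂ) (k : ℤ) :
    coef (fun x => c * g x) k = c * coef g k := by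
  simp only [coef, mul_assoc]
  rw [intervalIntegral.integral_const_mul]
  ring

/-- The Fourier coefficients of the derivative, by integration by parts. -/
theorem coef_of_hasDerivAt {g g' : ℝ → ℂ} (hg : ∀ x, HasDerivAt g (g' x) x) (hc : Continuous g')
    (hper : Function.Periodic g (2 * Real.pi)) (k : ℤ) :
    coef g' k = Complex.I * k * coef g k := by
  have he : ∀ x : ℝ, HasDerivAt (fun x : ℝ => Complex.exp (-(Complex.I * k * x)))
      (-(Complex.I * k) * Complex.exp (-(Complex.I * k * x))) x := by
    intro x
    have h1 : HasDerivAt (fun x : ℝ => -(Complex.I * k * (x : ℂ))) (-(Complex.I * k * 1)) x :=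
      ((Complex.ofRealCLM.hasDerivAt (x := x)).const_mul (Complex.I * k)).neg
    convert h1.cexp using 1
    ring
  have h2 : Complex.exp (-(Complex.I * k * ((2 * Real.pi : ℝ) : ℂ))) = 1 := by
    rw [Complex.exp_eq_one_iff]
    exact ⟨-k, by push_cast; ring⟩
  have h := intervalIntegral.integral_mul_deriv_eq_deriv_mul (a := 0) (b := 2 * Real.pi)
    (u := g) (v := fun x : ℝ => Complex.exp (-(Complex.I * k * x))) (u' := g')
    (v' := fun x : ℝ => -(Complex.I * k) * Complex.exp (-(Complex.I * k * x)))
    (fun x _ => hg x) (fun x _ => he x) (hc.intervalIntegrable _ _)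
    (Continuous.intervalIntegrable (by fun_prop) _ _)
  have h0 : g (2 * Real.pi) = g 0 := by simpa using hper 0
  rw [h2, h0] at h
  have h3 : ∫ x in (0 : ℝ)..(2 * Real.pi), g x * (-(Complex.I * k) *
      Complex.exp (-(Complex.I * k * x))) = -(Complex.I * k) *
      ∫ x in (0 : ℝ)..(2 * Real.pi), g x * Complex.exp (-(Complex.I * k * x)) := by
    rw [← intervalIntegral.integral_const_mul]
    congr 1; ext x; ring
  rw [h3] at h
  simp only [Complex.ofReal_zero, mul_zero, neg_zero, Complex.exp_zero, mul_one, sub_self,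
    zero_sub] at h
  rw [coef, coef]
  linear_combination ((2 * Real.pi : ℝ) : ℂ)⁻¹ * h

/-- Bessel's inequality, with the mean square bounded by the supremum. -/
theorem summable_norm_sq_coef {g : ℝ → ℂ} (hg : Continuous g) {C : ℝ} (hC : ∀ x, ‖g x‖ ≤ C) :
    Summable (fun l : ℤ => ‖coef g l‖ ^ 2) ∧ ∑' l : ℤ, ‖coef g l‖ ^ 2 ≤ C ^ 2 := by
  have hL : MeasureTheory.MemLp g 2
      (MeasureTheory.volume.restrict (Set.Ioc 0 (2 * Real.pi))) :=
    MeasureTheory.MemLp.of_bound hg.aestronglyMeasurable C (Filter.Eventually.of_forall hC)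
  have h := hasSum_sq_fourierCoeffOn Real.two_pi_pos hL
  simp only [← coef_eq_fourierCoeffOn] at h
  refine ⟨h.summable, ?_⟩
  rw [h.tsum_eq, sub_zero, smul_eq_mul, inv_mul_le_iff₀ Real.two_pi_pos]
  have : ∫ x in (0 : ℝ)..(2 * Real.pi), ‖g x‖ ^ 2 ≤ ∫ x in (0 : ℝ)..(2 * Real.pi), C ^ 2 := by
    apply intervalIntegral.integral_mono_on Real.two_pi_pos.le
    · exact Continuous.intervalIntegrable (by fun_prop) _ _
    · exact continuous_const.intervalIntegrable _ _
    · intro x _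
      exact pow_le_pow_left₀ (norm_nonneg _) (hC x) 2
  simpa using this

/-- Fourier inversion. -/
theorem hasSum_coef {g : ℝ → ℂ} (hg : Continuous g) (hper : Function.Periodic g (2 * Real.pi))
    (hs : Summable (coef g)) (x : ℝ) :
    HasSum (fun k : ℤ => coef g k * Complex.exp (Complex.I * k * x)) (g x) := by
  have : Fact (0 < 2 * Real.pi) := ⟨Real.two_pi_pos⟩
  let G : C(AddCircle (2 * Real.pi), ℂ) := ⟨hper.lift, by
    exact continuous_coinduced_dom.mpr hg⟩
  have hG : ∀ k, fourierCoeff (G : AddCircle (2 * Real.pi) → ℂ) k = coef g k := by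
    intro k
    rw [fourierCoeff_eq_intervalIntegral _ _ 0, coef]
    simp only [zero_add, one_div, Complex.real_smul, Complex.ofReal_inv, smul_eq_mul]
    congr 1
    apply intervalIntegral.integral_congr
    intro x _
    simp only
    rw [fourier_two_pi_apply (-k) x, mul_comm]
    congr 2
    push_cast
    ring
  have h := has_pointwise_sum_fourier_series_of_summable (f := G)
    (by rw [funext hG]; exact hs) (x : AddCircle (2 * Real.pi))
  simp only [hG, smul_eq_mul, fourier_two_pi_apply] at h
  exact h

/-- Fourier coefficients may be computed termwise in a normally convergent series. -/
theorem hasSum_coef_tsum {ι : Type*} [Countable ι] {g : ι → ℝ → ℂ} (hg : ∀ i, Continuous (g i))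
    {u : ι → ℝ} (hu : Summable u) (hb : ∀ i x, ‖g i x‖ ≤ u i) (k : ℤ) :
    HasSum (fun i => coef (g i) k) (coef (fun x => ∑' i, g i x) k) := by
  unfold coef
  apply HasSum.mul_left
  apply intervalIntegral.hasSum_integral_of_dominated_convergence (fun i _ => u i)
  · intro i
    have := hg i
    exact Continuous.aestronglyMeasurable (by fun_prop)
  · intro i
    refine Filter.Eventually.of_forall fun x _ => ?_
    rw [norm_mul, norm_exp_neg_I_mul, mul_one]; exact hb i x
  · exact Filter.Eventually.of_forall fun x _ => hu
  · exact intervalIntegrable_const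
  · refine Filter.Eventually.of_forall fun x _ => ?_
    exact (Summable.of_norm_bounded hu (fun i => hb i x)).hasSum.mul_right _

theorem coef_exp (j k : ℤ) :
    coef (fun x : ℝ => Complex.exp (Complex.I * j * x)) k = if j = k then 1 else 0 := by
  have hp : ((2 * Real.pi : ℝ) : ℂ) ≠ 0 := by exact_mod_cast Real.two_pi_pos.ne'
  split_ifs with h
  · subst h
    unfold coef
    have : ∀ x : ℝ, Complex.exp (Complex.I * j * x) * Complex.exp (-(Complex.I * j * x)) = 1 := by
      intro x; rw [← Complex.exp_add]; simp
    simp only [this]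
    rw [intervalIntegral.integral_const, sub_zero, Complex.real_smul, mul_one,
      inv_mul_cancel₀ hp]
  · have hper : Function.Periodic (fun x : ℝ => Complex.exp (Complex.I * j * x))
        (2 * Real.pi) := by
      intro x
      simp only
      rw [Complex.exp_eq_exp_iff_exists_int]
      exact ⟨j, by push_cast; ring⟩
    have hd : ∀ x : ℝ, HasDerivAt (fun x : ℝ => Complex.exp (Complex.I * j * x))
        ((Complex.I * j) * Complex.exp (Complex.I * j * x)) x := by
      intro x
      have h1 : HasDerivAt (fun x : ℝ => (Complex.I * j * (x : ℂ))) (Complex.I * j * 1) x :=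
        ((Complex.ofRealCLM.hasDerivAt (x := x)).const_mul (Complex.I * j))
      convert h1.cexp using 1
      ring
    have h1 := coef_of_hasDerivAt hd (by fun_prop) hper k
    rw [coef_const_mul] at h1
    have h2 : (Complex.I * ((j : ℂ) - k)) *
        coef (fun x : ℝ => Complex.exp (Complex.I * j * x)) k = 0 := by
      linear_combination h1
    rcases mul_eq_zero.mp h2 with h3 | h3
    · exfalso
      rcases mul_eq_zero.mp h3 with h4 | h4
      · exact Complex.I_ne_zero h4
      · apply h
        exact_mod_cast sub_eq_zero.mp h4
    · exact h3

theorem coef_conj (g : ℝ → ℂ) (k : ℤ) :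
    coef (fun x => (starRingEnd ℂ) (g x)) k = (starRingEnd ℂ) (coef g (-k)) := by
  unfold coef
  rw [map_mul, ← intervalIntegral.intervalIntegral_conj]
  simp only [map_mul, map_inv₀, Complex.conj_ofReal]
  congr 1
  apply intervalIntegral.integral_congr
  intro x _
  simp only
  rw [← Complex.exp_conj]
  congr 2
  simp [Complex.conj_ofReal]

/-! ### Smooth functions on the torus -/

/-- Smooth functions on the torus, without the zero mean condition of `IsTorusField`. -/
structure IsSmoothPeriodic (f : ℝ × ℝ → ℂ) : Prop where
  smooth : ContDiff ℝ ∞ f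
  periodic_x : ∀ x y, f (x + 2 * Real.pi, y) = f (x, y)
  periodic_y : ∀ x y, f (x, y + 2 * Real.pi) = f (x, y)

theorem IsTorusField.isSmoothPeriodic {f : ℝ × ℝ → ℂ} (hf : IsTorusField f) :
    IsSmoothPeriodic f := ⟨hf.smooth, hf.periodic_x, hf.periodic_y⟩

theorem hasFDerivAt_dx {f : ℝ × ℝ → ℂ} {L : ℝ × ℝ →L[ℝ] ℂ} {p : ℝ × ℝ}
    (h : HasFDerivAt f L p) : HasDerivAt (fun s => f (s, p.2)) (L (1, 0)) p.1 := by
  have h1 : HasDerivAt (fun s : ℝ => (s, p.2)) ((1 : ℝ), (0 : ℝ)) p.1 :=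
    (hasDerivAt_id p.1).prodMk (hasDerivAt_const p.1 p.2)
  exact HasFDerivAt.comp_hasDerivAt (f := fun s : ℝ => (s, p.2)) (l := f) p.1 h h1

theorem hasFDerivAt_dy {f : ℝ × ℝ → ℂ} {L : ℝ × ℝ →L[ℝ] ℂ} {p : ℝ × ℝ}
    (h : HasFDerivAt f L p) : HasDerivAt (fun s => f (p.1, s)) (L (0, 1)) p.2 := by
  have h1 : HasDerivAt (fun s : ℝ => (p.1, s)) ((0 : ℝ), (1 : ℝ)) p.2 :=
    (hasDerivAt_const p.2 p.1).prodMk (hasDerivAt_id p.2)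
  exact HasFDerivAt.comp_hasDerivAt (f := fun s : ℝ => (p.1, s)) (l := f) p.2 h h1

theorem dx_eq_of_hasFDerivAt {f : ℝ × ℝ → ℂ} {L : ℝ × ℝ →L[ℝ] ℂ} {p : ℝ × ℝ}
    (h : HasFDerivAt f L p) : dx f p = L (1, 0) := (hasFDerivAt_dx h).deriv

theorem dy_eq_of_hasFDerivAt {f : ℝ × ℝ → ℂ} {L : ℝ × ℝ →L[ℝ] ℂ} {p : ℝ × ℝ}
    (h : HasFDerivAt f L p) : dy f p = L (0, 1) := (hasFDerivAt_dy h).deriv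

namespace IsSmoothPeriodic

variable {f g : ℝ × ℝ → ℂ}

theorem hasFDerivAt_fderiv (hf : IsSmoothPeriodic f) (p : ℝ × ℝ) :
    HasFDerivAt f (fderiv ℝ f p) p :=
  (hf.smooth.differentiable (by simp) p).hasFDerivAt

theorem dx_eq (hf : IsSmoothPeriodic f) : dx f = fun p => fderiv ℝ f p (1, 0) := by
  ext p; exact dx_eq_of_hasFDerivAt (hf.hasFDerivAt_fderiv p)

theorem dy_eq (hf : IsSmoothPeriodic f) : dy f = fun p => fderiv ℝ f p (0, 1) := by
  ext p; exact dy_eq_of_hasFDerivAt (hf.hasFDerivAt_fderiv p)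

theorem hasFDerivAt (hf : IsSmoothPeriodic f) (p : ℝ × ℝ) :
    HasFDerivAt f ((ContinuousLinearMap.fst ℝ ℝ ℝ).smulRight (dx f p) +
      (ContinuousLinearMap.snd ℝ ℝ ℝ).smulRight (dy f p)) p := by
  have h := hf.hasFDerivAt_fderiv p
  convert h using 1
  rw [hf.dx_eq, hf.dy_eq]
  ext <;> simp

theorem hasDerivAt_x (hf : IsSmoothPeriodic f) (x y : ℝ) :
    HasDerivAt (fun s => f (s, y)) (dx f (x, y)) x := by
  have := hasFDerivAt_dx (hf.hasFDerivAt (x, y)); simpa using this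

theorem hasDerivAt_y (hf : IsSmoothPeriodic f) (x y : ℝ) :
    HasDerivAt (fun s => f (x, s)) (dy f (x, y)) y := by
  have := hasFDerivAt_dy (hf.hasFDerivAt (x, y)); simpa using this

theorem continuous (hf : IsSmoothPeriodic f) : Continuous f := hf.smooth.continuous

theorem dx (hf : IsSmoothPeriodic f) : IsSmoothPeriodic (dx f) where
  smooth := by
    rw [hf.dx_eq]
    exact (hf.smooth.fderiv_right (m := ∞) (by simp)).clm_apply contDiff_const
  periodic_x x y := by
    have h1 := hf.hasDerivAt_x (x + 2 * Real.pi) y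
    have h2 := h1.comp_add_const x (2 * Real.pi)
    simp only [hf.periodic_x] at h2
    exact h2.unique (hf.hasDerivAt_x x y)
  periodic_y x y := by
    have h1 := hf.hasDerivAt_x x (y + 2 * Real.pi)
    simp only [hf.periodic_y] at h1
    exact h1.unique (hf.hasDerivAt_x x y)

theorem dy (hf : IsSmoothPeriodic f) : IsSmoothPeriodic (dy f) where
  smooth := by
    rw [hf.dy_eq]
    exact (hf.smooth.fderiv_right (m := ∞) (by simp)).clm_apply contDiff_const
  periodic_y x y := by
    have h1 := hf.hasDerivAt_y x (y + 2 * Real.pi)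
    have h2 := h1.comp_add_const y (2 * Real.pi)
    simp only [hf.periodic_y] at h2
    exact h2.unique (hf.hasDerivAt_y x y)
  periodic_x x y := by
    have h1 := hf.hasDerivAt_y (x + 2 * Real.pi) y
    simp only [hf.periodic_x] at h1
    exact h1.unique (hf.hasDerivAt_y x y)

theorem iterate_dx (hf : IsSmoothPeriodic f) (n : ℕ) : IsSmoothPeriodic (ShearFlow.dx^[n] f) := by
  induction n with
  | zero => exact hf
  | succ n ih => rw [Function.iterate_succ_apply']; exact ih.dx

theorem iterate_dy (hf : IsSmoothPeriodic f) (n : ℕ) : IsSmoothPeriodic (ShearFlow.dy^[n] f) := by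
  induction n with
  | zero => exact hf
  | succ n ih => rw [Function.iterate_succ_apply']; exact ih.dy

theorem add (hf : IsSmoothPeriodic f) (hg : IsSmoothPeriodic g) :
    IsSmoothPeriodic (fun p => f p + g p) :=
  ⟨hf.smooth.add hg.smooth, fun x y => by simp only [hf.periodic_x, hg.periodic_x],
    fun x y => by simp only [hf.periodic_y, hg.periodic_y]⟩

theorem mul (hf : IsSmoothPeriodic f) (hg : IsSmoothPeriodic g) :
    IsSmoothPeriodic (fun p => f p * g p) :=
  ⟨hf.smooth.mul hg.smooth, fun x y => by simp only [hf.periodic_x, hg.periodic_x],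
    fun x y => by simp only [hf.periodic_y, hg.periodic_y]⟩

theorem zero : IsSmoothPeriodic (fun _ => 0) :=
  ⟨contDiff_const, fun _ _ => rfl, fun _ _ => rfl⟩

theorem const_mul (c : ℂ) (hf : IsSmoothPeriodic f) : IsSmoothPeriodic (fun p => c * f p) :=
  ⟨contDiff_const.mul hf.smooth, fun x y => by simp only [hf.periodic_x],
    fun x y => by simp only [hf.periodic_y]⟩

theorem neg (hf : IsSmoothPeriodic f) : IsSmoothPeriodic (fun p => -f p) :=
  ⟨hf.smooth.neg, fun x y => by simp only [hf.periodic_x],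
    fun x y => by simp only [hf.periodic_y]⟩

theorem conj (hf : IsSmoothPeriodic f) : IsSmoothPeriodic (fun p => (starRingEnd ℂ) (f p)) :=
  ⟨Complex.conjCLE.contDiff.comp hf.smooth, fun x y => by simp only [hf.periodic_x],
    fun x y => by simp only [hf.periodic_y]⟩

theorem dy_add (hf : IsSmoothPeriodic f) (hg : IsSmoothPeriodic g) :
    ShearFlow.dy (fun p => f p + g p) = fun p => ShearFlow.dy f p + ShearFlow.dy g p := by
  ext p; exact ((hf.hasDerivAt_y p.1 p.2).add (hg.hasDerivAt_y p.1 p.2)).deriv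

theorem dx_mul (hf : IsSmoothPeriodic f) (hg : IsSmoothPeriodic g) :
    ShearFlow.dx (fun p => f p * g p) =
      fun p => ShearFlow.dx f p * g p + f p * ShearFlow.dx g p := by
  ext p; exact ((hf.hasDerivAt_x p.1 p.2).mul (hg.hasDerivAt_x p.1 p.2)).deriv

theorem dy_mul (hf : IsSmoothPeriodic f) (hg : IsSmoothPeriodic g) :
    ShearFlow.dy (fun p => f p * g p) =
      fun p => ShearFlow.dy f p * g p + f p * ShearFlow.dy g p := by
  ext p; exact ((hf.hasDerivAt_y p.1 p.2).mul (hg.hasDerivAt_y p.1 p.2)).deriv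

theorem dx_const_mul (c : ℂ) (hf : IsSmoothPeriodic f) :
    ShearFlow.dx (fun p => c * f p) = fun p => c * ShearFlow.dx f p := by
  ext p; exact ((hf.hasDerivAt_x p.1 p.2).const_mul c).deriv

theorem dy_const_mul (c : ℂ) (hf : IsSmoothPeriodic f) :
    ShearFlow.dy (fun p => c * f p) = fun p => c * ShearFlow.dy f p := by
  ext p; exact ((hf.hasDerivAt_y p.1 p.2).const_mul c).deriv

theorem dx_conj (hf : IsSmoothPeriodic f) :
    ShearFlow.dx (fun p => (starRingEnd ℂ) (f p)) =
      fun p => (starRingEnd ℂ) (ShearFlow.dx f p) := by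
  ext p
  exact (Complex.conjCLE.toContinuousLinearMap.hasFDerivAt.comp_hasDerivAt p.1
    (hf.hasDerivAt_x p.1 p.2)).deriv

theorem dy_conj (hf : IsSmoothPeriodic f) :
    ShearFlow.dy (fun p => (starRingEnd ℂ) (f p)) =
      fun p => (starRingEnd ℂ) (ShearFlow.dy f p) := by
  ext p
  exact (Complex.conjCLE.toContinuousLinearMap.hasFDerivAt.comp_hasDerivAt p.2
    (hf.hasDerivAt_y p.1 p.2)).deriv

/-- Smooth functions on the torus are bounded, by compactness of a period cell. -/
theorem exists_bound (hf : IsSmoothPeriodic f) : ∃ C : ℝ, 0 ≤ C ∧ ∀ p, ‖f p‖ ≤ C := by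
  obtain ⟨C, hC⟩ := (isCompact_Icc (a := (0 : ℝ)) (b := 2 * Real.pi)).prod
    (isCompact_Icc (a := (0 : ℝ)) (b := 2 * Real.pi)) |>.exists_bound_of_continuousOn
    hf.continuous.continuousOn
  have h0 : ∀ p, ‖f p‖ ≤ C := by
    rintro ⟨x, y⟩
    have hx : Function.Periodic (fun x => f (x, y)) (2 * Real.pi) := fun x => hf.periodic_x x y
    obtain ⟨x', hx', hxe⟩ := hx.exists_mem_Ico₀ Real.two_pi_pos x
    have hy : Function.Periodic (fun y => f (x', y)) (2 * Real.pi) := fun y => hf.periodic_y x' y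
    obtain ⟨y', hy', hye⟩ := hy.exists_mem_Ico₀ Real.two_pi_pos y
    rw [show f (x, y) = f (x', y) from hxe, show f (x', y) = f (x', y') from hye]
    exact hC (x', y') ⟨Set.Ico_subset_Icc_self hx', Set.Ico_subset_Icc_self hy'⟩
  exact ⟨C, (norm_nonneg _).trans (h0 (0, 0)), h0⟩

theorem fourierX_eq (f : ℝ × ℝ → ℂ) (k : ℤ) (y : ℝ) :
    fourierX f k y = coef (fun x => f (x, y)) k := rfl

theorem fourierXY_eq (f : ℝ × ℝ → ℂ) (k l : ℤ) :
    fourierXY f k l = coef (fourierX f k) l := rfl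

theorem fourierX_dx (hf : IsSmoothPeriodic f) (k : ℤ) (y : ℝ) :
    fourierX (ShearFlow.dx f) k y = Complex.I * k * fourierX f k y := by
  rw [fourierX_eq, fourierX_eq]
  exact coef_of_hasDerivAt (fun x => hf.hasDerivAt_x x y)
    (hf.dx.continuous.comp (by fun_prop)) (fun x => hf.periodic_x x y) k

theorem hasDerivAt_fourierX (hf : IsSmoothPeriodic f) (k : ℤ) (y : ℝ) :
    HasDerivAt (fourierX f k) (fourierX (ShearFlow.dy f) k y) y := by
  unfold fourierX
  apply HasDerivAt.const_mul
  obtain ⟨C, -, hC⟩ := hf.dy.exists_bound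
  have hc : ∀ y : ℝ, Continuous fun x : ℝ => f (x, y) * Complex.exp (-(Complex.I * k * x)) := by
    intro y
    have := hf.continuous
    fun_prop
  have hc' : Continuous fun x : ℝ => ShearFlow.dy f (x, y) *
      Complex.exp (-(Complex.I * k * x)) := by
    have := hf.dy.continuous
    fun_prop
  refine (intervalIntegral.hasDerivAt_integral_of_dominated_loc_of_deriv_le
    (F := fun y x => f (x, y) * Complex.exp (-(Complex.I * k * x)))
    (F' := fun y x => ShearFlow.dy f (x, y) * Complex.exp (-(Complex.I * k * x)))
    (bound := fun _ => C) (s := Set.univ) Filter.univ_mem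
    (Filter.Eventually.of_forall fun y => (hc y).aestronglyMeasurable)
    ((hc y).intervalIntegrable _ _) hc'.aestronglyMeasurable
    (Filter.Eventually.of_forall fun x _ y _ => ?_) intervalIntegrable_const
    (Filter.Eventually.of_forall fun x _ y _ => ?_)).2
  · rw [norm_mul, norm_exp_neg_I_mul, mul_one]; exact hC _
  · exact (hf.hasDerivAt_y x y).mul_const _

theorem continuous_fourierX (hf : IsSmoothPeriodic f) (k : ℤ) : Continuous (fourierX f k) :=
  continuous_iff_continuousAt.mpr fun y => (hf.hasDerivAt_fourierX k y).continuousAt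

theorem periodic_fourierX (hf : IsSmoothPeriodic f) (k : ℤ) :
    Function.Periodic (fourierX f k) (2 * Real.pi) := by
  intro y
  simp only [fourierX, hf.periodic_y]

theorem iteratedDeriv_fourierX (hf : IsSmoothPeriodic f) (k : ℤ) (l : ℕ) :
    iteratedDeriv l (fourierX f k) = fourierX (ShearFlow.dy^[l] f) k := by
  induction l with
  | zero => simp
  | succ l ih =>
    rw [iteratedDeriv_succ, ih, Function.iterate_succ_apply']
    ext y
    exact ((hf.iterate_dy l).hasDerivAt_fourierX k y).deriv

theorem norm_fourierX_le {C : ℝ} (hC : ∀ p, ‖f p‖ ≤ C) (k : ℤ) (y : ℝ) : ‖fourierX f k y‖ ≤ C :=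
  norm_coef_le (fun _ => hC _) k

theorem norm_fourierXY_le {C : ℝ} (hC : ∀ p, ‖f p‖ ≤ C) (k l : ℤ) : ‖fourierXY f k l‖ ≤ C :=
  norm_coef_le (fun y => norm_fourierX_le hC k y) l

theorem fourierXY_dx (hf : IsSmoothPeriodic f) (k l : ℤ) :
    fourierXY (ShearFlow.dx f) k l = Complex.I * k * fourierXY f k l := by
  rw [fourierXY_eq, fourierXY_eq, ← coef_const_mul]
  congr 1
  ext y
  exact hf.fourierX_dx k y

theorem fourierXY_dy (hf : IsSmoothPeriodic f) (k l : ℤ) :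
    fourierXY (ShearFlow.dy f) k l = Complex.I * l * fourierXY f k l := by
  rw [fourierXY_eq, fourierXY_eq]
  exact coef_of_hasDerivAt (fun y => hf.hasDerivAt_fourierX k y) (hf.dy.continuous_fourierX k)
    (hf.periodic_fourierX k) l

theorem fourierX_add (hf : IsSmoothPeriodic f) (hg : IsSmoothPeriodic g) (k : ℤ) (y : ℝ) :
    fourierX (fun p => f p + g p) k y = fourierX f k y + fourierX g k y :=
  coef_add (hf.continuous.comp (by fun_prop)) (hg.continuous.comp (by fun_prop)) k

theorem fourierX_const_mul (c : ℂ) (f : ℝ × ℝ → ℂ) (k : ℤ) (y : ℝ) :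
    fourierX (fun p => c * f p) k y = c * fourierX f k y := coef_const_mul _ _ k

theorem fourierXY_const_mul (c : ℂ) (f : ℝ × ℝ → ℂ) (k l : ℤ) :
    fourierXY (fun p => c * f p) k l = c * fourierXY f k l := by
  rw [fourierXY_eq, fourierXY_eq, ← coef_const_mul]; congr 1; ext y
  exact fourierX_const_mul c f k y

theorem fourierX_conj (f : ℝ × ℝ → ℂ) (k : ℤ) (y : ℝ) :
    fourierX (fun p => (starRingEnd ℂ) (f p)) k y = (starRingEnd ℂ) (fourierX f (-k) y) :=
  coef_conj _ k

theorem fourierXY_conj (f : ℝ × ℝ → ℂ) (k l : ℤ) :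
    fourierXY (fun p => (starRingEnd ℂ) (f p)) k l = (starRingEnd ℂ) (fourierXY f (-k) (-l)) := by
  rw [fourierXY_eq, fourierXY_eq, ← coef_conj]; congr 1; ext y
  exact fourierX_conj f k y

end IsSmoothPeriodic

theorem fourierXY_zero_zero (f : ℝ × ℝ → ℂ) :
    fourierXY f 0 0 = ((2 * Real.pi : ℝ) : ℂ)⁻¹ * (((2 * Real.pi : ℝ) : ℂ)⁻¹ *
      ∫ y in (0 : ℝ)..(2 * Real.pi), ∫ x in (0 : ℝ)..(2 * Real.pi), f (x, y)) := by
  simp [fourierXY, fourierX]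

theorem IsSmoothPeriodic.isTorusField_iff {f : ℝ × ℝ → ℂ} (hf : IsSmoothPeriodic f) :
    IsTorusField f ↔ fourierXY f 0 0 = 0 := by
  have hp : ((2 * Real.pi : ℝ) : ℂ)⁻¹ ≠ 0 :=
    inv_ne_zero (by exact_mod_cast Real.two_pi_pos.ne')
  rw [fourierXY_zero_zero]
  constructor
  · intro h; rw [h.mean_zero]; simp
  · intro h
    refine ⟨hf.smooth, hf.periodic_x, hf.periodic_y, ?_⟩
    simpa [hp] using h

/-! ### Trigonometric series and Fourier inversion -/

/-- A class of functions whose derivatives are combinations, with constant coefficients, of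
functions of the same class consists of smooth functions. -/
theorem contDiffOn_of_class {E : Type*} [NormedAddCommGroup E] [NormedSpace ℝ E] {s : Set E}
    (hs : IsOpen s) (𝒞 : Set (E → ℂ))
    (h : ∀ F ∈ 𝒞, ∃ (m : ℕ) (G : Fin m → E → ℂ) (L : Fin m → E →L[ℝ] ℝ), (∀ j, G j ∈ 𝒞) ∧
      ∀ x ∈ s, HasFDerivAt F (∑ j, (L j).smulRight (G j x)) x) :
    ∀ F ∈ 𝒞, ContDiffOn ℝ ∞ F s := by
  have key : ∀ n : ℕ, ∀ F ∈ 𝒞, ContDiffOn ℝ n F s := by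
    intro n
    induction n with
    | zero =>
      intro F hF
      obtain ⟨m, G, L, -, hd⟩ := h F hF
      rw [Nat.cast_zero, contDiffOn_zero]
      exact fun x hx => (hd x hx).continuousAt.continuousWithinAt
    | succ n ih =>
      intro F hF
      obtain ⟨m, G, L, hG, hd⟩ := h F hF
      rw [Nat.cast_add, Nat.cast_one, contDiffOn_succ_iff_fderiv_of_isOpen hs]
      refine ⟨fun x hx => (hd x hx).differentiableAt.differentiableWithinAt, by simp, ?_⟩
      have h1 : ContDiffOn ℝ n (fun x => ∑ j, (L j).smulRight (G j x)) s := by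
        apply ContDiffOn.sum
        intro j _
        exact (ContinuousLinearMap.smulRightL ℝ E ℂ (L j)).contDiff.comp_contDiffOn
          (ih (G j) (hG j))
      exact h1.congr fun x hx => (hd x hx).fderiv
  intro F hF
  rw [contDiffOn_infty]
  exact fun n => key n F hF

/-- The size `1 + |k| + |l|` of a frequency. -/
def freqSize (m : ℤ × ℤ) : ℝ := 1 + |(m.1 : ℝ)| + |(m.2 : ℝ)|

theorem one_le_freqSize (m : ℤ × ℤ) : 1 ≤ freqSize m := by
  have := abs_nonneg (m.1 : ℝ); have := abs_nonneg (m.2 : ℝ); unfold freqSize; linarith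

theorem freqSize_nonneg (m : ℤ × ℤ) : 0 ≤ freqSize m := zero_le_one.trans (one_le_freqSize m)

theorem norm_fst_le_freqSize (m : ℤ × ℤ) : ‖Complex.I * (m.1 : ℂ)‖ ≤ freqSize m := by
  have := abs_nonneg (m.2 : ℝ)
  rw [norm_mul, Complex.norm_I, one_mul, Complex.norm_intCast, freqSize]; linarith

theorem norm_snd_le_freqSize (m : ℤ × ℤ) : ‖Complex.I * (m.2 : ℂ)‖ ≤ freqSize m := by
  have := abs_nonneg (m.1 : ℝ)
  rw [norm_mul, Complex.norm_I, one_mul, Complex.norm_intCast, freqSize]; linarith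

/-- Families of Fourier coefficients that decay faster than every power of the frequency. -/
def RapidDecay (c : ℤ × ℤ → ℂ) : Prop :=
  ∀ N : ℕ, Summable fun m => freqSize m ^ N * ‖c m‖

theorem RapidDecay.summable_norm {c : ℤ × ℤ → ℂ} (hc : RapidDecay c) :
    Summable fun m => ‖c m‖ := by simpa using hc 0

theorem RapidDecay.mul {a c : ℤ × ℤ → ℂ} (hc : RapidDecay c)
    (ha : ∀ m, ‖a m‖ ≤ freqSize m) : RapidDecay fun m => a m * c m := by
  intro N
  refine Summable.of_nonneg_of_le
    (fun m => mul_nonneg (pow_nonneg (freqSize_nonneg m) _) (norm_nonneg _)) (fun m => ?_)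
    (hc (N + 1))
  rw [norm_mul, pow_succ, mul_assoc]
  have := freqSize_nonneg m
  have := ha m
  gcongr

/-- The double Fourier coefficients, as a function on `ℤ × ℤ`. -/
abbrev fourierPair (f : ℝ × ℝ → ℂ) (m : ℤ × ℤ) : ℂ := fourierXY f m.1 m.2

/-- The trigonometric series with coefficients `c`. -/
def trigSeries (c : ℤ × ℤ → ℂ) (p : ℝ × ℝ) : ℂ :=
  ∑' m : ℤ × ℤ, c m * Complex.exp (Complex.I * (m.1 * p.1 + m.2 * p.2))

theorem norm_trig (m : ℤ × ℤ) (p : ℝ × ℝ) :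
    ‖Complex.exp (Complex.I * (m.1 * p.1 + m.2 * p.2))‖ = 1 := by
  have := norm_exp_I_mul (m.1 * p.1 + m.2 * p.2)
  rw [← this]; congr 2; push_cast; ring

theorem summable_trig {c : ℤ × ℤ → ℂ} (hc : Summable fun m => ‖c m‖) (p : ℝ × ℝ) :
    Summable fun m : ℤ × ℤ => c m * Complex.exp (Complex.I * (m.1 * p.1 + m.2 * p.2)) :=
  Summable.of_norm (by simpa only [norm_mul, norm_trig, mul_one] using hc)

theorem hasFDerivAt_trig (c : ℂ) (m : ℤ × ℤ) (p : ℝ × ℝ) :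
    HasFDerivAt (fun p : ℝ × ℝ => c * Complex.exp (Complex.I * (m.1 * p.1 + m.2 * p.2)))
      ((ContinuousLinearMap.fst ℝ ℝ ℝ).smulRight (Complex.I * m.1 * c *
          Complex.exp (Complex.I * (m.1 * p.1 + m.2 * p.2))) +
        (ContinuousLinearMap.snd ℝ ℝ ℝ).smulRight (Complex.I * m.2 * c *
          Complex.exp (Complex.I * (m.1 * p.1 + m.2 * p.2)))) p := by
  have h1 : HasFDerivAt (fun p : ℝ × ℝ => (p.1 : ℂ))
      (Complex.ofRealCLM.comp (ContinuousLinearMap.fst ℝ ℝ ℝ)) p :=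
    (Complex.ofRealCLM.comp (ContinuousLinearMap.fst ℝ ℝ ℝ)).hasFDerivAt
  have h2 : HasFDerivAt (fun p : ℝ × ℝ => (p.2 : ℂ))
      (Complex.ofRealCLM.comp (ContinuousLinearMap.snd ℝ ℝ ℝ)) p :=
    (Complex.ofRealCLM.comp (ContinuousLinearMap.snd ℝ ℝ ℝ)).hasFDerivAt
  have h := ((((h1.const_mul (m.1 : ℂ)).add (h2.const_mul (m.2 : ℂ))).const_mul
    Complex.I).cexp).const_mul c
  refine h.congr_fderiv ?_
  ext <;> simp <;> ring

theorem hasFDerivAt_trigSeries {c : ℤ × ℤ → ℂ} (hc : RapidDecay c) (p : ℝ × ℝ) :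
    HasFDerivAt (trigSeries c)
      ((ContinuousLinearMap.fst ℝ ℝ ℝ).smulRight (trigSeries (fun m => Complex.I * m.1 * c m) p) +
        (ContinuousLinearMap.snd ℝ ℝ ℝ).smulRight
          (trigSeries (fun m => Complex.I * m.2 * c m) p)) p := by
  have h := hasFDerivAt_tsum (𝕜 := ℝ) (u := fun m => 2 * (freqSize m ^ 1 * ‖c m‖))
    ((hc 1).mul_left 2) (fun m p => hasFDerivAt_trig (c m) m p) (fun m p => ?_)
    (x₀ := (0, 0)) (summable_trig hc.summable_norm _) p
  · refine h.congr_fderiv ?_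
    have h1 := summable_trig (hc.mul norm_fst_le_freqSize).summable_norm p
    have h2 := summable_trig (hc.mul norm_snd_le_freqSize).summable_norm p
    have e1 := (ContinuousLinearMap.smulRightL ℝ (ℝ × ℝ) ℂ
      (ContinuousLinearMap.fst ℝ ℝ ℝ)).hasSum h1.hasSum
    have e2 := (ContinuousLinearMap.smulRightL ℝ (ℝ × ℝ) ℂ
      (ContinuousLinearMap.snd ℝ ℝ ℝ)).hasSum h2.hasSum
    exact (e1.add e2).tsum_eq
  · have hb : ∀ z : ℂ, ‖z‖ ≤ freqSize m → ∀ L : ℝ × ℝ →L[ℝ] ℝ, ‖L‖ ≤ 1 →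
        ‖L.smulRight (z * c m * Complex.exp (Complex.I * (m.1 * p.1 + m.2 * p.2)))‖ ≤
          freqSize m ^ 1 * ‖c m‖ := by
      intro z hz L hL
      rw [ContinuousLinearMap.norm_smulRight_apply, norm_mul, norm_mul, norm_trig, mul_one, pow_one]
      calc ‖L‖ * (‖z‖ * ‖c m‖) ≤ 1 * (freqSize m * ‖c m‖) := by gcongr
        _ = _ := one_mul _
    refine (norm_add_le _ _).trans ?_
    rw [two_mul]
    exact add_le_add (hb _ (norm_fst_le_freqSize m) _ (ContinuousLinearMap.norm_fst_le ℝ ℝ ℝ))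
      (hb _ (norm_snd_le_freqSize m) _ (ContinuousLinearMap.norm_snd_le ℝ ℝ ℝ))

theorem dx_trigSeries {c : ℤ × ℤ → ℂ} (hc : RapidDecay c) :
    dx (trigSeries c) = trigSeries fun m => Complex.I * m.1 * c m := by
  ext p; rw [dx_eq_of_hasFDerivAt (hasFDerivAt_trigSeries hc p)]; simp

theorem dy_trigSeries {c : ℤ × ℤ → ℂ} (hc : RapidDecay c) :
    dy (trigSeries c) = trigSeries fun m => Complex.I * m.2 * c m := by
  ext p; rw [dy_eq_of_hasFDerivAt (hasFDerivAt_trigSeries hc p)]; simp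

theorem RapidDecay.isSmoothPeriodic {c : ℤ × ℤ → ℂ} (hc : RapidDecay c) :
    IsSmoothPeriodic (trigSeries c) where
  smooth := by
    rw [← contDiffOn_univ]
    refine contDiffOn_of_class isOpen_univ {F | ∃ c, RapidDecay c ∧ F = trigSeries c} ?_ _
      ⟨c, hc, rfl⟩
    rintro F ⟨c, hc, rfl⟩
    refine ⟨2, ![trigSeries (fun m => Complex.I * m.1 * c m),
      trigSeries (fun m => Complex.I * m.2 * c m)], ![ContinuousLinearMap.fst ℝ ℝ ℝ,
      ContinuousLinearMap.snd ℝ ℝ ℝ], ?_, ?_⟩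
    · intro j
      fin_cases j
      · exact ⟨_, hc.mul norm_fst_le_freqSize, rfl⟩
      · exact ⟨_, hc.mul norm_snd_le_freqSize, rfl⟩
    · intro x _
      simpa [Fin.sum_univ_two] using hasFDerivAt_trigSeries hc x
  periodic_x x y := by
    unfold trigSeries
    congr 1; ext m; congr 1
    rw [Complex.exp_eq_exp_iff_exists_int]
    exact ⟨m.1, by push_cast; ring⟩
  periodic_y x y := by
    unfold trigSeries
    congr 1; ext m; congr 1
    rw [Complex.exp_eq_exp_iff_exists_int]
    exact ⟨m.2, by push_cast; ring⟩

theorem coef_trig (c : ℂ) (m : ℤ × ℤ) (k : ℤ) (y : ℝ) :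
    coef (fun x : ℝ => c * Complex.exp (Complex.I * (m.1 * x + m.2 * y))) k =
      (if m.1 = k then c else 0) * Complex.exp (Complex.I * m.2 * y) := by
  have : (fun x : ℝ => c * Complex.exp (Complex.I * (m.1 * x + m.2 * y))) =
      fun x : ℝ => (c * Complex.exp (Complex.I * m.2 * y)) *
        Complex.exp (Complex.I * m.1 * x) := by
    ext x; rw [mul_assoc, ← Complex.exp_add]; congr 2; ring
  rw [this, coef_const_mul, coef_exp]
  split_ifs <;> ring

theorem fourierXY_trigSeries {c : ℤ × ℤ → ℂ} (hc : Summable fun m => ‖c m‖) (k l : ℤ) :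
    fourierXY (trigSeries c) k l = c (k, l) := by
  have h1 : fourierX (trigSeries c) k = fun y : ℝ => ∑' m : ℤ × ℤ,
      (if m.1 = k then c m else 0) * Complex.exp (Complex.I * m.2 * y) := by
    ext y
    have h := hasSum_coef_tsum
      (g := fun m x => c m * Complex.exp (Complex.I * (m.1 * (x : ℝ) + m.2 * y)))
      (fun m => by fun_prop) hc (fun m x => by rw [norm_mul, norm_trig m (x, y), mul_one]) k
    simp only [coef_trig] at h
    exact h.tsum_eq.symm
  rw [IsSmoothPeriodic.fourierXY_eq, h1]
  have hb : ∀ (m : ℤ × ℤ) (y : ℝ), ‖(if m.1 = k then c m else 0) *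
      Complex.exp (Complex.I * m.2 * y)‖ ≤ ‖c m‖ := by
    intro m y
    have := norm_exp_I_mul (m.2 * y)
    push_cast at this
    rw [norm_mul, mul_assoc, this, mul_one]
    split_ifs <;> simp
  have h := hasSum_coef_tsum (fun m => by fun_prop) hc hb l
  rw [← h.tsum_eq, tsum_eq_single (k, l)]
  · simp [coef_const_mul, coef_exp]
  · rintro ⟨k', l'⟩ hne
    rw [coef_const_mul, coef_exp]
    by_cases h1 : k' = k
    · have : l' ≠ l := fun h2 => hne (by rw [h1, h2])
      simp [this]
    · simp [h1]

theorem summable_one_add_abs_sq : Summable fun n : ℤ => ((1 + |(n : ℝ)|) ^ 2)⁻¹ := by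
  have h : Summable fun n : ℤ => ‖((n : ℝ) ^ 2)⁻¹‖ := by
    have := (Real.summable_one_div_int_pow (p := 2)).mpr one_lt_two
    simpa using this
  refine Summable.of_norm_bounded_eventually h ?_
  have : {0}ᶜ ∈ (Filter.cofinite : Filter ℤ) :=
    (Set.finite_singleton 0).compl_mem_cofinite
  filter_upwards [this] with n hn
  have hn' : (0 : ℝ) < |(n : ℝ)| := by
    rw [abs_pos]; exact_mod_cast hn
  rw [norm_inv, norm_inv, Real.norm_of_nonneg (by positivity), Real.norm_of_nonneg (by positivity),
    ← sq_abs (n : ℝ)]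
  gcongr
  linarith

theorem summable_freqSize : Summable fun m : ℤ × ℤ => (freqSize m ^ 4)⁻¹ := by
  have h := summable_one_add_abs_sq.mul_of_nonneg summable_one_add_abs_sq
    (fun n => by positivity) (fun n => by positivity)
  refine Summable.of_nonneg_of_le (fun m => inv_nonneg.mpr (pow_nonneg (freqSize_nonneg m) _))
    (fun m => ?_) h
  rw [← mul_inv]
  have h1 : 1 + |(m.1 : ℝ)| ≤ freqSize m := by
    have := abs_nonneg (m.2 : ℝ); unfold freqSize; linarith
  have h2 : 1 + |(m.2 : ℝ)| ≤ freqSize m := by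
    have := abs_nonneg (m.1 : ℝ); unfold freqSize; linarith
  have h3 : freqSize m ^ 4 = freqSize m ^ 2 * freqSize m ^ 2 := by ring
  rw [h3]
  gcongr

namespace IsSmoothPeriodic

variable {f g : ℝ × ℝ → ℂ}

theorem fourierXY_iterate_dx (hf : IsSmoothPeriodic f) (n : ℕ) (k l : ℤ) :
    fourierXY (ShearFlow.dx^[n] f) k l = (Complex.I * k) ^ n * fourierXY f k l := by
  induction n with
  | zero => simp
  | succ n ih =>
    rw [Function.iterate_succ_apply', (hf.iterate_dx n).fourierXY_dx, ih]; ring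

theorem fourierXY_iterate_dy (hf : IsSmoothPeriodic f) (n : ℕ) (k l : ℤ) :
    fourierXY (ShearFlow.dy^[n] f) k l = (Complex.I * l) ^ n * fourierXY f k l := by
  induction n with
  | zero => simp
  | succ n ih =>
    rw [Function.iterate_succ_apply', (hf.iterate_dy n).fourierXY_dy, ih]; ring

theorem exists_freqSize_bound (hf : IsSmoothPeriodic f) (N : ℕ) :
    ∃ C : ℝ, ∀ m, freqSize m ^ N * ‖fourierPair f m‖ ≤ C := by
  obtain ⟨C₀, hC₀, h0⟩ := hf.exists_bound
  obtain ⟨C₁, hC₁, h1⟩ := (hf.iterate_dx N).exists_bound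
  obtain ⟨C₂, hC₂, h2⟩ := (hf.iterate_dy N).exists_bound
  refine ⟨3 ^ N * (C₀ + C₁ + C₂), fun m => ?_⟩
  have e0 := norm_fourierXY_le h0 m.1 m.2
  have e1 := norm_fourierXY_le h1 m.1 m.2
  have e2 := norm_fourierXY_le h2 m.1 m.2
  rw [hf.fourierXY_iterate_dx, norm_mul, norm_pow, norm_mul, Complex.norm_I, one_mul,
    Complex.norm_intCast] at e1
  rw [hf.fourierXY_iterate_dy, norm_mul, norm_pow, norm_mul, Complex.norm_I, one_mul,
    Complex.norm_intCast] at e2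
  set a := |(m.1 : ℝ)| with ha
  set b := |(m.2 : ℝ)| with hb
  have ha0 : 0 ≤ a := abs_nonneg _
  have hb0 : 0 ≤ b := abs_nonneg _
  have hmax : freqSize m ^ N ≤ 3 ^ N * (1 + a ^ N + b ^ N) := by
    have h3 : freqSize m ≤ 3 * max 1 (max a b) := by
      have := le_max_left 1 (max a b)
      have := (le_max_left a b).trans (le_max_right 1 (max a b))
      have := (le_max_right a b).trans (le_max_right 1 (max a b))
      unfold freqSize; linarith
    calc freqSize m ^ N ≤ (3 * max 1 (max a b)) ^ N :=
          pow_le_pow_left₀ (freqSize_nonneg m) h3 N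
      _ = 3 ^ N * (max 1 (max a b)) ^ N := mul_pow _ _ _
      _ ≤ _ := by
        gcongr
        have := pow_nonneg ha0 N
        have := pow_nonneg hb0 N
        rcases max_choice 1 (max a b) with h | h <;> rw [h]
        · rw [one_pow]; linarith
        · rcases max_choice a b with h | h <;> rw [h] <;> linarith
  calc freqSize m ^ N * ‖fourierPair f m‖
      ≤ 3 ^ N * (1 + a ^ N + b ^ N) * ‖fourierXY f m.1 m.2‖ := by gcongr
    _ = 3 ^ N * (‖fourierXY f m.1 m.2‖ + a ^ N * ‖fourierXY f m.1 m.2‖ +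
        b ^ N * ‖fourierXY f m.1 m.2‖) := by ring
    _ ≤ _ := by gcongr

theorem rapidDecay (hf : IsSmoothPeriodic f) : RapidDecay (fourierPair f) := by
  intro N
  obtain ⟨C, hC⟩ := hf.exists_freqSize_bound (N + 4)
  refine Summable.of_nonneg_of_le
    (fun m => mul_nonneg (pow_nonneg (freqSize_nonneg m) _) (norm_nonneg _)) (fun m => ?_)
    (summable_freqSize.mul_left C)
  have hp : 0 < freqSize m ^ 4 := pow_pos (zero_lt_one.trans_le (one_le_freqSize m)) 4
  rw [← div_eq_mul_inv, le_div_iff₀ hp]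
  have := hC m
  rw [pow_add] at this
  linarith

theorem summable_fourierXY (hf : IsSmoothPeriodic f) (k : ℤ) :
    Summable fun l => ‖fourierXY f k l‖ :=
  hf.rapidDecay.summable_norm.comp_injective (i := fun l => (k, l)) (Prod.mk_right_injective k)

theorem hasSum_fourierX (hf : IsSmoothPeriodic f) (k : ℤ) (y : ℝ) :
    HasSum (fun l : ℤ => fourierXY f k l * Complex.exp (Complex.I * l * y)) (fourierX f k y) :=
  hasSum_coef (hf.continuous_fourierX k) (hf.periodic_fourierX k)
    (Summable.of_norm (hf.summable_fourierXY k)) y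

theorem norm_fourierX_le_tsum (hf : IsSmoothPeriodic f) (k : ℤ) (y : ℝ) :
    ‖fourierX f k y‖ ≤ ∑' l, ‖fourierXY f k l‖ := by
  rw [← (hf.hasSum_fourierX k y).tsum_eq]
  refine tsum_of_norm_bounded (hf.summable_fourierXY k).hasSum fun l => ?_
  have := norm_exp_I_mul (l * y)
  push_cast at this
  rw [norm_mul, mul_assoc, this, mul_one]

theorem summable_fourierX (hf : IsSmoothPeriodic f) (y : ℝ) :
    Summable fun k => ‖fourierX f k y‖ :=
  Summable.of_nonneg_of_le (fun _ => norm_nonneg _) (fun k => hf.norm_fourierX_le_tsum k y)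
    hf.rapidDecay.summable_norm.prod

theorem hasSum (hf : IsSmoothPeriodic f) (x y : ℝ) :
    HasSum (fun k : ℤ => fourierX f k y * Complex.exp (Complex.I * k * x)) (f (x, y)) :=
  hasSum_coef (g := fun x => f (x, y)) (hf.continuous.comp (by fun_prop))
    (fun x => hf.periodic_x x y) (Summable.of_norm (hf.summable_fourierX y)) x

/-- Fourier inversion on the torus. -/
theorem eq_trigSeries (hf : IsSmoothPeriodic f) : f = trigSeries (fourierPair f) := by
  ext ⟨x, y⟩
  have h := (summable_trig hf.rapidDecay.summable_norm (x, y)).hasSum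
  have h2 := h.prod_fiberwise (g := fun k : ℤ => fourierX f k y * Complex.exp (Complex.I * k * x))
    (fun k => by
      have := (hf.hasSum_fourierX k y).mul_right (Complex.exp (Complex.I * k * x))
      refine this.congr_fun fun l => ?_
      rw [mul_assoc, ← Complex.exp_add]
      congr 2; ring)
  exact (hf.hasSum x y).unique h2

theorem ext_fourierXY (hf : IsSmoothPeriodic f) (hg : IsSmoothPeriodic g)
    (h : ∀ k l, fourierXY f k l = fourierXY g k l) : f = g := by
  rw [hf.eq_trigSeries, hg.eq_trigSeries]
  congr 1; ext m; exact h _ _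

end IsSmoothPeriodic

/-! ### The generator function and derivatives -/

/-- The supremum of the modulus of the `k`-th Fourier coefficient in `x`. -/
def supX (f : ℝ × ℝ → ℂ) (k : ℤ) : ℝ≥0∞ := ⨆ y : ℝ, ‖fourierX f k y‖ₑ

/-- The weights in the generator function. -/
def genWeight (z₁ z₂ : ℝ) (k : ℤ) (l : ℕ) : ℝ≥0∞ :=
  ENNReal.ofReal (Real.exp (|(k : ℝ)| * z₁) * z₂ ^ l / (l.factorial : ℝ))

theorem enorm_fourierX_le_supX (f : ℝ × ℝ → ℂ) (k : ℤ) (y : ℝ) :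
    ‖fourierX f k y‖ₑ ≤ supX f k := le_iSup (fun y => ‖fourierX f k y‖ₑ) y

theorem genWeight_mono {z₁ z₂ z₁' z₂' : ℝ} (h₁ : z₁ ≤ z₁') (h₂ : 0 ≤ z₂) (h₂' : z₂ ≤ z₂')
    (k : ℤ) (l : ℕ) : genWeight z₁ z₂ k l ≤ genWeight z₁' z₂' k l := by
  apply ENNReal.ofReal_le_ofReal
  gcongr

theorem genWeight_zero_right (z₁ z₂ : ℝ) (k : ℤ) :
    genWeight z₁ z₂ k 0 = ENNReal.ofReal (Real.exp (|(k : ℝ)| * z₁)) := by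
  simp [genWeight]

theorem one_le_genWeight {z₁ z₂ : ℝ} (h₁ : 0 ≤ z₁) (k : ℤ) : 1 ≤ genWeight z₁ z₂ k 0 := by
  rw [genWeight_zero_right, ← ENNReal.ofReal_one]
  apply ENNReal.ofReal_le_ofReal
  rw [Real.one_le_exp_iff]
  positivity

theorem Gen_mono (f : ℝ × ℝ → ℂ) {z₁ z₂ z₁' z₂' : ℝ} (h₁ : z₁ ≤ z₁') (h₂ : 0 ≤ z₂)
    (h₂' : z₂ ≤ z₂') : Gen f z₁ z₂ ≤ Gen f z₁' z₂' := by
  apply ENNReal.tsum_le_tsum; intro k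
  apply ENNReal.tsum_le_tsum; intro l
  exact mul_le_mul_left (genWeight_mono h₁ h₂ h₂' k l) _

theorem supX_const_mul (c : ℂ) (f : ℝ × ℝ → ℂ) (k : ℤ) :
    supX (fun p => c * f p) k = ‖c‖ₑ * supX f k := by
  simp only [supX, IsSmoothPeriodic.fourierX_const_mul, enorm_mul, ENNReal.mul_iSup]

theorem supX_conj (f : ℝ × ℝ → ℂ) (k : ℤ) :
    supX (fun p => (starRingEnd ℂ) (f p)) k = supX f (-k) := by
  simp only [supX, IsSmoothPeriodic.fourierX_conj]
  congr 1; ext y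
  rw [← ofReal_norm, ← ofReal_norm, RCLike.norm_conj]

theorem supX_zero (k : ℤ) : supX (fun _ => 0) k = 0 := by
  simp [supX, fourierX]

namespace IsSmoothPeriodic

variable {f g : ℝ × ℝ → ℂ}

theorem Gen_eq (hf : IsSmoothPeriodic f) (z₁ z₂ : ℝ) :
    Gen f z₁ z₂ = ∑' k : ℤ, ∑' l : ℕ, genWeight z₁ z₂ k l * supX (ShearFlow.dy^[l] f) k := by
  simp only [Gen, genWeight, supX, hf.iteratedDeriv_fourierX]

theorem supX_ne_top (hf : IsSmoothPeriodic f) (k : ℤ) : supX f k ≠ ⊤ := by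
  obtain ⟨C, -, hC⟩ := hf.exists_bound
  refine ne_top_of_le_ne_top (b := ENNReal.ofReal C) ENNReal.ofReal_ne_top (iSup_le fun y => ?_)
  rw [← ofReal_norm]
  exact ENNReal.ofReal_le_ofReal (norm_fourierX_le hC k y)

theorem norm_fourierX_le_supX (hf : IsSmoothPeriodic f) (k : ℤ) (y : ℝ) :
    ‖fourierX f k y‖ ≤ (supX f k).toReal := by
  rw [← toReal_enorm]
  exact ENNReal.toReal_mono (hf.supX_ne_top k) (enorm_fourierX_le_supX f k y)

theorem supX_add_le (hf : IsSmoothPeriodic f) (hg : IsSmoothPeriodic g) (k : ℤ) :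
    supX (fun p => f p + g p) k ≤ supX f k + supX g k := by
  refine iSup_le fun y => ?_
  rw [hf.fourierX_add hg]
  exact (enorm_add_le _ _).trans
    (add_le_add (enorm_fourierX_le_supX f k y) (enorm_fourierX_le_supX g k y))

theorem tsum_supX_le_Gen (hf : IsSmoothPeriodic f) {z₁ z₂ : ℝ} (h₁ : 0 ≤ z₁) :
    ∑' k, supX f k ≤ Gen f z₁ z₂ := by
  rw [hf.Gen_eq]
  refine ENNReal.tsum_le_tsum fun k => ?_
  refine le_trans ?_ (ENNReal.le_tsum 0)
  exact le_mul_of_one_le_left' (one_le_genWeight h₁ k)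

theorem enorm_le_tsum_supX (hf : IsSmoothPeriodic f) (p : ℝ × ℝ) : ‖f p‖ₑ ≤ ∑' k, supX f k := by
  have h := hf.hasSum p.1 p.2
  rw [← h.tsum_eq]
  refine (enorm_tsum_le_tsum_enorm).trans (ENNReal.tsum_le_tsum fun k => ?_)
  have := norm_exp_I_mul (k * p.1)
  push_cast at this
  rw [enorm_mul, ← ofReal_norm (Complex.exp _), mul_assoc, this, ENNReal.ofReal_one, mul_one]
  exact enorm_fourierX_le_supX f k p.2

theorem enorm_le_Gen (hf : IsSmoothPeriodic f) {z₁ z₂ : ℝ} (h₁ : 0 ≤ z₁) (p : ℝ × ℝ) :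
    ‖f p‖ₑ ≤ Gen f z₁ z₂ := (hf.enorm_le_tsum_supX p).trans (hf.tsum_supX_le_Gen h₁)

theorem iterate_dy_add (hf : IsSmoothPeriodic f) (hg : IsSmoothPeriodic g) (l : ℕ) :
    ShearFlow.dy^[l] (fun p => f p + g p) =
      fun p => ShearFlow.dy^[l] f p + ShearFlow.dy^[l] g p := by
  induction l with
  | zero => rfl
  | succ l ih =>
    simp only [Function.iterate_succ_apply', ih]
    exact (hf.iterate_dy l).dy_add (hg.iterate_dy l)

theorem iterate_dy_const_mul (c : ℂ) (hf : IsSmoothPeriodic f) (l : ℕ) :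
    ShearFlow.dy^[l] (fun p => c * f p) = fun p => c * ShearFlow.dy^[l] f p := by
  induction l with
  | zero => rfl
  | succ l ih =>
    simp only [Function.iterate_succ_apply', ih]
    exact (hf.iterate_dy l).dy_const_mul c

theorem iterate_dy_conj (hf : IsSmoothPeriodic f) (l : ℕ) :
    ShearFlow.dy^[l] (fun p => (starRingEnd ℂ) (f p)) =
      fun p => (starRingEnd ℂ) (ShearFlow.dy^[l] f p) := by
  induction l with
  | zero => rfl
  | succ l ih =>
    simp only [Function.iterate_succ_apply', ih]
    exact (hf.iterate_dy l).dy_conj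

theorem Gen_add_le (hf : IsSmoothPeriodic f) (hg : IsSmoothPeriodic g) (z₁ z₂ : ℝ) :
    Gen (fun p => f p + g p) z₁ z₂ ≤ Gen f z₁ z₂ + Gen g z₁ z₂ := by
  rw [hf.Gen_eq, hg.Gen_eq, (hf.add hg).Gen_eq, ← ENNReal.tsum_add]
  refine ENNReal.tsum_le_tsum fun k => ?_
  rw [← ENNReal.tsum_add]
  refine ENNReal.tsum_le_tsum fun l => ?_
  rw [hf.iterate_dy_add hg, ← mul_add]
  gcongr
  exact (hf.iterate_dy l).supX_add_le (hg.iterate_dy l) k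

theorem Gen_const_mul (c : ℂ) (hf : IsSmoothPeriodic f) (z₁ z₂ : ℝ) :
    Gen (fun p => c * f p) z₁ z₂ = ‖c‖ₑ * Gen f z₁ z₂ := by
  rw [hf.Gen_eq, (hf.const_mul c).Gen_eq, ← ENNReal.tsum_mul_left]
  congr 1; ext k
  rw [← ENNReal.tsum_mul_left]
  congr 1; ext l
  rw [hf.iterate_dy_const_mul, supX_const_mul]
  ring

theorem Gen_neg (hf : IsSmoothPeriodic f) (z₁ z₂ : ℝ) :
    Gen (fun p => -f p) z₁ z₂ = Gen f z₁ z₂ := by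
  have := hf.Gen_const_mul (-1) z₁ z₂
  simpa using this

theorem Gen_conj (hf : IsSmoothPeriodic f) (z₁ z₂ : ℝ) :
    Gen (fun p => (starRingEnd ℂ) (f p)) z₁ z₂ = Gen f z₁ z₂ := by
  rw [hf.Gen_eq, hf.conj.Gen_eq, ← (Equiv.neg ℤ).tsum_eq]
  congr 1; ext k; congr 1; ext l
  rw [hf.iterate_dy_conj, supX_conj, Equiv.neg_apply, neg_neg]
  simp [genWeight]

theorem sum {ι : Type*} (s : Finset ι) {F : ι → ℝ × ℝ → ℂ} (hF : ∀ i, IsSmoothPeriodic (F i)) :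
    IsSmoothPeriodic (fun p => ∑ i ∈ s, F i p) := by
  classical
  induction s using Finset.induction_on with
  | empty => simpa using zero
  | insert a s ha ih =>
    simp only [Finset.sum_insert ha]
    exact (hF a).add ih

theorem Gen_zero (z₁ z₂ : ℝ) : Gen (fun _ => 0) z₁ z₂ = 0 := by
  have := zero.Gen_const_mul 0 z₁ z₂
  simpa using this

theorem Gen_sum_le {ι : Type*} (s : Finset ι) {F : ι → ℝ × ℝ → ℂ}
    (hF : ∀ i, IsSmoothPeriodic (F i)) (z₁ z₂ : ℝ) :
    Gen (fun p => ∑ i ∈ s, F i p) z₁ z₂ ≤ ∑ i ∈ s, Gen (F i) z₁ z₂ := by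
  classical
  induction s using Finset.induction_on with
  | empty => simp [Gen_zero]
  | insert a s ha ih =>
    simp only [Finset.sum_insert ha]
    exact ((hF a).Gen_add_le (IsSmoothPeriodic.sum s hF) z₁ z₂).trans (add_le_add le_rfl ih)

theorem dx_dy_comm (hf : IsSmoothPeriodic f) :
    ShearFlow.dy (ShearFlow.dx f) = ShearFlow.dx (ShearFlow.dy f) := by
  apply hf.dx.dy.ext_fourierXY hf.dy.dx
  intro k l
  rw [hf.dx.fourierXY_dy, hf.fourierXY_dx, hf.dy.fourierXY_dx, hf.fourierXY_dy]
  ring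

theorem iterate_dy_dx (hf : IsSmoothPeriodic f) (l : ℕ) :
    ShearFlow.dy^[l] (ShearFlow.dx f) = ShearFlow.dx (ShearFlow.dy^[l] f) := by
  induction l with
  | zero => rfl
  | succ l ih => simp only [Function.iterate_succ_apply', ih, (hf.iterate_dy l).dx_dy_comm]

theorem supX_dx (hf : IsSmoothPeriodic f) (k : ℤ) :
    supX (ShearFlow.dx f) k = ENNReal.ofReal |(k : ℝ)| * supX f k := by
  simp only [supX, hf.fourierX_dx, enorm_mul, ENNReal.mul_iSup]
  congr 1; ext y
  rw [← ofReal_norm Complex.I, Complex.norm_I, ENNReal.ofReal_one, one_mul, ← ofReal_norm (k : ℂ),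
    Complex.norm_intCast]

/-- A derivative in `x` costs at most the largest frequency. -/
theorem Gen_dx_le_of_frequencies (hf : IsSmoothPeriodic f) {N : ℝ}
    (hN : ∀ k : ℤ, N < |(k : ℝ)| → ∀ y, fourierX f k y = 0) (z₁ z₂ : ℝ) :
    Gen (ShearFlow.dx f) z₁ z₂ ≤ ENNReal.ofReal N * Gen f z₁ z₂ := by
  rw [hf.Gen_eq, hf.dx.Gen_eq, ← ENNReal.tsum_mul_left]
  refine ENNReal.tsum_le_tsum fun k => ?_
  rw [← ENNReal.tsum_mul_left]
  refine ENNReal.tsum_le_tsum fun l => ?_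
  rw [hf.iterate_dy_dx, (hf.iterate_dy l).supX_dx]
  by_cases hk : N < |(k : ℝ)|
  · have : supX (ShearFlow.dy^[l] f) k = 0 := by
      rw [supX, ← hf.iteratedDeriv_fourierX]
      have h0 : fourierX f k = fun _ => 0 := funext (hN k hk)
      rw [h0]
      simp
    rw [this]; simp
  · rw [mul_left_comm]
    gcongr
    exact not_lt.mp hk

/-- A derivative in `x` costs a factor `1 / (z₁' - z₁)`. -/
theorem Gen_dx_le (hf : IsSmoothPeriodic f) {z₁ z₁' z₂ : ℝ} (h : z₁ < z₁') (hz₂ : 0 ≤ z₂) :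
    Gen (ShearFlow.dx f) z₁ z₂ ≤ ENNReal.ofReal (1 / (z₁' - z₁)) * Gen f z₁' z₂ := by
  rw [hf.Gen_eq, hf.dx.Gen_eq, ← ENNReal.tsum_mul_left]
  refine ENNReal.tsum_le_tsum fun k => ?_
  rw [← ENNReal.tsum_mul_left]
  refine ENNReal.tsum_le_tsum fun l => ?_
  rw [hf.iterate_dy_dx, (hf.iterate_dy l).supX_dx, ← mul_assoc, ← mul_assoc]
  refine mul_le_mul_left ?_ _
  have hd : 0 < z₁' - z₁ := sub_pos.mpr h
  rw [genWeight, genWeight, ← ENNReal.ofReal_mul (by positivity),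
    ← ENNReal.ofReal_mul (by positivity)]
  apply ENNReal.ofReal_le_ofReal
  have h1 : |(k : ℝ)| * (z₁' - z₁) ≤ Real.exp (|(k : ℝ)| * (z₁' - z₁)) := by
    have := Real.add_one_le_exp (|(k : ℝ)| * (z₁' - z₁)); linarith
  have h2 : Real.exp (|(k : ℝ)| * z₁') =
      Real.exp (|(k : ℝ)| * z₁) * Real.exp (|(k : ℝ)| * (z₁' - z₁)) := by
    rw [← Real.exp_add]; congr 1; ring
  rw [h2]
  calc Real.exp (|(k : ℝ)| * z₁) * z₂ ^ l / (l.factorial : ℝ) * |(k : ℝ)|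
      = 1 / (z₁' - z₁) * (Real.exp (|(k : ℝ)| * z₁) * (|(k : ℝ)| * (z₁' - z₁)) * z₂ ^ l /
          (l.factorial : ℝ)) := by field_simp
    _ ≤ _ := by gcongr

/-- A derivative in `y` costs a factor `1 / (z₂' - z₂)`. -/
theorem Gen_dy_le (hf : IsSmoothPeriodic f) {z₁ z₂ z₂' : ℝ} (hz₂ : 0 ≤ z₂) (h : z₂ < z₂') :
    Gen (ShearFlow.dy f) z₁ z₂ ≤ ENNReal.ofReal (1 / (z₂' - z₂)) * Gen f z₁ z₂' := by
  rw [hf.Gen_eq, hf.dy.Gen_eq, ← ENNReal.tsum_mul_left]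
  refine ENNReal.tsum_le_tsum fun k => ?_
  have hd : 0 < z₂' - z₂ := sub_pos.mpr h
  rw [← ENNReal.tsum_mul_left]
  refine le_trans ?_ (ENNReal.tsum_comp_le_tsum_of_injective (Nat.succ_injective) _)
  refine ENNReal.tsum_le_tsum fun l => ?_
  rw [← Function.iterate_succ_apply, ← mul_assoc]
  simp only [Nat.succ_eq_add_one]
  refine mul_le_mul_left ?_ _
  rw [genWeight, genWeight, ← ENNReal.ofReal_mul (by positivity)]
  apply ENNReal.ofReal_le_ofReal
  -- Bernoulli's inequality: `(l + 1) z^l (z' - z) ≤ z'^(l+1) - z^(l+1)`.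
  have h1 : ((l : ℝ) + 1) * z₂ ^ l * (z₂' - z₂) ≤ z₂' ^ (l + 1) := by
    have hb : ∀ l : ℕ, z₂ ^ (l + 1) + ((l : ℝ) + 1) * z₂ ^ l * (z₂' - z₂) ≤ z₂' ^ (l + 1) := by
      intro l
      induction l with
      | zero => simp
      | succ l ih =>
        have h2 : z₂ * z₂ ^ (l + 1) + z₂ ^ (l + 1) * (z₂' - z₂) +
            z₂ * (((l : ℝ) + 1) * z₂ ^ l * (z₂' - z₂)) ≤ z₂' * z₂' ^ (l + 1) := by
          have h3 : z₂' * (z₂ ^ (l + 1) + ((l : ℝ) + 1) * z₂ ^ l * (z₂' - z₂)) ≤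
              z₂' * z₂' ^ (l + 1) := mul_le_mul_of_nonneg_left ih (hz₂.trans h.le)
          have h4 : 0 ≤ (z₂' - z₂) * (((l : ℝ) + 1) * z₂ ^ l * (z₂' - z₂)) := by positivity
          nlinarith
        push_cast
        rw [pow_succ z₂' (l + 1), pow_succ z₂ (l + 1)]
        have e : z₂ * (((l : ℝ) + 1) * z₂ ^ l * (z₂' - z₂)) =
          ((l : ℝ) + 1) * z₂ ^ (l + 1) * (z₂' - z₂) := by ring
        rw [e] at h2
        linarith
    have : 0 ≤ z₂ ^ (l + 1) := by positivity
    linarith [hb l]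
  rw [Nat.factorial_succ]
  push_cast
  calc Real.exp (|(k : ℝ)| * z₁) * z₂ ^ l / (l.factorial : ℝ)
      = 1 / (z₂' - z₂) * (Real.exp (|(k : ℝ)| * z₁) * (((l : ℝ) + 1) * z₂ ^ l * (z₂' - z₂)) /
          (((l : ℝ) + 1) * (l.factorial : ℝ))) := by field_simp
    _ ≤ _ := by gcongr

end IsSmoothPeriodic

/-! ### Products and Fourier multipliers in the generator norm -/

theorem tsum_sum_antidiagonal {ι : Type*} [AddCommMonoid ι] [Finset.HasAntidiagonal ι]
    (F : ι × ι → ℝ≥0∞) : ∑' i, ∑ q ∈ antidiagonal i, F q = ∑' q : ι × ι, F q := by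
  rw [← (Finset.HasAntidiagonal.sigmaAntidiagonalEquivProd (A := ι)).tsum_eq, ENNReal.tsum_sigma']
  congr 1; ext i
  rw [tsum_fintype, ← Finset.sum_coe_sort]
  rfl

theorem tsum_prod_mul {ι κ : Type*} (F : ι → ℝ≥0∞) (G : κ → ℝ≥0∞) :
    ∑' q : ι × κ, F q.1 * G q.2 = (∑' i, F i) * ∑' j, G j := by
  rw [ENNReal.tsum_prod', ← ENNReal.tsum_mul_right]
  congr 1; ext i; exact ENNReal.tsum_mul_left (a := F i) (f := G)

/-- The weights of the generator function are submultiplicative, up to the binomial coefficients of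
the Leibniz rule. -/
theorem genWeight_mul_choose_le {z₁ z₂ : ℝ} (h₁ : 0 ≤ z₁) (h₂ : 0 ≤ z₂) (k j : ℤ) (a b : ℕ) :
    genWeight z₁ z₂ k (a + b) * ((a + b).choose a : ℕ) ≤
      genWeight z₁ z₂ j a * genWeight z₁ z₂ (k - j) b := by
  unfold genWeight
  rw [← ENNReal.ofReal_natCast, ← ENNReal.ofReal_mul (by positivity),
    ← ENNReal.ofReal_mul (by positivity)]
  apply ENNReal.ofReal_le_ofReal
  have hc : (((a + b).choose a : ℕ) : ℝ) / ((a + b).factorial : ℝ) =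
      1 / (a.factorial : ℝ) * (1 / (b.factorial : ℝ)) := by
    have h := Nat.add_choose_mul_factorial_mul_factorial b a
    rw [add_comm b a] at h
    have h' : (((a + b).choose a : ℕ) : ℝ) * (a.factorial : ℝ) * (b.factorial : ℝ) =
      ((a + b).factorial : ℝ) := by
      rw [mul_right_comm]; exact_mod_cast h
    have ha : (a.factorial : ℝ) ≠ 0 := by positivity
    have hb : (b.factorial : ℝ) ≠ 0 := by positivity
    have hab : ((a + b).factorial : ℝ) ≠ 0 := by positivity
    rw [← h'] at hab ⊢
    field_simp
    exact div_self (fun h => hab (by rw [h]; ring))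
  have he : Real.exp (|(k : ℝ)| * z₁) ≤
      Real.exp (|(j : ℝ)| * z₁) * Real.exp (|((k - j : ℤ) : ℝ)| * z₁) := by
    rw [← Real.exp_add, ← add_mul]
    gcongr
    have := abs_add_le (j : ℝ) ((k - j : ℤ) : ℝ)
    push_cast at this ⊢
    simpa using this
  calc Real.exp (|(k : ℝ)| * z₁) * z₂ ^ (a + b) / ((a + b).factorial : ℝ) *
        (((a + b).choose a : ℕ) : ℝ)
      = Real.exp (|(k : ℝ)| * z₁) * (z₂ ^ a * z₂ ^ b) * ((((a + b).choose a : ℕ) : ℝ) /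
        ((a + b).factorial : ℝ)) := by rw [pow_add]; ring
    _ ≤ (Real.exp (|(j : ℝ)| * z₁) * Real.exp (|((k - j : ℤ) : ℝ)| * z₁)) * (z₂ ^ a * z₂ ^ b) *
        ((((a + b).choose a : ℕ) : ℝ) / ((a + b).factorial : ℝ)) := by gcongr
    _ = _ := by rw [hc]; ring

namespace IsSmoothPeriodic

variable {f g : ℝ × ℝ → ℂ}

theorem hasSum_fourierX_mul (hf : IsSmoothPeriodic f) (hg : IsSmoothPeriodic g) (k : ℤ) (y : ℝ) :
    HasSum (fun j => fourierX f j y * fourierX g (k - j) y)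
      (fourierX (fun p => f p * g p) k y) := by
  obtain ⟨C, hC0, hC⟩ := hg.exists_bound
  have hgc := hg.continuous
  have h := hasSum_coef_tsum
    (g := fun (j : ℤ) (x : ℝ) => fourierX f j y * Complex.exp (Complex.I * j * x) * g (x, y))
    (fun j => by fun_prop) ((hf.summable_fourierX y).mul_right C) (fun j x => by
      have := norm_exp_I_mul (j * x)
      push_cast at this
      rw [norm_mul, norm_mul, mul_assoc Complex.I, this, mul_one]
      gcongr
      exact hC _) k
  have e1 : (fun x : ℝ => ∑' j : ℤ, fourierX f j y * Complex.exp (Complex.I * j * x) * g (x, y)) =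
      fun x => f (x, y) * g (x, y) := by
    ext x; exact ((hf.hasSum x y).mul_right _).tsum_eq
  rw [e1] at h
  refine HasSum.congr_fun h fun j => ?_
  have e2 : (fun x : ℝ => fourierX f j y * Complex.exp (Complex.I * j * x) * g (x, y)) =
      fun x : ℝ => fourierX f j y * (Complex.exp (Complex.I * j * x) * g (x, y)) := by
    ext x; ring
  rw [e2, coef_const_mul]
  congr 1
  rw [fourierX_eq, coef, coef]
  congr 1
  apply intervalIntegral.integral_congr
  intro x _
  simp only
  rw [mul_comm (Complex.exp _) (g _), mul_assoc (g _), ← Complex.exp_add]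
  congr 2
  push_cast; ring

theorem supX_mul_le (hf : IsSmoothPeriodic f) (hg : IsSmoothPeriodic g) (k : ℤ) :
    supX (fun p => f p * g p) k ≤ ∑' j, supX f j * supX g (k - j) := by
  refine iSup_le fun y => ?_
  rw [← (hf.hasSum_fourierX_mul hg k y).tsum_eq]
  refine enorm_tsum_le_tsum_enorm.trans (ENNReal.tsum_le_tsum fun j => ?_)
  rw [enorm_mul]
  exact mul_le_mul' (enorm_fourierX_le_supX _ _ _) (enorm_fourierX_le_supX _ _ _)

theorem iterate_dy_apply (f : ℝ × ℝ → ℂ) (l : ℕ) (x y : ℝ) :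
    ShearFlow.dy^[l] f (x, y) = iteratedDeriv l (fun s => f (x, s)) y := by
  induction l generalizing y with
  | zero => simp
  | succ l ih =>
    rw [Function.iterate_succ_apply', iteratedDeriv_succ]
    unfold ShearFlow.dy
    congr 1
    ext s; exact ih s

theorem iterate_dy_mul (hf : IsSmoothPeriodic f) (hg : IsSmoothPeriodic g) (l : ℕ) :
    ShearFlow.dy^[l] (fun p => f p * g p) = fun p => ∑ q ∈ antidiagonal l,
      (l.choose q.1 : ℂ) * (ShearFlow.dy^[q.1] f p * ShearFlow.dy^[q.2] g p) := by
  ext ⟨x, y⟩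
  rw [iterate_dy_apply, Finset.Nat.sum_antidiagonal_eq_sum_range_succ_mk]
  have hf' : ContDiff ℝ l (fun s => f (x, s)) :=
    (hf.smooth.comp (contDiff_const.prodMk contDiff_id)).of_le (by exact_mod_cast le_top)
  have hg' : ContDiff ℝ l (fun s => g (x, s)) :=
    (hg.smooth.comp (contDiff_const.prodMk contDiff_id)).of_le (by exact_mod_cast le_top)
  have h := iteratedDeriv_mul hf'.contDiffAt hg'.contDiffAt (x := y)
  refine h.trans (Finset.sum_congr rfl fun i _ => ?_)
  simp only [iterate_dy_apply]
  ring

/-- The generator function of a product is at most the product of the generator functions. -/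
theorem Gen_mul_le (hf : IsSmoothPeriodic f) (hg : IsSmoothPeriodic g) {z₁ z₂ : ℝ} (h₁ : 0 ≤ z₁)
    (h₂ : 0 ≤ z₂) : Gen (fun p => f p * g p) z₁ z₂ ≤ Gen f z₁ z₂ * Gen g z₁ z₂ := by
  set A : ℤ → ℕ → ℝ≥0∞ := fun k l => genWeight z₁ z₂ k l * supX (ShearFlow.dy^[l] f) k with hA
  set B : ℤ → ℕ → ℝ≥0∞ := fun k l => genWeight z₁ z₂ k l * supX (ShearFlow.dy^[l] g) k with hB
  have hterm : ∀ k l, genWeight z₁ z₂ k l * supX (ShearFlow.dy^[l] (fun p => f p * g p)) k ≤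
      ∑' j, ∑ q ∈ antidiagonal l, A j q.1 * B (k - j) q.2 := by
    intro k l
    have h1 : supX (ShearFlow.dy^[l] (fun p => f p * g p)) k ≤ ∑ q ∈ antidiagonal l,
        (l.choose q.1 : ℕ) * ∑' j, supX (ShearFlow.dy^[q.1] f) j *
          supX (ShearFlow.dy^[q.2] g) (k - j) := by
      rw [hf.iterate_dy_mul hg]
      have hs : ∀ s : Finset (ℕ × ℕ), supX (fun p => ∑ q ∈ s,
          (l.choose q.1 : ℂ) * (ShearFlow.dy^[q.1] f p * ShearFlow.dy^[q.2] g p)) k ≤ ∑ q ∈ s,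
          (l.choose q.1 : ℕ) * ∑' j, supX (ShearFlow.dy^[q.1] f) j *
            supX (ShearFlow.dy^[q.2] g) (k - j) := by
        intro s
        have hsm : ∀ q : ℕ × ℕ, IsSmoothPeriodic fun p => (l.choose q.1 : ℂ) *
            (ShearFlow.dy^[q.1] f p * ShearFlow.dy^[q.2] g p) :=
          fun q => ((hf.iterate_dy q.1).mul (hg.iterate_dy q.2)).const_mul _
        induction s using Finset.induction_on with
        | empty => simp [supX_zero]
        | insert a s ha ih =>
          simp only [Finset.sum_insert ha]
          refine ((hsm a).supX_add_le (IsSmoothPeriodic.sum s hsm) k).trans (add_le_add ?_ ih)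
          rw [supX_const_mul]
          have : ‖((l.choose a.1 : ℕ) : ℂ)‖ₑ = (l.choose a.1 : ℕ) := by
            rw [← ofReal_norm, Complex.norm_natCast, ENNReal.ofReal_natCast]
          rw [this]
          gcongr
          exact (hf.iterate_dy _).supX_mul_le (hg.iterate_dy _) k
      exact hs _
    refine (mul_le_mul_right h1 _).trans ?_
    rw [Finset.mul_sum, Summable.tsum_finsetSum (fun _ _ => ENNReal.summable)]
    refine Finset.sum_le_sum fun q hq => ?_
    rw [← mul_assoc, ← ENNReal.tsum_mul_left]
    refine ENNReal.tsum_le_tsum fun j => ?_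
    obtain rfl := Finset.HasAntidiagonal.mem_antidiagonal.mp hq
    have := genWeight_mul_choose_le h₁ h₂ k j q.1 q.2
    calc _ ≤ genWeight z₁ z₂ j q.1 * genWeight z₁ z₂ (k - j) q.2 *
          (supX (ShearFlow.dy^[q.1] f) j * supX (ShearFlow.dy^[q.2] g) (k - j)) :=
          mul_le_mul_left this _
      _ = _ := by simp only [hA, hB]; ring
  rw [hf.Gen_eq, hg.Gen_eq, (hf.mul hg).Gen_eq]
  calc _ ≤ ∑' k, ∑' l, ∑' j, ∑ q ∈ antidiagonal l, A j q.1 * B (k - j) q.2 :=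
        ENNReal.tsum_le_tsum fun k => ENNReal.tsum_le_tsum fun l => hterm k l
    _ = ∑' k, ∑' j, (∑' l, A j l) * ∑' l, B (k - j) l := by
        congr 1; ext k
        rw [ENNReal.tsum_comm]
        congr 1; ext j
        rw [tsum_sum_antidiagonal (fun q : ℕ × ℕ => A j q.1 * B (k - j) q.2), tsum_prod_mul]
    _ = _ := by
        rw [ENNReal.tsum_comm]
        simp_rw [ENNReal.tsum_mul_left]
        rw [← ENNReal.tsum_mul_right]
        congr 1; ext j
        congr 1
        exact (Equiv.subRight j).tsum_eq (fun k => ∑' l, B k l)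

/-- The frequencies in `x` of a product. -/
theorem fourierX_mul_eq_zero (hf : IsSmoothPeriodic f) (hg : IsSmoothPeriodic g) {M N : ℝ}
    (hM : ∀ k : ℤ, M < |(k : ℝ)| → ∀ y, fourierX f k y = 0)
    (hN : ∀ k : ℤ, N < |(k : ℝ)| → ∀ y, fourierX g k y = 0)
    (k : ℤ) (hk : M + N < |(k : ℝ)|) (y : ℝ) : fourierX (fun p => f p * g p) k y = 0 := by
  rw [← (hf.hasSum_fourierX_mul hg k y).tsum_eq]
  refine (tsum_congr fun j => ?_).trans tsum_zero
  by_cases hj : M < |(j : ℝ)|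
  · rw [hM j hj, zero_mul]
  · rw [hN (k - j) _ y, mul_zero]
    have := abs_add_le (j : ℝ) ((k - j : ℤ) : ℝ)
    push_cast at this ⊢
    rw [add_sub_cancel] at this
    linarith

end IsSmoothPeriodic

/-- Fourier multipliers that are bounded by `1` and, for each fixed frequency in `x`, square
summable in the frequency in `y`, with a bound that does not depend on the frequency in `x`. -/
structure IsMultiplier (m : ℤ × ℤ → ℂ) : Prop where
  norm_le_one : ∀ n, ‖m n‖ ≤ 1
  norm_sq_le : ∀ n, ‖m n‖ ^ 2 ≤ 4 * ((1 + |(n.2 : ℝ)|) ^ 2)⁻¹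

/-- The operator with Fourier multiplier `m`. -/
def mult (m : ℤ × ℤ → ℂ) (f : ℝ × ℝ → ℂ) : ℝ × ℝ → ℂ :=
  trigSeries fun n => m n * fourierPair f n

/-- A bound for multiplier operators in the supremum norm in `y`. -/
def multBound : ℝ := (1 + ∑' l : ℤ, 4 * ((1 + |(l : ℝ)|) ^ 2)⁻¹) / 2

theorem multBound_pos : 0 < multBound := by
  have : 0 ≤ ∑' l : ℤ, 4 * ((1 + |(l : ℝ)|) ^ 2)⁻¹ := tsum_nonneg fun l => by positivity
  unfold multBound; linarith

namespace IsMultiplier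

variable {m : ℤ × ℤ → ℂ} {f : ℝ × ℝ → ℂ}

theorem rapidDecay (hm : IsMultiplier m) (hf : IsSmoothPeriodic f) :
    RapidDecay fun n => m n * fourierPair f n :=
  hf.rapidDecay.mul fun n => (hm.norm_le_one n).trans (one_le_freqSize n)

theorem isSmoothPeriodic (hm : IsMultiplier m) (hf : IsSmoothPeriodic f) :
    IsSmoothPeriodic (mult m f) := (hm.rapidDecay hf).isSmoothPeriodic

theorem fourierXY_mult (hm : IsMultiplier m) (hf : IsSmoothPeriodic f) (k l : ℤ) :
    fourierXY (mult m f) k l = m (k, l) * fourierXY f k l :=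
  fourierXY_trigSeries (hm.rapidDecay hf).summable_norm k l

theorem dy_mult (hm : IsMultiplier m) (hf : IsSmoothPeriodic f) :
    dy (mult m f) = mult m (dy f) := by
  apply (hm.isSmoothPeriodic hf).dy.ext_fourierXY (hm.isSmoothPeriodic hf.dy)
  intro k l
  rw [(hm.isSmoothPeriodic hf).fourierXY_dy, hm.fourierXY_mult hf, hm.fourierXY_mult hf.dy,
    hf.fourierXY_dy]
  ring

theorem iterate_dy_mult (hm : IsMultiplier m) (hf : IsSmoothPeriodic f) (l : ℕ) :
    dy^[l] (mult m f) = mult m (dy^[l] f) := by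
  induction l with
  | zero => rfl
  | succ l ih => simp only [Function.iterate_succ_apply', ih, hm.dy_mult (hf.iterate_dy l)]

/-- Bessel's inequality and the Cauchy-Schwarz inequality bound the absolute sum of the Fourier
coefficients in `y`. -/
theorem tsum_norm_le (hm : IsMultiplier m) (hf : IsSmoothPeriodic f) (k : ℤ) :
    ∑' l, ‖m (k, l) * fourierXY f k l‖ ≤ multBound * (supX f k).toReal := by
  set M := (supX f k).toReal with hM
  have hb : ∀ y, ‖fourierX f k y‖ ≤ M := hf.norm_fourierX_le_supX k
  obtain ⟨hs, hle⟩ := summable_norm_sq_coef (hf.continuous_fourierX k) hb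
  have hM0 : 0 ≤ M := ENNReal.toReal_nonneg
  rcases hM0.eq_or_lt with h0 | hpos
  · have hz : ∀ l, fourierXY f k l = 0 := fun l => by
      have := norm_coef_le hb l
      rw [← h0] at this
      exact norm_le_zero_iff.mp this
    simp [hz, ← h0]
  have h4 : Summable fun l : ℤ => 4 * ((1 + |(l : ℝ)|) ^ 2)⁻¹ :=
    summable_one_add_abs_sq.mul_left 4
  have hsum : HasSum (fun l : ℤ => (M⁻¹ * ‖fourierXY f k l‖ ^ 2 +
      M * (4 * ((1 + |(l : ℝ)|) ^ 2)⁻¹)) / 2) ((M⁻¹ * ∑' l, ‖fourierXY f k l‖ ^ 2 +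
      M * ∑' l : ℤ, 4 * ((1 + |(l : ℝ)|) ^ 2)⁻¹) / 2) :=
    ((hs.hasSum.mul_left _).add (h4.hasSum.mul_left _)).div_const 2
  -- `2 a b ≤ a² / M + M b²`, termwise
  have hterm : ∀ l : ℤ, ‖m (k, l) * fourierXY f k l‖ ≤ (M⁻¹ * ‖fourierXY f k l‖ ^ 2 +
      M * (4 * ((1 + |(l : ℝ)|) ^ 2)⁻¹)) / 2 := by
    intro l
    have h1 := hm.norm_sq_le (k, l)
    have h2 : M * ‖m (k, l)‖ ^ 2 ≤ M * (4 * ((1 + |(l : ℝ)|) ^ 2)⁻¹) := by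
      gcongr
    have h3 : 0 ≤ M⁻¹ * (‖fourierXY f k l‖ - M * ‖m (k, l)‖) ^ 2 := by positivity
    have h5 : M⁻¹ * (‖fourierXY f k l‖ - M * ‖m (k, l)‖) ^ 2 = M⁻¹ * ‖fourierXY f k l‖ ^ 2 -
        2 * (‖m (k, l)‖ * ‖fourierXY f k l‖) + M * ‖m (k, l)‖ ^ 2 := by
      field_simp; ring
    rw [norm_mul]
    linarith
  have hsm : Summable fun l => ‖m (k, l) * fourierXY f k l‖ :=
    Summable.of_nonneg_of_le (fun _ => norm_nonneg _) hterm hsum.summable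
  refine (hsm.tsum_le_tsum hterm hsum.summable).trans ?_
  rw [hsum.tsum_eq]
  have h6 : M⁻¹ * ∑' l, ‖fourierXY f k l‖ ^ 2 ≤ M⁻¹ * M ^ 2 := by
    gcongr
    exact hle
  have h7 : M⁻¹ * M ^ 2 = M := by field_simp
  unfold multBound
  linarith

theorem supX_mult_le (hm : IsMultiplier m) (hf : IsSmoothPeriodic f) (k : ℤ) :
    supX (mult m f) k ≤ ENNReal.ofReal multBound * supX f k := by
  rw [← ENNReal.ofReal_toReal (hf.supX_ne_top k), ← ENNReal.ofReal_mul multBound_pos.le]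
  refine iSup_le fun y => ?_
  rw [← ofReal_norm]
  apply ENNReal.ofReal_le_ofReal
  refine ((hm.isSmoothPeriodic hf).norm_fourierX_le_tsum k y).trans ?_
  simp only [hm.fourierXY_mult hf]
  exact hm.tsum_norm_le hf k

theorem Gen_mult_le (hm : IsMultiplier m) (hf : IsSmoothPeriodic f) (z₁ z₂ : ℝ) :
    Gen (mult m f) z₁ z₂ ≤ ENNReal.ofReal multBound * Gen f z₁ z₂ := by
  rw [hf.Gen_eq, (hm.isSmoothPeriodic hf).Gen_eq, ← ENNReal.tsum_mul_left]
  refine ENNReal.tsum_le_tsum fun k => ?_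
  rw [← ENNReal.tsum_mul_left]
  refine ENNReal.tsum_le_tsum fun l => ?_
  rw [mul_left_comm, hm.iterate_dy_mult hf]
  gcongr
  exact hm.supX_mult_le (hf.iterate_dy l) k

theorem tsum_enorm_le_Gen (hm : IsMultiplier m) (hf : IsSmoothPeriodic f) {z₁ z₂ : ℝ}
    (h₁ : 0 ≤ z₁) : ∑' n : ℤ × ℤ, ‖m n * fourierPair f n‖ₑ ≤
      ENNReal.ofReal multBound * Gen f z₁ z₂ := by
  rw [ENNReal.tsum_prod']
  refine le_trans ?_ (mul_le_mul_right (hf.tsum_supX_le_Gen (z₂ := z₂) h₁) _)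
  rw [← ENNReal.tsum_mul_left]
  refine ENNReal.tsum_le_tsum fun k => ?_
  have h := hm.tsum_norm_le hf k
  have hs : Summable fun l => ‖m (k, l) * fourierXY f k l‖ :=
    (hm.rapidDecay hf).summable_norm.comp_injective (i := fun l => (k, l))
      (Prod.mk_right_injective k)
  rw [← ENNReal.ofReal_toReal (hf.supX_ne_top k), ← ENNReal.ofReal_mul multBound_pos.le]
  refine le_trans ?_ (ENNReal.ofReal_le_ofReal h)
  rw [ENNReal.ofReal_tsum_of_nonneg (fun _ => norm_nonneg _) hs]
  exact ENNReal.tsum_le_tsum fun l => by rw [ofReal_norm]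

theorem fourierX_mult_eq_zero (hm : IsMultiplier m) (hf : IsSmoothPeriodic f) {k : ℤ}
    (hk : ∀ y, fourierX f k y = 0) (y : ℝ) : fourierX (mult m f) k y = 0 := by
  have h : supX f k = 0 := by simp [supX, hk]
  have h2 := (enorm_fourierX_le_supX (mult m f) k y).trans (hm.supX_mult_le hf k)
  rw [h, mul_zero, nonpos_iff_eq_zero, enorm_eq_zero] at h2
  exact h2

end IsMultiplier

/-! ### The velocity, the nonlinear term and the linearized operator -/

/-- Symbols of order `-1`; the constant `4` comes from `(1 + |l|)² ≤ 4 (k² + l²)` at nonzero integer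
frequencies. -/
theorem isMultiplier_div {a : ℤ × ℤ → ℂ}
    (ha : ∀ n : ℤ × ℤ, n ≠ 0 → ‖a n‖ ^ 2 ≤ (n.1 : ℝ) ^ 2 + (n.2 : ℝ) ^ 2) :
    IsMultiplier fun n => a n / ((n.1 : ℂ) ^ 2 + (n.2 : ℂ) ^ 2) := by
  have key : ∀ n : ℤ × ℤ, n ≠ 0 → 1 ≤ (n.1 : ℝ) ^ 2 + (n.2 : ℝ) ^ 2 ∧
      (1 + |(n.2 : ℝ)|) ^ 2 ≤ 4 * ((n.1 : ℝ) ^ 2 + (n.2 : ℝ) ^ 2) ∧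
      ‖a n / ((n.1 : ℂ) ^ 2 + (n.2 : ℂ) ^ 2)‖ ^ 2 ≤ ((n.1 : ℝ) ^ 2 + (n.2 : ℝ) ^ 2)⁻¹ := by
    rintro ⟨k, l⟩ hn
    have hD : 1 ≤ (k : ℝ) ^ 2 + (l : ℝ) ^ 2 := by
      have : 0 < k ^ 2 + l ^ 2 := by
        by_contra h
        have hk : k = 0 := by nlinarith [sq_nonneg k, sq_nonneg l]
        have hl : l = 0 := by nlinarith [sq_nonneg k, sq_nonneg l]
        exact hn (by rw [hk, hl]; rfl)
      exact_mod_cast this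
    refine ⟨hD, ?_, ?_⟩
    · have := sq_abs (l : ℝ)
      have := sq_nonneg (k : ℝ)
      have : (|(l : ℝ)| - 1) ^ 2 ≥ 0 := sq_nonneg _
      simp only
      nlinarith
    · have h1 : ‖((k : ℂ) ^ 2 + (l : ℂ) ^ 2)‖ = (k : ℝ) ^ 2 + (l : ℝ) ^ 2 := by
        rw [← Real.norm_of_nonneg (r := (k : ℝ) ^ 2 + (l : ℝ) ^ 2) (by positivity),
          ← Complex.norm_real]
        push_cast; rfl
      have h2 := ha (k, l) hn
      simp only [norm_div, h1, div_pow] at h2 ⊢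
      rw [div_le_iff₀ (by positivity)]
      refine h2.trans (le_of_eq ?_)
      have : (k : ℝ) ^ 2 + (l : ℝ) ^ 2 ≠ 0 := by positivity
      field_simp
  constructor
  · intro n
    by_cases hn : n = 0
    · subst hn; simp
    · obtain ⟨h1, -, h3⟩ := key n hn
      have h4 := h3.trans (inv_le_one_of_one_le₀ h1)
      exact (sq_le_one_iff₀ (norm_nonneg _)).mp h4
  · intro n
    by_cases hn : n = 0
    · subst hn; simp
    · obtain ⟨h1, h2, h3⟩ := key n hn
      refine h3.trans ?_
      rw [← div_eq_mul_inv, inv_eq_one_div, div_le_div_iff₀ (by positivity) (by positivity)]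
      linarith

/-- The Fourier multiplier of `Δ⁻¹`. -/
def invMult (n : ℤ × ℤ) : ℂ := -1 / ((n.1 : ℂ) ^ 2 + (n.2 : ℂ) ^ 2)

/-- The Fourier multiplier of `-∂_y Δ⁻¹`. -/
def velMult₁ (n : ℤ × ℤ) : ℂ := Complex.I * n.2 / ((n.1 : ℂ) ^ 2 + (n.2 : ℂ) ^ 2)

/-- The Fourier multiplier of `∂_x Δ⁻¹`. -/
def velMult₂ (n : ℤ × ℤ) : ℂ := -(Complex.I * n.1) / ((n.1 : ℂ) ^ 2 + (n.2 : ℂ) ^ 2)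

theorem isMultiplier_invMult : IsMultiplier invMult := by
  refine isMultiplier_div fun n hn => ?_
  have : 0 < n.1 ^ 2 + n.2 ^ 2 := by
    by_contra h
    have hk : n.1 = 0 := by nlinarith [sq_nonneg n.1, sq_nonneg n.2]
    have hl : n.2 = 0 := by nlinarith [sq_nonneg n.1, sq_nonneg n.2]
    exact hn (Prod.ext hk hl)
  rw [norm_neg, norm_one, one_pow]
  exact_mod_cast this

theorem isMultiplier_velMult₁ : IsMultiplier velMult₁ := by
  refine isMultiplier_div fun n _ => ?_
  rw [norm_mul, Complex.norm_I, one_mul, Complex.norm_intCast, sq_abs]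
  nlinarith [sq_nonneg (n.1 : ℝ)]

theorem isMultiplier_velMult₂ : IsMultiplier velMult₂ := by
  refine isMultiplier_div fun n _ => ?_
  rw [norm_neg, norm_mul, Complex.norm_I, one_mul, Complex.norm_intCast, sq_abs]
  nlinarith [sq_nonneg (n.2 : ℝ)]

theorem invLaplacian_eq (f : ℝ × ℝ → ℂ) : invLaplacian f = mult invMult f := by
  ext p
  unfold invLaplacian mult trigSeries invMult fourierPair
  congr 1; ext n; congr 1; ring

/-- The first component of the velocity. -/
abbrev velX (f : ℝ × ℝ → ℂ) : ℝ × ℝ → ℂ := mult velMult₁ f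

/-- The second component of the velocity. -/
abbrev velY (f : ℝ × ℝ → ℂ) : ℝ × ℝ → ℂ := mult velMult₂ f

namespace IsSmoothPeriodic

variable {f g : ℝ × ℝ → ℂ}

theorem velocity_eq (hf : IsSmoothPeriodic f) : velocity f = fun p => (velX f p, velY f p) := by
  have hr := isMultiplier_invMult.rapidDecay hf
  ext p
  · simp only [velocity, invLaplacian_eq, mult]
    rw [dy_trigSeries hr, trigSeries, trigSeries, ← tsum_neg]
    congr 1; ext n; unfold invMult velMult₁; ring
  · simp only [velocity, invLaplacian_eq, mult]
    rw [dx_trigSeries hr]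
    congr 1; ext n; unfold invMult velMult₂; ring

theorem velX (hf : IsSmoothPeriodic f) : IsSmoothPeriodic (velX f) :=
  isMultiplier_velMult₁.isSmoothPeriodic hf

theorem velY (hf : IsSmoothPeriodic f) : IsSmoothPeriodic (velY f) :=
  isMultiplier_velMult₂.isSmoothPeriodic hf

/-- The velocity is divergence free. -/
theorem dx_velX_add_dy_velY (hf : IsSmoothPeriodic f) (p : ℝ × ℝ) :
    ShearFlow.dx (ShearFlow.velX f) p + ShearFlow.dy (ShearFlow.velY f) p = 0 := by
  have h : (ShearFlow.dx (ShearFlow.velX f)) =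
      fun p => (-1 : ℂ) * ShearFlow.dy (ShearFlow.velY f) p := by
    apply hf.velX.dx.ext_fourierXY (hf.velY.dy.const_mul _)
    intro k l
    rw [fourierXY_const_mul, hf.velX.fourierXY_dx, hf.velY.fourierXY_dy,
      isMultiplier_velMult₁.fourierXY_mult hf, isMultiplier_velMult₂.fourierXY_mult hf]
    unfold velMult₁ velMult₂
    ring
  rw [h]; ring

theorem fourierXY_add (hf : IsSmoothPeriodic f) (hg : IsSmoothPeriodic g) (k l : ℤ) :
    fourierXY (fun p => f p + g p) k l = fourierXY f k l + fourierXY g k l := by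
  rw [fourierXY_eq, fourierXY_eq, fourierXY_eq, ← coef_add (hf.continuous_fourierX k)
    (hg.continuous_fourierX k)]
  congr 1; ext y
  exact hf.fourierX_add hg k y

theorem Q_eq (hf : IsSmoothPeriodic f) (g : ℝ × ℝ → ℂ) : Q (velocity f) g = fun p =>
    -(ShearFlow.velX f p * ShearFlow.dx g p + ShearFlow.velY f p * ShearFlow.dy g p) := by
  ext p; simp only [Q, transport, hf.velocity_eq]

theorem Q (hf : IsSmoothPeriodic f) (hg : IsSmoothPeriodic g) :
    IsSmoothPeriodic (Q (velocity f) g) := by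
  rw [hf.Q_eq]
  exact ((hf.velX.mul hg.dx).add (hf.velY.mul hg.dy)).neg

/-- As the velocity is divergence free, the nonlinear term is a divergence and has zero mean. -/
theorem fourierXY_Q_zero (hf : IsSmoothPeriodic f) (hg : IsSmoothPeriodic g) :
    fourierXY (ShearFlow.Q (velocity f) g) 0 0 = 0 := by
  have h : ShearFlow.Q (velocity f) g = fun p => (-1 : ℂ) *
      (ShearFlow.dx (fun p => ShearFlow.velX f p * g p) p +
        ShearFlow.dy (fun p => ShearFlow.velY f p * g p) p) := by
    rw [hf.Q_eq, hf.velX.dx_mul hg, hf.velY.dy_mul hg]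
    ext p
    linear_combination g p * hf.dx_velX_add_dy_velY p
  rw [h, fourierXY_const_mul, (hf.velX.mul hg).dx.fourierXY_add (hf.velY.mul hg).dy,
    (hf.velX.mul hg).fourierXY_dx, (hf.velY.mul hg).fourierXY_dy]
  simp

theorem Gen_Q_le (hf : IsSmoothPeriodic f) (hg : IsSmoothPeriodic g) {z₁ z₂ : ℝ} (h₁ : 0 ≤ z₁)
    (h₂ : 0 ≤ z₂) : Gen (ShearFlow.Q (velocity f) g) z₁ z₂ ≤ ENNReal.ofReal multBound *
      (Gen f z₁ z₂ * (Gen (ShearFlow.dx g) z₁ z₂ + Gen (ShearFlow.dy g) z₁ z₂)) := by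
  rw [hf.Q_eq, ((hf.velX.mul hg.dx).add (hf.velY.mul hg.dy)).Gen_neg]
  refine ((hf.velX.mul hg.dx).Gen_add_le (hf.velY.mul hg.dy) _ _).trans ?_
  rw [mul_add, mul_add, ← mul_assoc, ← mul_assoc]
  refine add_le_add ((hf.velX.Gen_mul_le hg.dx h₁ h₂).trans ?_)
    ((hf.velY.Gen_mul_le hg.dy h₁ h₂).trans ?_)
  · exact mul_le_mul_left (isMultiplier_velMult₁.Gen_mult_le hf _ _) _
  · exact mul_le_mul_left (isMultiplier_velMult₂.Gen_mult_le hf _ _) _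

theorem linearized_eq (U : ℝ → ℝ) (hf : IsSmoothPeriodic f) (p : ℝ × ℝ) :
    linearized U f p = (U p.2 : ℂ) * ShearFlow.dx f p +
      (ShearFlow.velX f p * ShearFlow.dx (shearVorticity U) p +
        ShearFlow.velY f p * ShearFlow.dy (shearVorticity U) p) := by
  simp only [linearized, transport, shear, hf.velocity_eq, zero_mul, add_zero]

theorem mult_conj {m : ℤ × ℤ → ℂ} (hm : IsMultiplier m) (hf : IsSmoothPeriodic f)
    (h : ∀ k l, (starRingEnd ℂ) (m (-k, -l)) = m (k, l)) :
    mult m (fun p => (starRingEnd ℂ) (f p)) = fun p => (starRingEnd ℂ) (mult m f p) := by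
  apply (hm.isSmoothPeriodic hf.conj).ext_fourierXY (hm.isSmoothPeriodic hf).conj
  intro k l
  rw [fourierXY_conj, hm.fourierXY_mult hf.conj, hm.fourierXY_mult hf, fourierXY_conj, map_mul, h]

theorem velX_conj (hf : IsSmoothPeriodic f) : ShearFlow.velX (fun p => (starRingEnd ℂ) (f p)) =
    fun p => (starRingEnd ℂ) (ShearFlow.velX f p) :=
  mult_conj isMultiplier_velMult₁ hf fun k l => by simp [velMult₁]

theorem velY_conj (hf : IsSmoothPeriodic f) : ShearFlow.velY (fun p => (starRingEnd ℂ) (f p)) =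
    fun p => (starRingEnd ℂ) (ShearFlow.velY f p) :=
  mult_conj isMultiplier_velMult₂ hf fun k l => by simp [velMult₂]

theorem Q_conj (hf : IsSmoothPeriodic f) (hg : IsSmoothPeriodic g) (p : ℝ × ℝ) :
    ShearFlow.Q (velocity fun p => (starRingEnd ℂ) (f p)) (fun p => (starRingEnd ℂ) (g p)) p =
      (starRingEnd ℂ) (ShearFlow.Q (velocity f) g p) := by
  rw [hf.conj.Q_eq, hf.Q_eq, hf.velX_conj, hf.velY_conj, hg.dx_conj, hg.dy_conj]
  simp only [map_neg, map_add, map_mul]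

theorem linearized_conj (U : ℝ → ℝ) (hf : IsSmoothPeriodic f) (p : ℝ × ℝ) :
    linearized U (fun p => (starRingEnd ℂ) (f p)) p = (starRingEnd ℂ) (linearized U f p) := by
  have h0 : ShearFlow.dx (shearVorticity U) p = 0 := by
    simp [ShearFlow.dx, shearVorticity]
  have h1 : (starRingEnd ℂ) (ShearFlow.dy (shearVorticity U) p) =
      ShearFlow.dy (shearVorticity U) p := by
    unfold ShearFlow.dy shearVorticity
    rw [Complex.conj_eq_iff_im]
    have e : (fun s : ℝ => -((deriv U s : ℝ) : ℂ)) = fun s : ℝ => ((-deriv U s : ℝ) : ℂ) := by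
      ext s; push_cast; rfl
    simp only
    rw [e]
    by_cases hd : DifferentiableAt ℝ (fun s => -deriv U s) p.2
    · rw [hd.hasDerivAt.ofReal_comp.deriv, Complex.ofReal_im]
    · rw [deriv_zero_of_not_differentiableAt, Complex.zero_im]
      intro hc
      apply hd
      have := Complex.reCLM.differentiableAt.comp p.2 hc
      exact this
  rw [hf.conj.linearized_eq, hf.linearized_eq, hf.velX_conj, hf.velY_conj, hf.dx_conj, h0]
  simp only [map_add, map_mul, h1, Complex.conj_ofReal, map_zero]

theorem velX_const_mul (c : ℂ) (f : ℝ × ℝ → ℂ) (p : ℝ × ℝ) :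
    ShearFlow.velX (fun p => c * f p) p = c * ShearFlow.velX f p := by
  unfold ShearFlow.velX mult trigSeries fourierPair
  simp only [fourierXY_const_mul]
  rw [← tsum_mul_left]
  congr 1; ext n; ring

theorem velY_const_mul (c : ℂ) (f : ℝ × ℝ → ℂ) (p : ℝ × ℝ) :
    ShearFlow.velY (fun p => c * f p) p = c * ShearFlow.velY f p := by
  unfold ShearFlow.velY mult trigSeries fourierPair
  simp only [fourierXY_const_mul]
  rw [← tsum_mul_left]
  congr 1; ext n; ring

theorem linearized_const_mul (U : ℝ → ℝ) (c : ℂ) (hf : IsSmoothPeriodic f) (p : ℝ × ℝ) :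
    linearized U (fun p => c * f p) p = c * linearized U f p := by
  rw [(hf.const_mul c).linearized_eq, hf.linearized_eq, velX_const_mul, velY_const_mul,
    hf.dx_const_mul]
  ring

end IsSmoothPeriodic

theorem velX_zero (p : ℝ × ℝ) : velX 0 p = 0 := by
  have := IsSmoothPeriodic.velX_const_mul 0 0 p
  simpa [Pi.zero_def] using this

theorem velY_zero (p : ℝ × ℝ) : velY 0 p = 0 := by
  have := IsSmoothPeriodic.velY_const_mul 0 0 p
  simpa [Pi.zero_def] using this

theorem dx_zero : dx 0 = 0 := by ext p; simp [dx]

theorem dy_zero : dy 0 = 0 := by ext p; simp [dy]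

theorem Q_zero_left (g : ℝ × ℝ → ℂ) (p : ℝ × ℝ) : Q (velocity 0) g p = 0 := by
  have := IsSmoothPeriodic.zero.Q_eq g
  rw [show (0 : ℝ × ℝ → ℂ) = fun _ => 0 from rfl, this]
  simp only [← Pi.zero_def, velX_zero, velY_zero]
  simp

theorem Q_zero_right (u : ℝ × ℝ → ℂ × ℂ) (p : ℝ × ℝ) : Q u 0 p = 0 := by
  simp [Q, transport, dx_zero, dy_zero]

theorem linearized_zero (U : ℝ → ℝ) (p : ℝ × ℝ) : linearized U 0 p = 0 := by
  rw [show (0 : ℝ × ℝ → ℂ) = fun _ => 0 from rfl, IsSmoothPeriodic.zero.linearized_eq]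
  simp only [← Pi.zero_def, velX_zero, velY_zero, dx_zero]
  simp

/-- A vorticity with zero velocity vanishes. -/
theorem IsTorusField.eq_zero_of_velocity {f : ℝ × ℝ → ℂ} (hf : IsTorusField f)
    (h : ∀ p, velocity f p = 0) : f = 0 := by
  have hs := hf.isSmoothPeriodic
  rw [hs.velocity_eq] at h
  have h1 : velX f = fun _ => 0 := funext fun p => congrArg Prod.fst (h p)
  have h2 : velY f = fun _ => 0 := funext fun p => congrArg Prod.snd (h p)
  refine hs.ext_fourierXY IsSmoothPeriodic.zero fun k l => ?_
  have e0 : ∀ k l, fourierXY (fun _ => 0) k l = 0 := by simp [fourierXY, fourierX]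
  rw [show fourierXY 0 k l = 0 from e0 k l]
  have e1 := isMultiplier_velMult₁.fourierXY_mult hs k l
  have e2 := isMultiplier_velMult₂.fourierXY_mult hs k l
  rw [show mult velMult₁ f = fun _ => 0 from h1, e0] at e1
  rw [show mult velMult₂ f = fun _ => 0 from h2, e0] at e2
  by_cases hkl : k = 0 ∧ l = 0
  · obtain ⟨rfl, rfl⟩ := hkl
    exact hs.isTorusField_iff.mp hf
  · have hD : ((k : ℂ) ^ 2 + (l : ℂ) ^ 2) ≠ 0 := by
      intro h0
      have h0' : (k : ℝ) ^ 2 + (l : ℝ) ^ 2 = 0 := by exact_mod_cast h0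
      apply hkl
      constructor
      · have : (k : ℝ) = 0 := by nlinarith [sq_nonneg (k : ℝ), sq_nonneg (l : ℝ)]
        exact_mod_cast this
      · have : (l : ℝ) = 0 := by nlinarith [sq_nonneg (k : ℝ), sq_nonneg (l : ℝ)]
        exact_mod_cast this
    rcases mul_eq_zero.mp e1.symm with h3 | h3
    · rcases mul_eq_zero.mp e2.symm with h4 | h4
      · exfalso
        apply hkl
        simp only [velMult₁, velMult₂, div_eq_zero_iff, hD, or_false, neg_eq_zero, mul_eq_zero,
          Complex.I_ne_zero, false_or, Int.cast_eq_zero] at h3 h4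
        exact ⟨h4, h3⟩
      · exact h4
    · exact h3

namespace IsAdmissible

variable {f g : ℝ × ℝ → ℂ} {M N : ℝ}

theorem isSmoothPeriodic (hf : IsAdmissible N f) : IsSmoothPeriodic f :=
  hf.torusField.isSmoothPeriodic

theorem zero : IsAdmissible N 0 where
  torusField := by
    rw [show (0 : ℝ × ℝ → ℂ) = fun _ => 0 from rfl, IsSmoothPeriodic.zero.isTorusField_iff]
    simp [fourierXY, fourierX]
  analytic := ⟨1, one_pos, by
    rw [show (0 : ℝ × ℝ → ℂ) = fun _ => 0 from rfl, IsSmoothPeriodic.Gen_zero]; simp⟩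
  frequencies := by simp [fourierX]

theorem add (hf : IsAdmissible N f) (hg : IsAdmissible N g) :
    IsAdmissible N (fun p => f p + g p) where
  torusField := by
    have h1 := hf.isSmoothPeriodic
    have h2 := hg.isSmoothPeriodic
    rw [(h1.add h2).isTorusField_iff, h1.fourierXY_add h2,
      h1.isTorusField_iff.mp hf.torusField, h2.isTorusField_iff.mp hg.torusField, add_zero]
  analytic := by
    obtain ⟨r, hr, h1⟩ := hf.analytic
    obtain ⟨s, hs, h2⟩ := hg.analytic
    have hm : 0 < min r s := lt_min hr hs
    refine ⟨min r s, hm, ne_top_of_le_ne_top (ENNReal.add_ne_top.mpr ⟨h1, h2⟩)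
      ((hf.isSmoothPeriodic.Gen_add_le hg.isSmoothPeriodic _ _).trans (add_le_add ?_ ?_))⟩
    · exact Gen_mono f (min_le_left _ _) hm.le (min_le_left _ _)
    · exact Gen_mono g (min_le_right _ _) hm.le (min_le_right _ _)
  frequencies k hk y := by
    rw [hf.isSmoothPeriodic.fourierX_add hg.isSmoothPeriodic, hf.frequencies k hk,
      hg.frequencies k hk, add_zero]

theorem const_mul (c : ℂ) (hf : IsAdmissible N f) : IsAdmissible N (fun p => c * f p) where
  torusField := by
    have h1 := hf.isSmoothPeriodic
    rw [(h1.const_mul c).isTorusField_iff, IsSmoothPeriodic.fourierXY_const_mul,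
      h1.isTorusField_iff.mp hf.torusField, mul_zero]
  analytic := by
    obtain ⟨r, hr, h1⟩ := hf.analytic
    refine ⟨r, hr, ?_⟩
    rw [hf.isSmoothPeriodic.Gen_const_mul]
    exact ENNReal.mul_ne_top (by simp) h1
  frequencies k hk y := by
    rw [IsSmoothPeriodic.fourierX_const_mul, hf.frequencies k hk, mul_zero]

theorem conj (hf : IsAdmissible N f) : IsAdmissible N (fun p => (starRingEnd ℂ) (f p)) where
  torusField := by
    have h1 := hf.isSmoothPeriodic
    rw [h1.conj.isTorusField_iff, IsSmoothPeriodic.fourierXY_conj, neg_zero,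
      h1.isTorusField_iff.mp hf.torusField, map_zero]
  analytic := by
    obtain ⟨r, hr, h1⟩ := hf.analytic
    exact ⟨r, hr, by rwa [hf.isSmoothPeriodic.Gen_conj]⟩
  frequencies k hk y := by
    rw [IsSmoothPeriodic.fourierX_conj, hf.frequencies (-k) (by simpa using hk), map_zero]

theorem sum {ι : Type*} (s : Finset ι) {F : ι → ℝ × ℝ → ℂ} (hF : ∀ i ∈ s, IsAdmissible N (F i)) :
    IsAdmissible N (fun p => ∑ i ∈ s, F i p) := by
  classical
  induction s using Finset.induction_on with
  | empty => simp only [Finset.sum_empty]; exact zero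
  | insert a s ha ih =>
    simp only [Finset.sum_insert ha]
    exact (hF a (Finset.mem_insert_self a s)).add
      (ih fun i hi => hF i (Finset.mem_insert_of_mem hi))

theorem Q (hf : IsAdmissible M f) (hg : IsAdmissible N g) :
    IsAdmissible (M + N) (Q (velocity f) g) where
  torusField := by
    have h1 := hf.isSmoothPeriodic
    have h2 := hg.isSmoothPeriodic
    rw [(h1.Q h2).isTorusField_iff, h1.fourierXY_Q_zero h2]
  analytic := by
    have hfs := hf.isSmoothPeriodic
    have hgs := hg.isSmoothPeriodic
    obtain ⟨r, hr, h1⟩ := hf.analytic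
    obtain ⟨s, hs, h2⟩ := hg.analytic
    have hm : 0 < min r s := lt_min hr hs
    have hm2 : min r s / 2 < min r s := half_lt_self hm
    refine ⟨min r s / 2, by positivity, ne_top_of_le_ne_top ?_
      (hfs.Gen_Q_le hgs (by positivity) (by positivity))⟩
    have hg1 : Gen g (min r s) (min r s) ≠ ⊤ := ne_top_of_le_ne_top h2
      (Gen_mono g (min_le_right _ _) hm.le (min_le_right _ _))
    refine ENNReal.mul_ne_top ENNReal.ofReal_ne_top (ENNReal.mul_ne_top ?_
      (ENNReal.add_ne_top.mpr ⟨?_, ?_⟩))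
    · exact ne_top_of_le_ne_top h1 (Gen_mono f (hm2.le.trans (min_le_left _ _)) (by positivity)
        (hm2.le.trans (min_le_left _ _)))
    · refine ne_top_of_le_ne_top ?_ (hgs.Gen_dx_le hm2 (by positivity))
      exact ENNReal.mul_ne_top ENNReal.ofReal_ne_top (ne_top_of_le_ne_top hg1
        (Gen_mono g le_rfl (by positivity) hm2.le))
    · refine ne_top_of_le_ne_top ?_ (hgs.Gen_dy_le (by positivity) hm2)
      exact ENNReal.mul_ne_top ENNReal.ofReal_ne_top (ne_top_of_le_ne_top hg1
        (Gen_mono g hm2.le hm.le le_rfl))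
  frequencies k hk y := by
    have hfs := hf.isSmoothPeriodic
    have hgs := hg.isSmoothPeriodic
    have e : ShearFlow.Q (velocity f) g = fun p =>
        (-1 : ℂ) * (velX f p * dx g p + velY f p * dy g p) := by
      rw [hfs.Q_eq]; ext p; ring
    rw [e, IsSmoothPeriodic.fourierX_const_mul,
      (hfs.velX.mul hgs.dx).fourierX_add (hfs.velY.mul hgs.dy),
      hfs.velX.fourierX_mul_eq_zero hgs.dx (M := M) (N := N),
      hfs.velY.fourierX_mul_eq_zero hgs.dy (M := M) (N := N)]
    · simp
    · exact fun k hk y => isMultiplier_velMult₂.fourierX_mult_eq_zero hfs (hf.frequencies k hk) y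
    · intro k hk y
      have h0 : fourierX g k = fun _ => 0 := funext (hg.frequencies k hk)
      rw [← (hgs.hasDerivAt_fourierX k y).deriv, h0, deriv_const]
    · exact hk
    · exact fun k hk y => isMultiplier_velMult₁.fourierX_mult_eq_zero hfs (hf.frequencies k hk) y
    · intro k hk y
      rw [hgs.fourierX_dx, hg.frequencies k hk, mul_zero]
    · exact hk

end IsAdmissible

/-! ### Formal exponential expansions of solutions -/

section Expansion

/-- Exponents `lam i` of an expansion `∑ᵢ exp (lam i t) Wᵢ` generated by modes of growth rate
`Re α`: they are additive in the index, and the growth rate is `deg i * Re α`. The indices are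
`ℕ` for one mode and `ℕ × ℕ` for a mode and its complex conjugate. -/
structure IsExponentSystem {ι : Type} [AddCommMonoid ι] (α : ℂ) (lam : ι → ℂ) (deg : ι → ℕ) :
    Prop where
  lam_add : ∀ i j, lam (i + j) = lam i + lam j
  deg_add : ∀ i j, deg (i + j) = deg i + deg j
  re_lam : ∀ i, (lam i).re = deg i * α.re
  norm_lam_le : ∀ i, ‖lam i‖ ≤ deg i * ‖α‖

/-- The coefficients `Wᵢ` of a formal solution `∑ᵢ exp (lam i t) Wᵢ` of the vorticity equation,
with prescribed coefficients `seed i` in degree one. -/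
structure IsExpansion {ι : Type} [AddCommMonoid ι] [Finset.HasAntidiagonal ι] (U : ℝ → ℝ)
    (lam : ι → ℂ) (deg : ι → ℕ) (K : ℕ) (seed W : ι → ℝ × ℝ → ℂ) : Prop where
  zero : ∀ i, deg i = 0 → W i = 0
  one : ∀ i, deg i = 1 → W i = seed i
  admissible : ∀ i, IsAdmissible ((deg i : ℝ) * K) (W i)
  recurrence : ∀ i, 2 ≤ deg i → ∀ p, lam i * W i p + linearized U (W i) p =
    ∑ q ∈ antidiagonal i, Q (velocity (W q.1)) (W q.2) p

variable {ι : Type} [AddCommMonoid ι] [Finset.HasAntidiagonal ι] {U : ℝ → ℝ} {α : ℂ} {K : ℕ}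
  {lam : ι → ℂ} {deg : ι → ℕ} {seed W W' : ι → ℝ × ℝ → ℂ}

/-- The resolvent assumption at the exponents of degree `n ≥ 2`, for the frequencies that occur
there. -/
theorem ResolventBound.exists_of_degree (hα : 0 < α.re) (H1 : ResolventBound U α K) :
    ∃ C : ℝ, 0 < C ∧ ∃ z₀ : ℝ, 0 < z₀ ∧
    ∀ n : ℕ, 2 ≤ n → ∀ μ : ℂ, μ.re = n * α.re →
      ∀ f : ℝ × ℝ → ℂ, IsAdmissible ((n : ℝ) * K) f →
        ∃ g : ℝ × ℝ → ℂ, IsAdmissible ((n : ℝ) * K) g ∧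
          (∀ p, μ * g p + linearized U g p = f p) ∧
          (∀ h : ℝ × ℝ → ℂ, IsAdmissible ((n : ℝ) * K) h →
            (∀ p, μ * h p + linearized U h p = f p) → h = g) ∧
          ∀ z₁ ∈ Set.Icc 0 z₀, ∀ z₂ ∈ Set.Icc 0 z₀,
            Gen g z₁ z₂ ≤ ENNReal.ofReal (C / (n * α.re)) * Gen f z₁ z₂ := by
  obtain ⟨C, hC, z₀, hz₀, h⟩ := H1
  refine ⟨C, hC, z₀, hz₀, fun n hn μ hμ f hf => ?_⟩
  have hn' : (2 : ℝ) ≤ n := by exact_mod_cast hn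
  have hfreq : (K : ℝ) * (μ.re / α.re) = (n : ℝ) * K := by
    rw [hμ, mul_div_assoc, div_self hα.ne']; ring
  obtain ⟨g, hg, heq, huniq, hGen⟩ := h μ (by rw [hμ]; nlinarith) f (by rwa [hfreq])
  rw [hfreq] at hg huniq
  refine ⟨g, hg, heq, huniq, fun z₁ h₁ z₂ h₂ => (hGen z₁ h₁ z₂ h₂).trans ?_⟩
  refine mul_le_mul_left (ENNReal.ofReal_le_ofReal ?_) _
  have hpos : 0 < (n : ℝ) * α.re := by positivity
  gcongr
  rw [← hμ]
  exact Complex.re_le_norm μ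

theorem IsExpansion.isSmoothPeriodic (hW : IsExpansion U lam deg K seed W) (i : ι) :
    IsSmoothPeriodic (W i) := (hW.admissible i).isSmoothPeriodic

theorem IsExponentSystem.admissible_sum_Q (hs : IsExponentSystem α lam deg) (i : ι)
    (hW : ∀ q ∈ antidiagonal i, IsAdmissible ((deg q.1 : ℝ) * K) (W q.1) ∧
      IsAdmissible ((deg q.2 : ℝ) * K) (W q.2)) : IsAdmissible ((deg i : ℝ) * K)
        (fun p => ∑ q ∈ antidiagonal i, Q (velocity (W q.1)) (W q.2) p) := by
  refine IsAdmissible.sum (antidiagonal i) (F := fun q => Q (velocity (W q.1)) (W q.2))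
    fun q hq => ?_
  obtain ⟨h1, h2⟩ := hW q hq
  have hd : deg i = deg q.1 + deg q.2 := by
    rw [← hs.deg_add, Finset.HasAntidiagonal.mem_antidiagonal.mp hq]
  have := h1.Q h2
  rwa [← add_mul, ← Nat.cast_add, ← hd] at this

/-- Pairs with a factor of degree zero do not contribute, so the nonlinear term in degree `n`
depends on the coefficients of degree less than `n` only. -/
theorem IsExponentSystem.sum_Q_congr (hs : IsExponentSystem α lam deg) {i : ι}
    (hW : ∀ j, deg j = 0 → W j = 0) (hW' : ∀ j, deg j = 0 → W' j = 0)
    (h : ∀ j, deg j < deg i → W j = W' j) (p : ℝ × ℝ) :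
    ∑ q ∈ antidiagonal i, Q (velocity (W q.1)) (W q.2) p =
      ∑ q ∈ antidiagonal i, Q (velocity (W' q.1)) (W' q.2) p := by
  refine Finset.sum_congr rfl fun q hq => ?_
  have hd : deg i = deg q.1 + deg q.2 := by
    rw [← hs.deg_add, Finset.HasAntidiagonal.mem_antidiagonal.mp hq]
  by_cases h1 : deg q.1 = 0
  · rw [hW _ h1, hW' _ h1, Q_zero_left, Q_zero_left]
  by_cases h2 : deg q.2 = 0
  · rw [hW _ h2, hW' _ h2, Q_zero_right, Q_zero_right]
  rw [h q.1 (by omega), h q.2 (by omega)]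

/-- By induction on the degree, from the uniqueness of the resolvent. -/
theorem IsExpansion.unique (hs : IsExponentSystem α lam deg) (hα : 0 < α.re)
    (H1 : ResolventBound U α K) (hW : IsExpansion U lam deg K seed W)
    (hW' : IsExpansion U lam deg K seed W') : W' = W := by
  obtain ⟨C, -, z₀, -, h⟩ := H1.exists_of_degree hα
  have key : ∀ n, ∀ i, deg i = n → W' i = W i := by
    intro n
    induction n using Nat.strong_induction_on with
    | _ n ih =>
      intro i hi
      rcases Nat.lt_or_ge n 2 with h2 | h2
      · interval_cases n
        · rw [hW.zero i hi, hW'.zero i hi]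
        · rw [hW.one i hi, hW'.one i hi]
      · obtain ⟨g, -, -, huniq, -⟩ := h n h2 (lam i) (by rw [hs.re_lam, hi]) _
          (hi ▸ hs.admissible_sum_Q i fun q _ => ⟨hW.admissible q.1, hW.admissible q.2⟩)
        rw [huniq (W i) (hi ▸ hW.admissible i) (hW.recurrence i (hi ▸ h2)),
          huniq (W' i) (hi ▸ hW'.admissible i) fun p => ?_]
        rw [hW'.recurrence i (hi ▸ h2)]
        exact hs.sum_Q_congr hW'.zero hW.zero (fun j hj => ih (deg j) (hi ▸ hj) j rfl) p
  exact funext fun i => key _ i rfl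

open Classical in
/-- A solution operator for `μ g + ℒ g = f` among the admissible functions (`0` if there is no
solution). -/
def resolventSol (U : ℝ → ℝ) (N : ℝ) (μ : ℂ) (f : ℝ × ℝ → ℂ) : ℝ × ℝ → ℂ :=
  if h : ∃ g, IsAdmissible N g ∧ ∀ p, μ * g p + linearized U g p = f p then h.choose else 0

/-- The expansion, computed up to degree `n` and continued by zero. -/
def expansionUpTo (U : ℝ → ℝ) (lam : ι → ℂ) (deg : ι → ℕ) (K : ℕ) (seed : ι → ℝ × ℝ → ℂ) :
    ℕ → ι → ℝ × ℝ → ℂ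
  | 0, _ => 0
  | n + 1, i =>
    if deg i = n + 1 then
      if n = 0 then seed i
      else resolventSol U ((deg i : ℝ) * K) (lam i) fun p => ∑ q ∈ antidiagonal i,
        Q (velocity (expansionUpTo U lam deg K seed n q.1)) (expansionUpTo U lam deg K seed n q.2) p
    else expansionUpTo U lam deg K seed n i

theorem expansionUpTo_eq {n : ℕ} {i : ι} (h : deg i ≤ n) :
    expansionUpTo U lam deg K seed n i = expansionUpTo U lam deg K seed (deg i) i := by
  induction n with
  | zero => rw [Nat.le_zero.mp h]
  | succ n ih =>
    rcases Nat.lt_or_ge n (deg i) with h' | h'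
    · rw [show deg i = n + 1 by omega]
    · rw [expansionUpTo, if_neg (by omega), ih h']

/-- Existence of the expansion, degree by degree. -/
theorem IsExponentSystem.exists_expansion (hs : IsExponentSystem α lam deg) (hα : 0 < α.re)
    (H1 : ResolventBound U α K) (hseed : ∀ i, deg i = 1 → IsAdmissible K (seed i)) :
    ∃ W, IsExpansion U lam deg K seed W := by
  obtain ⟨C, -, z₀, -, h⟩ := H1.exists_of_degree hα
  set W : ι → ℝ × ℝ → ℂ := fun i => expansionUpTo U lam deg K seed (deg i) i with hW
  have h0 : ∀ i, deg i = 0 → W i = 0 := fun i hi => by simp [hW, hi, expansionUpTo]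
  have h1 : ∀ i, deg i = 1 → W i = seed i := fun i hi => by simp [hW, hi, expansionUpTo]
  have h2 : ∀ i, 2 ≤ deg i → W i = resolventSol U ((deg i : ℝ) * K) (lam i)
      fun p => ∑ q ∈ antidiagonal i, Q (velocity (W q.1)) (W q.2) p := by
    intro i hi
    obtain ⟨n, hn⟩ : ∃ n, deg i = n + 1 := ⟨deg i - 1, by omega⟩
    have e1 : W i = expansionUpTo U lam deg K seed (n + 1) i := by
      rw [← hn]
    rw [e1, expansionUpTo, if_pos hn, if_neg (by omega)]
    refine congrArg (resolventSol _ _ _) (funext fun p => ?_)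
    refine hs.sum_Q_congr (fun j hj => ?_) h0 (fun j hj => ?_) p
    · rw [expansionUpTo_eq (by omega), hj, expansionUpTo]
    · exact expansionUpTo_eq (by omega)
  have hadm : ∀ n, ∀ i, deg i = n → IsAdmissible ((deg i : ℝ) * K) (W i) ∧
      (2 ≤ deg i → ∀ p, lam i * W i p + linearized U (W i) p =
        ∑ q ∈ antidiagonal i, Q (velocity (W q.1)) (W q.2) p) := by
    intro n
    induction n using Nat.strong_induction_on with
    | _ n ih =>
      intro i hi
      rcases Nat.lt_or_ge n 2 with hn | hn
      · refine ⟨?_, fun h3 => by omega⟩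
        interval_cases n
        · rw [h0 i hi]; exact IsAdmissible.zero
        · rw [h1 i hi, hi, Nat.cast_one, one_mul]; exact hseed i hi
      · have hsum : IsAdmissible ((n : ℝ) * K)
            (fun p => ∑ q ∈ antidiagonal i, Q (velocity (W q.1)) (W q.2) p) := by
          -- Where a factor has degree `n`, the other one has degree zero and the term vanishes.
          set W₀ : ι → ℝ × ℝ → ℂ := fun j => if deg j < n then W j else 0 with hW₀
          have e : (fun p => ∑ q ∈ antidiagonal i, Q (velocity (W q.1)) (W q.2) p) =
              fun p => ∑ q ∈ antidiagonal i, Q (velocity (W₀ q.1)) (W₀ q.2) p := by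
            ext p
            refine hs.sum_Q_congr h0 (fun j hj => ?_) (fun j hj => ?_) p
            · simp only [hW₀]; split_ifs
              · exact h0 j hj
              · rfl
            · simp only [hW₀]; rw [if_pos (hi ▸ hj)]
          rw [e, ← hi]
          have hW₀a : ∀ j, IsAdmissible ((deg j : ℝ) * K) (W₀ j) := by
            intro j
            simp only [hW₀]
            split_ifs with hj
            · exact (ih _ hj j rfl).1
            · exact IsAdmissible.zero
          exact hs.admissible_sum_Q i fun q _ => ⟨hW₀a q.1, hW₀a q.2⟩
        obtain ⟨g, hg, heq, -, -⟩ := h n hn (lam i) (by rw [hs.re_lam, hi]) _ hsum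
        have hex : ∃ g, IsAdmissible ((deg i : ℝ) * K) g ∧ ∀ p, lam i * g p + linearized U g p =
            ∑ q ∈ antidiagonal i, Q (velocity (W q.1)) (W q.2) p := ⟨g, by rwa [hi], heq⟩
        rw [h2 i (hi ▸ hn), resolventSol, dif_pos hex]
        exact ⟨hex.choose_spec.1, fun _ => hex.choose_spec.2⟩
  exact ⟨W, h0, h1, fun i => (hadm _ i rfl).1, fun i => (hadm _ i rfl).2⟩

end Expansion

/-! ### Geometric bounds for the expansion -/

section Majorant

variable {ι : Type} {U : ℝ → ℝ} {α : ℂ} {K : ℕ}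
  {lam : ι → ℂ} {deg : ι → ℕ} {seed W W' : ι → ℝ × ℝ → ℂ}

/-- The sum of a family over the indices of degree `n`. -/
def degSum (deg : ι → ℕ) (F : ι → ℝ≥0∞) (n : ℕ) : ℝ≥0∞ := ∑' i, if deg i = n then F i else 0

theorem degSum_mono {F G : ι → ℝ≥0∞} {n : ℕ} (h : ∀ i, deg i = n → F i ≤ G i) :
    degSum deg F n ≤ degSum deg G n := by
  refine ENNReal.tsum_le_tsum fun i => ?_
  split_ifs with hi
  · exact h i hi
  · exact le_rfl

theorem degSum_const_mul (c : ℝ≥0∞) (F : ι → ℝ≥0∞) (n : ℕ) :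
    degSum deg (fun i => c * F i) n = c * degSum deg F n := by
  rw [degSum, degSum, ← ENNReal.tsum_mul_left]
  congr 1; ext i; split_ifs <;> simp

theorem tsum_degSum (F : ι → ℝ≥0∞) : ∑' n, degSum deg F n = ∑' i, F i := by
  unfold degSum
  rw [ENNReal.tsum_comm]
  congr 1; ext i
  rw [tsum_eq_single (deg i) (fun n hn => if_neg hn.symm), if_pos rfl]

variable [AddCommMonoid ι] [Finset.HasAntidiagonal ι]

/-- The sum in degree `n` of a convolution is the convolution of the sums in each degree. -/
theorem degSum_antidiagonal (hd : ∀ i j, deg (i + j) = deg i + deg j) (F G : ι → ℝ≥0∞) (n : ℕ) :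
    degSum deg (fun i => ∑ q ∈ antidiagonal i, F q.1 * G q.2) n =
      ∑ q ∈ antidiagonal n, degSum deg F q.1 * degSum deg G q.2 := by
  have h1 : ∀ i, (if deg i = n then ∑ q ∈ antidiagonal i, F q.1 * G q.2 else 0) =
      ∑ q ∈ antidiagonal i, if deg q.1 + deg q.2 = n then F q.1 * G q.2 else 0 := by
    intro i
    have h2 : ∀ q ∈ antidiagonal i, deg q.1 + deg q.2 = deg i := fun q hq => by
      rw [← hd, Finset.HasAntidiagonal.mem_antidiagonal.mp hq]
    split_ifs with hi
    · exact Finset.sum_congr rfl fun q hq => by rw [if_pos ((h2 q hq).trans hi)]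
    · exact (Finset.sum_eq_zero fun q hq => by rw [if_neg (by rw [h2 q hq]; exact hi)]).symm
  have h3 : ∀ q : ι × ι, (if deg q.1 + deg q.2 = n then F q.1 * G q.2 else 0) =
      ∑ r ∈ antidiagonal n, (if deg q.1 = r.1 then F q.1 else 0) *
        (if deg q.2 = r.2 then G q.2 else 0) := by
    intro q
    split_ifs with hq
    · rw [Finset.sum_eq_single (deg q.1, deg q.2)]
      · simp
      · rintro ⟨a, b⟩ - hne
        by_cases ha : deg q.1 = a
        · have hb : deg q.2 ≠ b := fun hb => hne (by rw [ha, hb])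
          simp [hb]
        · simp [ha]
      · intro h; exact absurd (Finset.HasAntidiagonal.mem_antidiagonal.mpr hq) h
    · refine (Finset.sum_eq_zero fun r hr => ?_).symm
      have hr' := Finset.HasAntidiagonal.mem_antidiagonal.mp hr
      by_cases ha : deg q.1 = r.1
      · have hb : deg q.2 ≠ r.2 := fun hb => hq (by rw [ha, hb, hr'])
        simp [hb]
      · simp [ha]
  unfold degSum
  simp_rw [h1]
  rw [tsum_sum_antidiagonal (fun q : ι × ι => if deg q.1 + deg q.2 = n then F q.1 * G q.2 else 0)]
  simp_rw [h3]
  rw [Summable.tsum_finsetSum (fun _ _ => ENNReal.summable)]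
  refine Finset.sum_congr rfl fun r _ => ?_
  exact tsum_prod_mul (fun i => if deg i = r.1 then F i else 0)
    (fun i => if deg i = r.2 then G i else 0)

/-- The majorant of the sum of the generator functions in degree `n + 1`, at distance `s` from the
boundary of the domain of analyticity: the solution of the convolution recursion `majorant_succ`. -/
def majorant (A D s : ℝ) (n : ℕ) : ℝ := A * (D * A / s) ^ n * catalan n

theorem majorant_nonneg {A D s : ℝ} (hA : 0 ≤ A) (hD : 0 ≤ D) (hs : 0 ≤ s) (n : ℕ) :
    0 ≤ majorant A D s n := by unfold majorant; positivity

theorem majorant_succ (A D s : ℝ) (n : ℕ) : majorant A D s (n + 1) =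
    D / s * ∑ q ∈ antidiagonal n, majorant A D s q.1 * majorant A D s q.2 := by
  unfold majorant
  rw [catalan_succ', Nat.cast_sum, Finset.mul_sum, Finset.mul_sum]
  refine Finset.sum_congr rfl fun q hq => ?_
  rw [← Finset.HasAntidiagonal.mem_antidiagonal.mp hq]
  push_cast
  ring

/-- Shrinking the distance to the boundary by the factor `(n + 1) / (n + 2)` costs at most a
constant factor. -/
theorem majorant_shrink_le {A D s : ℝ} (hA : 0 ≤ A) (hD : 0 ≤ D) (hs : 0 < s) (n : ℕ) :
    majorant A D (s * ((n + 1) / (n + 2))) n ≤ 3 * majorant A D s n := by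
  have e : D * A / (s * ((n + 1) / (n + 2))) = D * A / s * (1 + 1 / ((n : ℝ) + 1)) := by
    field_simp; ring
  have h1 : (1 + 1 / ((n : ℝ) + 1)) ^ n ≤ 3 := by
    calc (1 + 1 / ((n : ℝ) + 1)) ^ n ≤ (Real.exp (1 / ((n : ℝ) + 1))) ^ n := by
          have := Real.add_one_le_exp (1 / ((n : ℝ) + 1))
          gcongr
          linarith
      _ = Real.exp (n * (1 / ((n : ℝ) + 1))) := by rw [← Real.exp_nat_mul]
      _ ≤ Real.exp 1 := by
          apply Real.exp_le_exp.mpr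
          rw [mul_one_div, div_le_one (by positivity)]
          linarith
      _ ≤ 3 := by linarith [Real.exp_one_lt_d9]
  unfold majorant
  rw [e, mul_pow]
  have h2 : 0 ≤ A * (D * A / s) ^ n * catalan n := by positivity
  calc A * ((D * A / s) ^ n * (1 + 1 / ((n : ℝ) + 1)) ^ n) * catalan n
      = (1 + 1 / ((n : ℝ) + 1)) ^ n * (A * (D * A / s) ^ n * catalan n) := by ring
    _ ≤ _ := by gcongr

theorem majorant_le {A D s : ℝ} (hA : 0 ≤ A) (hD : 0 ≤ D) (hs : 0 < s) (n : ℕ) :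
    majorant A D s n ≤ A * (4 * D / s * A) ^ n := by
  have h : catalan n ≤ 4 ^ n := by
    rw [catalan_eq_centralBinom_div]
    refine (Nat.div_le_self _ _).trans ?_
    rw [Nat.centralBinom, show 4 ^ n = 2 ^ (2 * n) by rw [pow_mul]; norm_num]
    exact Nat.choose_le_two_pow _ _
  have h' : (catalan n : ℝ) ≤ 4 ^ n := by exact_mod_cast h
  unfold majorant
  calc A * (D * A / s) ^ n * catalan n ≤ A * (D * A / s) ^ n * 4 ^ n := by gcongr
    _ = _ := by rw [mul_assoc, ← mul_pow]; congr 2; ring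

/-- The estimate of the nonlinear term in degree `n`: a derivative of a coefficient of degree `m`
costs a factor of order `m`, which the resolvent compensates. -/
theorem IsExpansion.Gen_step (hs : IsExponentSystem α lam deg)
    (hW : IsExpansion U lam deg K seed W) {C r z : ℝ} {n : ℕ}
    (hres : ∀ i, deg i = n → Gen (W i) r z ≤ ENNReal.ofReal (C / (n * α.re)) *
      Gen (fun p => ∑ q ∈ antidiagonal i, Q (velocity (W q.1)) (W q.2) p) r z)
    (hr : 0 ≤ r) (hz : 0 ≤ z) : degSum deg (fun i => Gen (W i) r z) n ≤
      ENNReal.ofReal (C / (n * α.re)) * (ENNReal.ofReal multBound *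
        ∑ q ∈ antidiagonal n, degSum deg (fun i => Gen (W i) r z) q.1 *
          degSum deg (fun i => Gen (dx (W i)) r z + Gen (dy (W i)) r z) q.2) := by
  rw [← degSum_antidiagonal hs.deg_add, ← degSum_const_mul, ← degSum_const_mul]
  refine degSum_mono fun i hi => (hres i hi).trans (mul_le_mul_right ?_ _)
  have hsm := hW.isSmoothPeriodic
  refine (IsSmoothPeriodic.Gen_sum_le (antidiagonal i)
    (F := fun q => Q (velocity (W q.1)) (W q.2)) (fun q => (hsm q.1).Q (hsm q.2)) _ _).trans ?_
  rw [Finset.mul_sum]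
  exact Finset.sum_le_sum fun q _ => (hsm q.1).Gen_Q_le (hsm q.2) hr hz

theorem IsExpansion.degSum_derivatives_le (hW : IsExpansion U lam deg K seed W) {r z z' : ℝ}
    (hz : 0 ≤ z) (hz' : z < z') (n : ℕ) :
    degSum deg (fun i => Gen (dx (W i)) r z + Gen (dy (W i)) r z) n ≤
      ENNReal.ofReal (n * K + 1 / (z' - z)) * degSum deg (fun i => Gen (W i) r z') n := by
  rw [← degSum_const_mul]
  refine degSum_mono fun i hi => ?_
  have hd : 0 < z' - z := sub_pos.mpr hz'
  rw [ENNReal.ofReal_add (by positivity) (by positivity), add_mul]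
  refine add_le_add ?_ ((hW.isSmoothPeriodic i).Gen_dy_le hz hz')
  refine ((hW.isSmoothPeriodic i).Gen_dx_le_of_frequencies
    (hW.admissible i).frequencies _ _).trans ?_
  rw [hi]
  exact mul_le_mul_right (Gen_mono _ le_rfl hz hz'.le) _

/-- The expansion converges geometrically in an analytic norm, with a ratio that is proportional
to the size `A` of the coefficients of degree one. -/
theorem ResolventBound.exists_degSum_le (hα : 0 < α.re) (H1 : ResolventBound U α K) {r₁ : ℝ}
    (hr₁ : 0 < r₁) : ∃ ρ : ℝ, 0 < ρ ∧ ∃ B : ℝ, 0 < B ∧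
    ∀ {ι : Type} [AddCommMonoid ι] [Finset.HasAntidiagonal ι] {lam : ι → ℂ} {deg : ι → ℕ}
      {seed W : ι → ℝ × ℝ → ℂ}, IsExponentSystem α lam deg → IsExpansion U lam deg K seed W →
      ∀ A : ℝ, 0 ≤ A → degSum deg (fun i => Gen (seed i) r₁ r₁) 1 ≤ ENNReal.ofReal A →
      ∀ n, degSum deg (fun i => Gen (W i) ρ ρ) (n + 1) ≤ ENNReal.ofReal (A * (B * A) ^ n) := by
  obtain ⟨C, hC, z₀, hz₀, hres⟩ := H1.exists_of_degree hα
  -- all estimates take place on `[0, r)`, where the resolvent bound holds and the seeds are finite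
  set r : ℝ := min r₁ (min z₀ 1) with hr
  have hr0 : 0 < r := lt_min hr₁ (lt_min hz₀ one_pos)
  have hrr₁ : r ≤ r₁ := min_le_left _ _
  have hrz₀ : r ≤ z₀ := (min_le_right _ _).trans (min_le_left _ _)
  have hr1 : r ≤ 1 := (min_le_right _ _).trans (min_le_right _ _)
  have hmb := multBound_pos
  set D : ℝ := 3 * C * multBound * (K + 2) / α.re with hD
  have hD0 : 0 < D := by positivity
  refine ⟨r / 2, by positivity, 4 * D / (r / 2), by positivity, ?_⟩
  intro ι _ _ lam deg seed W hs hW A hA hseed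
  have key : ∀ n, ∀ z, 0 ≤ z → z < r →
      degSum deg (fun i => Gen (W i) r z) (n + 1) ≤ ENNReal.ofReal (majorant A D (r - z) n) := by
    intro n
    induction n using Nat.strong_induction_on with
    | _ n ih =>
      intro z hz hzr
      have hrz : 0 < r - z := sub_pos.mpr hzr
      rcases n with _ | n
      · refine le_trans ?_ (hseed.trans (le_of_eq ?_))
        · refine degSum_mono fun i hi => ?_
          rw [hW.one i hi]
          exact Gen_mono _ hrr₁ hz (hzr.le.trans hrr₁)
        · simp [majorant]
      · have hstep := hW.Gen_step (C := C) (r := r) (z := z) (n := n + 2) hs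
          (fun i hi => ?_) hr0.le hz
        swap
        · obtain ⟨g, -, -, huniq, hGen⟩ := hres (n + 2) (by omega) (lam i) (by rw [hs.re_lam, hi]) _
            (hi ▸ hs.admissible_sum_Q i fun q _ => ⟨hW.admissible q.1, hW.admissible q.2⟩)
          rw [huniq (W i) (hi ▸ hW.admissible i) (hW.recurrence i (by omega))]
          exact hGen r ⟨hr0.le, hrz₀⟩ z ⟨hz, hzr.le.trans hrz₀⟩
        refine hstep.trans ?_
        set S : ℕ → ℝ≥0∞ := degSum deg (fun i => Gen (W i) r z) with hS
        set T : ℕ → ℝ≥0∞ :=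
          degSum deg (fun i => Gen (dx (W i)) r z + Gen (dy (W i)) r z) with hT
        have hS0 : S 0 = 0 := by
          rw [hS, ← nonpos_iff_eq_zero]
          refine (degSum_mono (G := fun _ => 0) fun i hi => ?_).trans (by simp [degSum])
          rw [hW.zero i hi, show (0 : ℝ × ℝ → ℂ) = fun _ => 0 from rfl, IsSmoothPeriodic.Gen_zero]
        have hT0 : T 0 = 0 := by
          rw [hT, ← nonpos_iff_eq_zero]
          refine (degSum_mono (G := fun _ => 0) fun i hi => ?_).trans (by simp [degSum])
          rw [hW.zero i hi, dx_zero, dy_zero, show (0 : ℝ × ℝ → ℂ) = fun _ => 0 from rfl,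
            IsSmoothPeriodic.Gen_zero, add_zero]
        have hTle : ∀ m, m ≤ n → T (m + 1) ≤
            ENNReal.ofReal ((n + 2) * (3 * (K + 2)) / (r - z) * majorant A D (r - z) m) := by
          intro m hm
          -- the derivative is estimated at a fraction of the distance to the boundary that is
          -- adapted to the degree
          set z' : ℝ := z + (r - z) / (m + 2) with hz'
          have hzz' : z < z' := by
            rw [hz']; linarith [show 0 < (r - z) / ((m : ℝ) + 2) by positivity]
          have hrz' : r - z' = (r - z) * ((m + 1) / (m + 2)) := by
            rw [hz']; field_simp; ring
          have hz'r : z' < r := by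
            rw [← sub_pos, hrz']; positivity
          refine (hW.degSum_derivatives_le hz hzz' (m + 1)).trans ?_
          refine (mul_le_mul_right (ih m (by omega) z' (hz.trans hzz'.le) hz'r) _).trans ?_
          rw [← ENNReal.ofReal_mul (by have := sub_pos.mpr hzz'; positivity)]
          apply ENNReal.ofReal_le_ofReal
          rw [hrz']
          have h1 := majorant_shrink_le hA hD0.le hrz m
          have h2 : ((m + 1 : ℕ) : ℝ) * K + 1 / (z' - z) ≤ (n + 2) * (K + 2) / (r - z) := by
            have e1 : 1 / (z' - z) = (m + 2) / (r - z) := by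
              rw [hz', add_sub_cancel_left, one_div_div]
            have hmn : (m : ℝ) ≤ n := by exact_mod_cast hm
            have hm0 : (0 : ℝ) ≤ m := Nat.cast_nonneg m
            have hK0 : (0 : ℝ) ≤ K := Nat.cast_nonneg K
            rw [e1, le_div_iff₀ hrz, add_mul, div_mul_cancel₀ _ hrz.ne']
            push_cast
            have h3 : ((m : ℝ) + 1) * K * (r - z) ≤ ((m : ℝ) + 1) * K * 1 := by
              gcongr; linarith
            nlinarith
          have h4 := majorant_nonneg hA hD0.le (hrz' ▸ (sub_pos.mpr hz'r).le) m
          calc _ ≤ (n + 2) * (K + 2) / (r - z) * (3 * majorant A D (r - z) m) := by gcongr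
            _ = _ := by ring
        have hsum : ∑ q ∈ antidiagonal (n + 2), S q.1 * T q.2 ≤
            ∑ q ∈ antidiagonal n, ENNReal.ofReal (majorant A D (r - z) q.1 *
              ((n + 2) * (3 * (K + 2)) / (r - z) * majorant A D (r - z) q.2)) := by
          rw [show n + 2 = (n + 1) + 1 from rfl, Finset.Nat.sum_antidiagonal_succ',
            Finset.Nat.sum_antidiagonal_succ]
          simp only [hS0, hT0, mul_zero, zero_mul, zero_add]
          refine Finset.sum_le_sum fun q hq => ?_
          have hq' := Finset.HasAntidiagonal.mem_antidiagonal.mp hq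
          rw [ENNReal.ofReal_mul (majorant_nonneg hA hD0.le hrz.le _)]
          exact mul_le_mul' (ih q.1 (by omega) z hz hzr) (hTle q.2 (by omega))
        refine (mul_le_mul_right (mul_le_mul_right hsum _) _).trans (le_of_eq ?_)
        rw [← ENNReal.ofReal_sum_of_nonneg (fun q _ => mul_nonneg
            (majorant_nonneg hA hD0.le hrz.le _) (mul_nonneg (by positivity)
            (majorant_nonneg hA hD0.le hrz.le _))), ← ENNReal.ofReal_mul hmb.le,
          ← ENNReal.ofReal_mul (by positivity), majorant_succ]
        congr 1
        have e2 : ∀ q : ℕ × ℕ, majorant A D (r - z) q.1 *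
            ((n + 2) * (3 * (K + 2)) / (r - z) * majorant A D (r - z) q.2) =
            (n + 2) * (3 * (K + 2)) / (r - z) *
              (majorant A D (r - z) q.1 * majorant A D (r - z) q.2) := fun q => by ring
        simp_rw [e2]
        rw [← Finset.mul_sum, hD]
        push_cast
        field_simp
  intro n
  refine (degSum_mono fun i _ => ?_).trans ((key n (r / 2) (by positivity) (by linarith)).trans
    (ENNReal.ofReal_le_ofReal ?_))
  · exact Gen_mono _ (by linarith) (by positivity) le_rfl
  · rw [show r - r / 2 = r / 2 by ring]
    exact majorant_le hA hD0.le (by positivity) n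

end Majorant

/-! ### Sums of exponential series -/

section ModeSum

/-- The sum of the series `∑ᵢ exp (lam i t) Wᵢ`. -/
def modeSum {ι : Type} (lam : ι → ℂ) (W : ι → ℝ × ℝ → ℂ) (t : ℝ) (p : ℝ × ℝ) : ℂ :=
  ∑' i, Complex.exp (lam i * t) * W i p

/-- The weight `exp (deg i * a * t)`, the size of `exp (lam i t)`. -/
def expWeight {ι : Type} (a : ℝ) (deg : ι → ℕ) (t : ℝ) (i : ι) : ℝ≥0∞ :=
  ENNReal.ofReal (Real.exp (deg i * a * t))

/-- Families of smooth functions for which the series `∑ᵢ exp (lam i t) Wᵢ` converges in an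
analytic norm for all times before `T`. -/
structure IsConvergent {ι : Type} (a : ℝ) (deg : ι → ℕ) (T : ℝ) (W : ι → ℝ × ℝ → ℂ) : Prop where
  smooth : ∀ i, IsSmoothPeriodic (W i)
  finite : ∀ t < T, ∃ ρ, 0 < ρ ∧ ∑' i, expWeight a deg t i * Gen (W i) ρ ρ ≠ ⊤

variable {ι : Type} {α : ℂ} {lam : ι → ℂ} {deg : ι → ℕ} {W : ι → ℝ × ℝ → ℂ} {T : ℝ}

theorem enorm_exp_mul (hre : ∀ i, (lam i).re = deg i * α.re) (t : ℝ) (i : ι) :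
    ‖Complex.exp (lam i * t)‖ₑ = expWeight α.re deg t i := by
  rw [← ofReal_norm, Complex.norm_exp, Complex.re_mul_ofReal, hre, expWeight]

theorem expWeight_mono {a : ℝ} (ha : 0 ≤ a) {s t : ℝ} (h : s ≤ t) (i : ι) :
    expWeight a deg s i ≤ expWeight a deg t i := by
  unfold expWeight
  gcongr

theorem norm_smulRight_le_of_norm_le_one {E : Type*} [NormedAddCommGroup E] [NormedSpace ℝ E]
    (L : E →L[ℝ] ℝ) (hL : ‖L‖ ≤ 1) (z : ℂ) : ‖L.smulRight z‖ ≤ ‖z‖ := by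
  rw [ContinuousLinearMap.norm_smulRight_apply]
  exact mul_le_of_le_one_left (norm_nonneg _) hL

namespace IsConvergent

theorem dx {a : ℝ} (hW : IsConvergent a deg T W) : IsConvergent a deg T fun i => dx (W i) where
  smooth i := (hW.smooth i).dx
  finite t ht := by
    obtain ⟨ρ, hρ, h⟩ := hW.finite t ht
    have h2 : ρ / 2 < ρ := half_lt_self hρ
    refine ⟨ρ / 2, by positivity, ne_top_of_le_ne_top
      (ENNReal.mul_ne_top (ENNReal.ofReal_ne_top (r := 1 / (ρ - ρ / 2))) h) ?_⟩
    rw [← ENNReal.tsum_mul_left]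
    refine ENNReal.tsum_le_tsum fun i => ?_
    rw [mul_left_comm]
    refine mul_le_mul_right (((hW.smooth i).Gen_dx_le h2 (by positivity)).trans ?_) _
    exact mul_le_mul_right (Gen_mono _ le_rfl (by positivity) h2.le) _

theorem dy {a : ℝ} (hW : IsConvergent a deg T W) : IsConvergent a deg T fun i => dy (W i) where
  smooth i := (hW.smooth i).dy
  finite t ht := by
    obtain ⟨ρ, hρ, h⟩ := hW.finite t ht
    have h2 : ρ / 2 < ρ := half_lt_self hρ
    refine ⟨ρ / 2, by positivity, ne_top_of_le_ne_top
      (ENNReal.mul_ne_top (ENNReal.ofReal_ne_top (r := 1 / (ρ - ρ / 2))) h) ?_⟩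
    rw [← ENNReal.tsum_mul_left]
    refine ENNReal.tsum_le_tsum fun i => ?_
    rw [mul_left_comm]
    refine mul_le_mul_right (((hW.smooth i).Gen_dy_le (by positivity) h2).trans ?_) _
    exact mul_le_mul_right (Gen_mono _ h2.le hρ.le le_rfl) _

theorem iterate_dy {a : ℝ} (hW : IsConvergent a deg T W) (l : ℕ) :
    IsConvergent a deg T fun i => ShearFlow.dy^[l] (W i) := by
  induction l with
  | zero => exact hW
  | succ l ih => simpa only [Function.iterate_succ_apply'] using ih.dy

theorem mult {a : ℝ} (hW : IsConvergent a deg T W) {m : ℤ × ℤ → ℂ} (hm : IsMultiplier m) :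
    IsConvergent a deg T fun i => mult m (W i) where
  smooth i := hm.isSmoothPeriodic (hW.smooth i)
  finite t ht := by
    obtain ⟨ρ, hρ, h⟩ := hW.finite t ht
    refine ⟨ρ, hρ, ne_top_of_le_ne_top
      (ENNReal.mul_ne_top (ENNReal.ofReal_ne_top (r := multBound)) h) ?_⟩
    rw [← ENNReal.tsum_mul_left]
    refine ENNReal.tsum_le_tsum fun i => ?_
    rw [mul_left_comm]
    exact mul_le_mul_right (hm.Gen_mult_le (hW.smooth i) _ _) _

/-- The time derivative: the factors `lam i` are absorbed by the decay in time. -/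
theorem lam_mul (hα : 0 < α.re) (hlam : ∀ i, ‖lam i‖ ≤ deg i * ‖α‖)
    (hW : IsConvergent α.re deg T W) : IsConvergent α.re deg T fun i p => lam i * W i p where
  smooth i := (hW.smooth i).const_mul _
  finite t ht := by
    obtain ⟨s, hts, hsT⟩ := exists_between ht
    obtain ⟨ρ, hρ, h⟩ := hW.finite s hsT
    have hd : 0 < s - t := sub_pos.mpr hts
    refine ⟨ρ, hρ, ne_top_of_le_ne_top (ENNReal.mul_ne_top
      (ENNReal.ofReal_ne_top (r := ‖α‖ / (α.re * (s - t)))) h) ?_⟩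
    rw [← ENNReal.tsum_mul_left]
    refine ENNReal.tsum_le_tsum fun i => ?_
    rw [(hW.smooth i).Gen_const_mul, ← mul_assoc, ← mul_assoc]
    refine mul_le_mul_left ?_ _
    rw [expWeight, expWeight, ← ofReal_norm, ← ENNReal.ofReal_mul (by positivity),
      ← ENNReal.ofReal_mul (by positivity)]
    apply ENNReal.ofReal_le_ofReal
    have h1 : (deg i : ℝ) * α.re * (s - t) ≤ Real.exp ((deg i : ℝ) * α.re * (s - t)) := by
      have := Real.add_one_le_exp ((deg i : ℝ) * α.re * (s - t)); linarith
    have h2 : Real.exp ((deg i : ℝ) * α.re * s) =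
        Real.exp ((deg i : ℝ) * α.re * t) * Real.exp ((deg i : ℝ) * α.re * (s - t)) := by
      rw [← Real.exp_add]; congr 1; ring
    rw [h2]
    calc Real.exp ((deg i : ℝ) * α.re * t) * ‖lam i‖
        ≤ Real.exp ((deg i : ℝ) * α.re * t) * (deg i * ‖α‖) := by gcongr; exact hlam i
      _ = ‖α‖ / (α.re * (s - t)) * (Real.exp ((deg i : ℝ) * α.re * t) *
            ((deg i : ℝ) * α.re * (s - t))) := by field_simp
      _ ≤ _ := by gcongr

/-- A summable majorant of the terms of the series, uniform in space and in bounded above times. -/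
theorem exists_bound (ha : 0 ≤ α.re) (hre : ∀ i, (lam i).re = deg i * α.re)
    (hW : IsConvergent α.re deg T W) {t : ℝ} (ht : t < T) :
    ∃ u : ι → ℝ, Summable u ∧ ∀ i, ∀ s ≤ t, ∀ p, ‖Complex.exp (lam i * s) * W i p‖ ≤ u i := by
  obtain ⟨ρ, hρ, h⟩ := hW.finite t ht
  refine ⟨fun i => (expWeight α.re deg t i * Gen (W i) ρ ρ).toReal, ENNReal.summable_toReal h,
    fun i s hs p => ?_⟩
  rw [← toReal_enorm]
  refine ENNReal.toReal_mono (ENNReal.ne_top_of_tsum_ne_top h i) ?_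
  rw [enorm_mul, enorm_exp_mul hre]
  exact mul_le_mul' (expWeight_mono ha hs i) ((hW.smooth i).enorm_le_Gen hρ.le p)

theorem summable_norm (ha : 0 ≤ α.re) (hre : ∀ i, (lam i).re = deg i * α.re)
    (hW : IsConvergent α.re deg T W) {t : ℝ} (ht : t < T) (p : ℝ × ℝ) :
    Summable fun i => ‖Complex.exp (lam i * t) * W i p‖ := by
  obtain ⟨u, hu, hb⟩ := hW.exists_bound ha hre ht
  exact Summable.of_nonneg_of_le (fun _ => norm_nonneg _) (fun i => hb i t le_rfl p) hu

theorem hasFDerivAt (hα : 0 < α.re) (hre : ∀ i, (lam i).re = deg i * α.re)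
    (hlam : ∀ i, ‖lam i‖ ≤ deg i * ‖α‖) (hW : IsConvergent α.re deg T W) {q : ℝ × (ℝ × ℝ)}
    (hq : q.1 < T) : HasFDerivAt (fun q : ℝ × (ℝ × ℝ) => modeSum lam W q.1 q.2)
      ((ContinuousLinearMap.fst ℝ ℝ (ℝ × ℝ)).smulRight
          (modeSum lam (fun i p => lam i * W i p) q.1 q.2) +
        ((ContinuousLinearMap.fst ℝ ℝ ℝ).comp (ContinuousLinearMap.snd ℝ ℝ (ℝ × ℝ))).smulRight
          (modeSum lam (fun i => ShearFlow.dx (W i)) q.1 q.2) +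
        ((ContinuousLinearMap.snd ℝ ℝ ℝ).comp (ContinuousLinearMap.snd ℝ ℝ (ℝ × ℝ))).smulRight
          (modeSum lam (fun i => ShearFlow.dy (W i)) q.1 q.2)) q := by
  obtain ⟨t, hqt, htT⟩ := exists_between hq
  set Lt : ℝ × (ℝ × ℝ) →L[ℝ] ℝ := ContinuousLinearMap.fst ℝ ℝ (ℝ × ℝ) with hLt
  set Lx : ℝ × (ℝ × ℝ) →L[ℝ] ℝ :=
    (ContinuousLinearMap.fst ℝ ℝ ℝ).comp (ContinuousLinearMap.snd ℝ ℝ (ℝ × ℝ)) with hLx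
  set Ly : ℝ × (ℝ × ℝ) →L[ℝ] ℝ :=
    (ContinuousLinearMap.snd ℝ ℝ ℝ).comp (ContinuousLinearMap.snd ℝ ℝ (ℝ × ℝ)) with hLy
  have nLt : ‖Lt‖ ≤ 1 := ContinuousLinearMap.norm_fst_le ℝ ℝ (ℝ × ℝ)
  have nLx : ‖Lx‖ ≤ 1 := (ContinuousLinearMap.opNorm_comp_le _ _).trans
    (mul_le_one₀ (ContinuousLinearMap.norm_fst_le ℝ ℝ ℝ) (norm_nonneg _)
      (ContinuousLinearMap.norm_snd_le ℝ ℝ (ℝ × ℝ)))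
  have nLy : ‖Ly‖ ≤ 1 := (ContinuousLinearMap.opNorm_comp_le _ _).trans
    (mul_le_one₀ (ContinuousLinearMap.norm_snd_le ℝ ℝ ℝ) (norm_nonneg _)
      (ContinuousLinearMap.norm_snd_le ℝ ℝ (ℝ × ℝ)))
  obtain ⟨ut, hut, bt⟩ := (hW.lam_mul hα hlam).exists_bound hα.le hre htT
  obtain ⟨ux, hux, bx⟩ := hW.dx.exists_bound hα.le hre htT
  obtain ⟨uy, huy, bty⟩ := hW.dy.exists_bound hα.le hre htT
  have hopen : IsOpen {q : ℝ × (ℝ × ℝ) | q.1 < t} := isOpen_lt continuous_fst continuous_const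
  have hconv : Convex ℝ {q : ℝ × (ℝ × ℝ) | q.1 < t} :=
    convex_halfSpace_lt (f := fun q : ℝ × (ℝ × ℝ) => q.1) (IsLinearMap.mk (by simp) (by simp)) t
  have hterm : ∀ (i : ι) (q : ℝ × (ℝ × ℝ)), HasFDerivAt
      (fun q : ℝ × (ℝ × ℝ) => Complex.exp (lam i * q.1) * W i q.2)
      (Lt.smulRight (Complex.exp (lam i * q.1) * (lam i * W i q.2)) +
        Lx.smulRight (Complex.exp (lam i * q.1) * ShearFlow.dx (W i) q.2) +
        Ly.smulRight (Complex.exp (lam i * q.1) * ShearFlow.dy (W i) q.2)) q := by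
    intro i q
    have h1 : HasFDerivAt (fun q : ℝ × (ℝ × ℝ) => (q.1 : ℂ)) (Complex.ofRealCLM.comp Lt) q :=
      (Complex.ofRealCLM.comp Lt).hasFDerivAt
    have h2 := (h1.const_mul (lam i)).cexp
    have h3 := ((hW.smooth i).hasFDerivAt q.2).comp q
      (ContinuousLinearMap.snd ℝ ℝ (ℝ × ℝ)).hasFDerivAt
    refine (h2.mul h3).congr_fderiv ?_
    (ext <;> simp [hLt, hLx, hLy]); ring
  have h := hasFDerivAt_tsum_of_isPreconnected (𝕜 := ℝ) ((hut.add hux).add huy) hopen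
    hconv.isPreconnected (fun i q _ => hterm i q) (fun i q hq => ?_) (x₀ := q) hqt
    (hW.summable_norm hα.le hre hq q.2).of_norm hqt
  · refine h.congr_fderiv ?_
    have s1 := ((hW.lam_mul hα hlam).summable_norm hα.le hre hq q.2).of_norm.hasSum
    have s2 := (hW.dx.summable_norm hα.le hre hq q.2).of_norm.hasSum
    have s3 := (hW.dy.summable_norm hα.le hre hq q.2).of_norm.hasSum
    have e1 := (ContinuousLinearMap.smulRightL ℝ (ℝ × (ℝ × ℝ)) ℂ Lt).hasSum s1
    have e2 := (ContinuousLinearMap.smulRightL ℝ (ℝ × (ℝ × ℝ)) ℂ Lx).hasSum s2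
    have e3 := (ContinuousLinearMap.smulRightL ℝ (ℝ × (ℝ × ℝ)) ℂ Ly).hasSum s3
    exact ((e1.add e2).add e3).tsum_eq
  · refine (norm_add_le _ _).trans (add_le_add ((norm_add_le _ _).trans (add_le_add ?_ ?_)) ?_)
    · exact (norm_smulRight_le_of_norm_le_one _ nLt _).trans (bt i q.1 (le_of_lt hq) q.2)
    · exact (norm_smulRight_le_of_norm_le_one _ nLx _).trans (bx i q.1 (le_of_lt hq) q.2)
    · exact (norm_smulRight_le_of_norm_le_one _ nLy _).trans (bty i q.1 (le_of_lt hq) q.2)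

/-- The derivatives in time and space of a convergent series are convergent series again. -/
theorem contDiffOn (hα : 0 < α.re) (hre : ∀ i, (lam i).re = deg i * α.re)
    (hlam : ∀ i, ‖lam i‖ ≤ deg i * ‖α‖) (hW : IsConvergent α.re deg T W) :
    ContDiffOn ℝ ∞ (fun q : ℝ × (ℝ × ℝ) => modeSum lam W q.1 q.2) {q | q.1 < T} := by
  refine contDiffOn_of_class (isOpen_lt continuous_fst continuous_const)
    {F | ∃ W, IsConvergent α.re deg T W ∧ F = fun q => modeSum lam W q.1 q.2} ?_ _ ⟨W, hW, rfl⟩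
  rintro F ⟨W, hW, rfl⟩
  refine ⟨3, ![fun q => modeSum lam (fun i p => lam i * W i p) q.1 q.2,
    fun q => modeSum lam (fun i => ShearFlow.dx (W i)) q.1 q.2,
    fun q => modeSum lam (fun i => ShearFlow.dy (W i)) q.1 q.2],
    ![ContinuousLinearMap.fst ℝ ℝ (ℝ × ℝ),
      (ContinuousLinearMap.fst ℝ ℝ ℝ).comp (ContinuousLinearMap.snd ℝ ℝ (ℝ × ℝ)),
      (ContinuousLinearMap.snd ℝ ℝ ℝ).comp (ContinuousLinearMap.snd ℝ ℝ (ℝ × ℝ))], ?_, ?_⟩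
  · intro j
    fin_cases j
    · exact ⟨_, hW.lam_mul hα hlam, rfl⟩
    · exact ⟨_, hW.dx, rfl⟩
    · exact ⟨_, hW.dy, rfl⟩
  · intro q hq
    simpa [Fin.sum_univ_three] using hW.hasFDerivAt hα hre hlam hq

theorem hasFDerivAt_space (hα : 0 < α.re) (hre : ∀ i, (lam i).re = deg i * α.re)
    (hlam : ∀ i, ‖lam i‖ ≤ deg i * ‖α‖) (hW : IsConvergent α.re deg T W) {t : ℝ} (ht : t < T)
    (p : ℝ × ℝ) : HasFDerivAt (modeSum lam W t)
      ((ContinuousLinearMap.fst ℝ ℝ ℝ).smulRight (modeSum lam (fun i => ShearFlow.dx (W i)) t p) +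
        (ContinuousLinearMap.snd ℝ ℝ ℝ).smulRight
          (modeSum lam (fun i => ShearFlow.dy (W i)) t p)) p := by
  have h := hW.hasFDerivAt hα hre hlam (q := (t, p)) ht
  have h2 : HasFDerivAt (fun p : ℝ × ℝ => (t, p)) (ContinuousLinearMap.inr ℝ ℝ (ℝ × ℝ)) p :=
    hasFDerivAt_prodMk_right t p
  refine (h.comp p h2).congr_fderiv ?_
  ext <;> simp

theorem dx_modeSum (hα : 0 < α.re) (hre : ∀ i, (lam i).re = deg i * α.re)
    (hlam : ∀ i, ‖lam i‖ ≤ deg i * ‖α‖) (hW : IsConvergent α.re deg T W) {t : ℝ} (ht : t < T) :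
    ShearFlow.dx (modeSum lam W t) = modeSum lam (fun i => ShearFlow.dx (W i)) t := by
  ext p; rw [dx_eq_of_hasFDerivAt (hW.hasFDerivAt_space hα hre hlam ht p)]; simp

theorem dy_modeSum (hα : 0 < α.re) (hre : ∀ i, (lam i).re = deg i * α.re)
    (hlam : ∀ i, ‖lam i‖ ≤ deg i * ‖α‖) (hW : IsConvergent α.re deg T W) {t : ℝ} (ht : t < T) :
    ShearFlow.dy (modeSum lam W t) = modeSum lam (fun i => ShearFlow.dy (W i)) t := by
  ext p; rw [dy_eq_of_hasFDerivAt (hW.hasFDerivAt_space hα hre hlam ht p)]; simp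

theorem iterate_dy_modeSum (hα : 0 < α.re) (hre : ∀ i, (lam i).re = deg i * α.re)
    (hlam : ∀ i, ‖lam i‖ ≤ deg i * ‖α‖) (hW : IsConvergent α.re deg T W) {t : ℝ} (ht : t < T)
    (l : ℕ) : ShearFlow.dy^[l] (modeSum lam W t) =
      modeSum lam (fun i => ShearFlow.dy^[l] (W i)) t := by
  induction l with
  | zero => rfl
  | succ l ih =>
    simp only [Function.iterate_succ_apply', ih]
    exact (hW.iterate_dy l).dy_modeSum hα hre hlam ht

theorem isSmoothPeriodic (hα : 0 < α.re) (hre : ∀ i, (lam i).re = deg i * α.re)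
    (hlam : ∀ i, ‖lam i‖ ≤ deg i * ‖α‖) (hW : IsConvergent α.re deg T W) {t : ℝ} (ht : t < T) :
    IsSmoothPeriodic (modeSum lam W t) where
  smooth := by
    rw [← contDiffOn_univ]
    exact (hW.contDiffOn hα hre hlam).comp (contDiff_prodMk_right t).contDiffOn fun _ _ => ht
  periodic_x x y := by simp only [modeSum, (hW.smooth _).periodic_x]
  periodic_y x y := by simp only [modeSum, (hW.smooth _).periodic_y]

theorem hasSum_fourierX [Countable ι] (ha : 0 ≤ α.re) (hre : ∀ i, (lam i).re = deg i * α.re)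
    (hW : IsConvergent α.re deg T W) {t : ℝ} (ht : t < T) (k : ℤ) (y : ℝ) :
    HasSum (fun i => Complex.exp (lam i * t) * fourierX (W i) k y)
      (fourierX (modeSum lam W t) k y) := by
  obtain ⟨u, hu, hb⟩ := hW.exists_bound ha hre ht
  have h := hasSum_coef_tsum (g := fun i x => Complex.exp (lam i * t) * W i (x, y))
    (fun i => by have := (hW.smooth i).continuous; fun_prop) hu
    (fun i x => hb i t le_rfl (x, y)) k
  simp only [coef_const_mul] at h
  exact h

theorem hasSum_fourierXY [Countable ι] (ha : 0 ≤ α.re) (hre : ∀ i, (lam i).re = deg i * α.re)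
    (hW : IsConvergent α.re deg T W) {t : ℝ} (ht : t < T) (k l : ℤ) :
    HasSum (fun i => Complex.exp (lam i * t) * fourierXY (W i) k l)
      (fourierXY (modeSum lam W t) k l) := by
  obtain ⟨u, hu, hb⟩ := hW.exists_bound ha hre ht
  have h := hasSum_coef_tsum (g := fun i y => Complex.exp (lam i * t) * fourierX (W i) k y)
    (fun i => continuous_const.mul ((hW.smooth i).continuous_fourierX k)) hu
    (fun i y => by
      rw [← IsSmoothPeriodic.fourierX_const_mul]
      exact IsSmoothPeriodic.norm_fourierX_le (hb i t le_rfl) k y) l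
  simp only [coef_const_mul] at h
  have e : fourierX (modeSum lam W t) k =
      fun y => ∑' i, Complex.exp (lam i * t) * fourierX (W i) k y := by
    ext y; exact (hW.hasSum_fourierX ha hre ht k y).tsum_eq.symm
  rw [IsSmoothPeriodic.fourierXY_eq, e]
  exact h

theorem supX_modeSum_le [Countable ι] (ha : 0 ≤ α.re) (hre : ∀ i, (lam i).re = deg i * α.re)
    (hW : IsConvergent α.re deg T W) {t : ℝ} (ht : t < T) (k : ℤ) :
    supX (modeSum lam W t) k ≤ ∑' i, expWeight α.re deg t i * supX (W i) k := by
  refine iSup_le fun y => ?_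
  rw [← (hW.hasSum_fourierX ha hre ht k y).tsum_eq]
  refine enorm_tsum_le_tsum_enorm.trans (ENNReal.tsum_le_tsum fun i => ?_)
  rw [enorm_mul, enorm_exp_mul hre]
  exact mul_le_mul_right (enorm_fourierX_le_supX _ _ _) _

theorem Gen_modeSum_le [Countable ι] (hα : 0 < α.re) (hre : ∀ i, (lam i).re = deg i * α.re)
    (hlam : ∀ i, ‖lam i‖ ≤ deg i * ‖α‖) (hW : IsConvergent α.re deg T W) {t : ℝ} (ht : t < T)
    (z₁ z₂ : ℝ) : Gen (modeSum lam W t) z₁ z₂ ≤ ∑' i, expWeight α.re deg t i * Gen (W i) z₁ z₂ := by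
  rw [(hW.isSmoothPeriodic hα hre hlam ht).Gen_eq]
  simp_rw [(hW.smooth _).Gen_eq, ← ENNReal.tsum_mul_left]
  refine le_trans (ENNReal.tsum_le_tsum fun k => ?_) (le_of_eq ENNReal.tsum_comm)
  refine le_trans (ENNReal.tsum_le_tsum fun l => ?_) (le_of_eq ENNReal.tsum_comm)
  rw [hW.iterate_dy_modeSum hα hre hlam ht]
  refine (mul_le_mul_right ((hW.iterate_dy l).supX_modeSum_le hα.le hre ht k) _).trans
    (le_of_eq ?_)
  rw [← ENNReal.tsum_mul_left]
  congr 1; ext i; exact mul_left_comm _ _ _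

/-- Multiplier operators may be applied termwise: the double series over the indices and the
frequencies converges absolutely. -/
theorem mult_modeSum [Countable ι] (hα : 0 < α.re) (hre : ∀ i, (lam i).re = deg i * α.re)
    (hW : IsConvergent α.re deg T W) {t : ℝ} (ht : t < T) {m : ℤ × ℤ → ℂ} (hm : IsMultiplier m)
    (p : ℝ × ℝ) :
    ShearFlow.mult m (modeSum lam W t) p = modeSum lam (fun i => ShearFlow.mult m (W i)) t p := by
  obtain ⟨ρ, hρ, hfin⟩ := hW.finite t ht
  set F : ι → ℤ × ℤ → ℂ := fun i n => Complex.exp (lam i * t) * (m n * fourierPair (W i) n *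
    Complex.exp (Complex.I * (n.1 * p.1 + n.2 * p.2))) with hF
  have hs : Summable (Function.uncurry F) := by
    apply Summable.of_enorm
    rw [ENNReal.tsum_prod']
    refine ne_top_of_le_ne_top (ENNReal.mul_ne_top
      (ENNReal.ofReal_ne_top (r := multBound)) hfin) ?_
    rw [← ENNReal.tsum_mul_left]
    refine ENNReal.tsum_le_tsum fun i => ?_
    rw [mul_left_comm]
    refine le_trans (le_of_eq ?_)
      (mul_le_mul_right (hm.tsum_enorm_le_Gen (hW.smooth i) (z₂ := ρ) hρ.le) _)
    rw [← ENNReal.tsum_mul_left]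
    congr 1; ext n
    simp only [Function.uncurry, hF]
    rw [enorm_mul, enorm_exp_mul hre, enorm_mul _ (Complex.exp _), ← ofReal_norm (Complex.exp _),
      norm_trig, ENNReal.ofReal_one, mul_one]
  have h := hs.tsum_comm
  unfold modeSum ShearFlow.mult trigSeries
  simp only [hF] at h
  simp_rw [tsum_mul_left] at h
  rw [← h]
  congr 1; ext n
  have e := (hW.hasSum_fourierXY hα.le hre ht n.1 n.2).tsum_eq
  change m n * fourierXY (modeSum lam W t) n.1 n.2 * _ = _
  rw [← e, ← tsum_mul_left, ← tsum_mul_right]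
  congr 1; ext i; unfold fourierPair; ring

end IsConvergent

end ModeSum

/-! ### The sum of the expansion solves the vorticity equation -/

section Solution

variable {ι : Type} [AddCommMonoid ι] [Finset.HasAntidiagonal ι] {U : ℝ → ℝ} {α : ℂ} {K : ℕ}
  {lam : ι → ℂ} {deg : ι → ℕ} {seed W : ι → ℝ × ℝ → ℂ} {T : ℝ}

/-- If the coefficients of degree one are eigenmodes, the recurrence holds in all degrees, since
the nonlinear term vanishes in degrees zero and one. -/
theorem IsExpansion.recurrence_of_modes (hs : IsExponentSystem α lam deg)
    (hW : IsExpansion U lam deg K seed W)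
    (hseed : ∀ i, deg i = 1 → ∀ p, lam i * seed i p + linearized U (seed i) p = 0)
    (i : ι) (p : ℝ × ℝ) : lam i * W i p + linearized U (W i) p =
      ∑ q ∈ antidiagonal i, Q (velocity (W q.1)) (W q.2) p := by
  rcases Nat.lt_or_ge (deg i) 2 with hi | hi
  · have h0 := hs.sum_Q_congr (W := W) (W' := 0) (i := i) hW.zero (fun _ _ => rfl)
      (fun j hj => hW.zero j (by omega)) p
    rw [h0]
    have h1 : ∑ q ∈ antidiagonal i, Q (velocity ((0 : ι → ℝ × ℝ → ℂ) q.1))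
        ((0 : ι → ℝ × ℝ → ℂ) q.2) p = 0 :=
      Finset.sum_eq_zero fun q _ => Q_zero_right _ p
    rw [h1]
    by_cases h : deg i = 1
    · rw [hW.one i h]; exact hseed i h p
    · rw [hW.zero i (by omega), linearized_zero]; simp
  · exact hW.recurrence i hi p

/-- The Cauchy product of two of the series. -/
theorem hasSum_cauchy_product [Countable ι] {f g : ι → ℂ} (hf : Summable fun i => ‖f i‖)
    (hg : Summable fun i => ‖g i‖) :
    HasSum (fun i => ∑ q ∈ antidiagonal i, f q.1 * g q.2) ((∑' i, f i) * ∑' i, g i) := by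
  have hfg := summable_mul_of_summable_norm hf hg
  rw [hf.of_norm.tsum_mul_tsum_eq_tsum_sum_antidiagonal hg.of_norm hfg]
  exact (summable_sum_mul_antidiagonal_of_summable_mul hfg).hasSum

theorem IsConvergent.hasDerivAt {ι : Type} {lam : ι → ℂ} {deg : ι → ℕ} {W : ι → ℝ × ℝ → ℂ}
    (hα : 0 < α.re) (hre : ∀ i, (lam i).re = deg i * α.re)
    (hlam : ∀ i, ‖lam i‖ ≤ deg i * ‖α‖) (hW : IsConvergent α.re deg T W) {t : ℝ} (ht : t < T)
    (p : ℝ × ℝ) : HasDerivAt (fun s => modeSum lam W s p)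
      (modeSum lam (fun i p => lam i * W i p) t p) t := by
  have h := hW.hasFDerivAt hα hre hlam (q := (t, p)) ht
  have h2 : HasDerivAt (fun s : ℝ => (s, p)) ((1 : ℝ), (0 : ℝ × ℝ)) t :=
    (hasDerivAt_id t).prodMk (hasDerivAt_const t p)
  have h3 := HasFDerivAt.comp_hasDerivAt (f := fun s : ℝ => (s, p))
    (l := fun q : ℝ × (ℝ × ℝ) => modeSum lam W q.1 q.2) t h h2
  simpa [Function.comp_def] using h3

/-- Summing the recurrence shows that the series solves the vorticity equation. -/
theorem IsExpansion.modeSum_equation [Countable ι] (hα : 0 < α.re)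
    (hs : IsExponentSystem α lam deg) (hW : IsExpansion U lam deg K seed W)
    (hseed : ∀ i, deg i = 1 → ∀ p, lam i * seed i p + linearized U (seed i) p = 0)
    (hc : IsConvergent α.re deg T W) {t : ℝ} (ht : t < T) (p : ℝ × ℝ) :
    modeSum lam (fun i p => lam i * W i p) t p =
      -linearized U (modeSum lam W t) p + Q (velocity (modeSum lam W t)) (modeSum lam W t) p := by
  have hre := hs.re_lam
  have hlam := hs.norm_lam_le
  have hsm := hc.isSmoothPeriodic hα hre hlam ht
  have hcX := hc.mult isMultiplier_velMult₁
  have hcY := hc.mult isMultiplier_velMult₂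
  have nA := hcX.summable_norm hα.le hre ht p
  have nB := hcY.summable_norm hα.le hre ht p
  have nX := hc.dx.summable_norm hα.le hre ht p
  have nY := hc.dy.summable_norm hα.le hre ht p
  rw [hsm.linearized_eq, hsm.Q_eq]
  simp only
  have eA : velX (modeSum lam W t) p = modeSum lam (fun i => velX (W i)) t p :=
    hc.mult_modeSum hα hre ht isMultiplier_velMult₁ p
  have eB : velY (modeSum lam W t) p = modeSum lam (fun i => velY (W i)) t p :=
    hc.mult_modeSum hα hre ht isMultiplier_velMult₂ p
  rw [hc.dx_modeSum hα hre hlam ht, hc.dy_modeSum hα hre hlam ht, eA, eB]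
  have hAX := hasSum_cauchy_product nA nX
  have hBY := hasSum_cauchy_product nB nY
  have hL := ((nX.of_norm.hasSum.mul_left (U p.2 : ℂ)).add
    ((nA.of_norm.hasSum.mul_right (dx (shearVorticity U) p)).add
      (nB.of_norm.hasSum.mul_right (dy (shearVorticity U) p)))).neg
  have htot := hL.add (hAX.add hBY).neg
  refine Eq.trans ?_ htot.tsum_eq
  unfold modeSum
  refine tsum_congr fun i => ?_
  have hr := hW.recurrence_of_modes hs hseed i p
  rw [(hW.isSmoothPeriodic i).linearized_eq] at hr
  have hq : Complex.exp (lam i * t) * ∑ q ∈ antidiagonal i, Q (velocity (W q.1)) (W q.2) p =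
      -(∑ q ∈ antidiagonal i, Complex.exp (lam q.1 * t) * velX (W q.1) p *
          (Complex.exp (lam q.2 * t) * dx (W q.2) p) +
        ∑ q ∈ antidiagonal i, Complex.exp (lam q.1 * t) * velY (W q.1) p *
          (Complex.exp (lam q.2 * t) * dy (W q.2) p)) := by
    rw [← Finset.sum_add_distrib, ← Finset.sum_neg_distrib, Finset.mul_sum]
    refine Finset.sum_congr rfl fun q hq => ?_
    rw [(hW.isSmoothPeriodic q.1).Q_eq, ← Finset.HasAntidiagonal.mem_antidiagonal.mp hq,
      hs.lam_add, add_mul, Complex.exp_add]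
    ring
  rw [← hq, ← hr]
  ring

theorem IsExpansion.isEulerPerturbation [Countable ι] (hα : 0 < α.re)
    (hs : IsExponentSystem α lam deg) (hW : IsExpansion U lam deg K seed W)
    (hseed : ∀ i, deg i = 1 → ∀ p, lam i * seed i p + linearized U (seed i) p = 0)
    (hc : IsConvergent α.re deg T W) {I : Set ℝ} (hI : ∀ t ∈ I, t < T) :
    IsEulerPerturbation U I (modeSum lam W) where
  smooth := (hc.contDiffOn hα hs.re_lam hs.norm_lam_le).mono fun q hq => hI q.1 hq.1
  torusField t ht := by
    rw [(hc.isSmoothPeriodic hα hs.re_lam hs.norm_lam_le (hI t ht)).isTorusField_iff,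
      ← (hc.hasSum_fourierXY hα.le hs.re_lam (hI t ht) 0 0).tsum_eq]
    refine (tsum_congr fun i => ?_).trans tsum_zero
    rw [(hW.isSmoothPeriodic i).isTorusField_iff.mp (hW.admissible i).torusField, mul_zero]
  equation t ht p := by
    rw [← hW.modeSum_equation hα hs hseed hc (hI t ht) p]
    exact (hc.hasDerivAt hα hs.re_lam hs.norm_lam_le (hI t ht) p).hasDerivWithinAt

/-- The part of the series of degree larger than `m`, in an analytic norm. -/
theorem tsum_expWeight_le_of_degSum_le {ι : Type} {deg : ι → ℕ} {W : ι → ℝ × ℝ → ℂ}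
    {a ρ A B t : ℝ} (hA : 0 ≤ A) (hB : 0 ≤ B)
    (hbound : ∀ n, degSum deg (fun i => Gen (W i) ρ ρ) (n + 1) ≤ ENNReal.ofReal (A * (B * A) ^ n))
    (ht : Real.exp (a * t) * (B * A) < 1) (m : ℕ) :
    (∑' i, if m < deg i then expWeight a deg t i * Gen (W i) ρ ρ else 0) ≤
      ENNReal.ofReal (Real.exp (a * t) * A * (Real.exp (a * t) * (B * A)) ^ m /
        (1 - Real.exp (a * t) * (B * A))) := by
  set θ := Real.exp (a * t) * (B * A) with hθ
  have hθ0 : 0 ≤ θ := by positivity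
  rw [← tsum_degSum (deg := deg), ← Summable.sum_add_tsum_nat_add' (k := m + 1) ENNReal.summable]
  have hz : ∑ n ∈ Finset.range (m + 1), degSum deg
      (fun i => if m < deg i then expWeight a deg t i * Gen (W i) ρ ρ else 0) n = 0 := by
    refine Finset.sum_eq_zero fun n hn => ?_
    rw [← nonpos_iff_eq_zero]
    refine (degSum_mono (G := fun _ => 0) fun i hi => ?_).trans (by simp [degSum])
    rw [if_neg]
    have := Finset.mem_range.mp hn
    omega
  rw [hz, zero_add]
  have hg := (hasSum_geometric_of_lt_one hθ0 ht).mul_left (Real.exp (a * t) * A * θ ^ m)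
  rw [div_eq_mul_inv, ← hg.tsum_eq, ENNReal.ofReal_tsum_of_nonneg (fun n => by positivity)
    hg.summable]
  refine ENNReal.tsum_le_tsum fun n => ?_
  have h1 : degSum deg
      (fun i => if m < deg i then expWeight a deg t i * Gen (W i) ρ ρ else 0) (n + (m + 1)) ≤
      ENNReal.ofReal (Real.exp (((n + m + 1 : ℕ) : ℝ) * a * t)) *
        degSum deg (fun i => Gen (W i) ρ ρ) (n + m + 1) := by
    rw [← degSum_const_mul]
    refine degSum_mono fun i hi => ?_
    split_ifs
    · rw [expWeight, hi, add_assoc]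
    · exact zero_le
  refine (h1.trans (mul_le_mul_right (hbound (n + m)) _)).trans (le_of_eq ?_)
  rw [← ENNReal.ofReal_mul (by positivity)]
  congr 1
  have e : Real.exp (((n + m + 1 : ℕ) : ℝ) * a * t) = Real.exp (a * t) ^ (n + m + 1) := by
    rw [← Real.exp_nat_mul]; congr 1; ring
  rw [e, hθ]
  ring

theorem IsExpansion.tsum_expWeight_le {ρ A B t : ℝ} (hW : IsExpansion U lam deg K seed W)
    (hA : 0 ≤ A) (hB : 0 ≤ B)
    (hbound : ∀ n, degSum deg (fun i => Gen (W i) ρ ρ) (n + 1) ≤ ENNReal.ofReal (A * (B * A) ^ n))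
    (ht : Real.exp (α.re * t) * (B * A) < 1) :
    ∑' i, expWeight α.re deg t i * Gen (W i) ρ ρ ≤
      ENNReal.ofReal (Real.exp (α.re * t) * A / (1 - Real.exp (α.re * t) * (B * A))) := by
  have h := tsum_expWeight_le_of_degSum_le (W := W) hA hB hbound ht 0
  rw [pow_zero, mul_one] at h
  refine le_trans (ENNReal.tsum_le_tsum fun i => ?_) h
  split_ifs with hi
  · exact le_rfl
  · rw [hW.zero i (by omega), show (0 : ℝ × ℝ → ℂ) = fun _ => 0 from rfl,
      IsSmoothPeriodic.Gen_zero, mul_zero]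

theorem IsExpansion.isConvergent {ρ A B : ℝ} (hα : 0 < α.re)
    (hW : IsExpansion U lam deg K seed W) (hρ : 0 < ρ) (hA : 0 ≤ A) (hB : 0 ≤ B)
    (hbound : ∀ n, degSum deg (fun i => Gen (W i) ρ ρ) (n + 1) ≤ ENNReal.ofReal (A * (B * A) ^ n))
    (hT : Real.exp (α.re * T) * (B * A) < 1) : IsConvergent α.re deg T W where
  smooth := hW.isSmoothPeriodic
  finite t ht := by
    refine ⟨ρ, hρ, ne_top_of_le_ne_top ENNReal.ofReal_ne_top
      (hW.tsum_expWeight_le hA hB hbound ?_)⟩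
    refine lt_of_le_of_lt ?_ hT
    gcongr

theorem exists_gt_exp_mul_lt {a x T₀ : ℝ} (h : Real.exp (a * T₀) * x < 1) :
    ∃ T, T₀ < T ∧ Real.exp (a * T) * x < 1 := by
  have hc : ContinuousAt (fun T => Real.exp (a * T) * x) T₀ := by fun_prop
  have h1 : ∀ᶠ T in nhdsWithin T₀ (Set.Ioi T₀), Real.exp (a * T) * x < 1 :=
    (hc.eventually_lt continuousAt_const h).filter_mono nhdsWithin_le_nhds
  obtain ⟨T, h2, h3⟩ := (h1.and self_mem_nhdsWithin).exists
  exact ⟨T, h3, h2⟩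

/-- Complex conjugation, combined with a symmetry `σ` of the indices that conjugates the
exponents, maps expansions to expansions. -/
theorem IsExpansion.conj (hW : IsExpansion U lam deg K seed W) (σ : ι ≃+ ι)
    (hdeg : ∀ i, deg (σ i) = deg i) (hlam : ∀ i, lam (σ i) = (starRingEnd ℂ) (lam i))
    (hseed : ∀ i, deg i = 1 → (fun p => (starRingEnd ℂ) (seed (σ i) p)) = seed i) :
    IsExpansion U lam deg K seed fun i p => (starRingEnd ℂ) (W (σ i) p) where
  zero i hi := by
    rw [hW.zero (σ i) (by rw [hdeg, hi])]; ext p; simp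
  one i hi := by
    rw [hW.one (σ i) (by rw [hdeg, hi])]; exact hseed i hi
  admissible i := by
    have := (hW.admissible (σ i)).conj
    rwa [hdeg] at this
  recurrence i hi p := by
    have h := hW.recurrence (σ i) (by rwa [hdeg]) p
    rw [(hW.isSmoothPeriodic (σ i)).linearized_conj]
    have h2 := congrArg (starRingEnd ℂ) h
    rw [map_add, map_mul, hlam, Complex.conj_conj, map_sum] at h2
    rw [h2]
    refine Finset.sum_equiv (Equiv.prodCongr σ.symm.toEquiv σ.symm.toEquiv) ?_ ?_
    · intro q
      simp only [Finset.HasAntidiagonal.mem_antidiagonal, Equiv.prodCongr_apply, Prod.map_fst,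
        Prod.map_snd]
      change q.1 + q.2 = σ i ↔ σ.symm q.1 + σ.symm q.2 = i
      rw [← map_add, AddEquiv.symm_apply_eq]
    · intro q _
      have e1 : σ (Equiv.prodCongr σ.symm.toEquiv σ.symm.toEquiv q).1 = q.1 :=
        σ.apply_symm_apply q.1
      have e2 : σ (Equiv.prodCongr σ.symm.toEquiv σ.symm.toEquiv q).2 = q.2 :=
        σ.apply_symm_apply q.2
      rw [e1, e2, (hW.isSmoothPeriodic q.1).Q_conj (hW.isSmoothPeriodic q.2)]

end Solution

/-! ### One mode, and a mode with its complex conjugate -/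

section Modes

variable {U : ℝ → ℝ} {α : ℂ} {K : ℕ} {v : ℝ × ℝ → ℂ}

theorem isExponentSystem_nat (α : ℂ) :
    IsExponentSystem α (fun n : ℕ => (n : ℂ) * α) (fun n : ℕ => n) where
  lam_add i j := by push_cast; ring
  deg_add _ _ := rfl
  re_lam i := by simp
  norm_lam_le i := by simp

/-- The iteration for one mode is the expansion indexed by `ℕ`; the sum over the antidiagonal has
two more terms, in which a factor of degree zero vanishes. -/
theorem isModeExpansion_iff {W : ℕ → ℝ × ℝ → ℂ} : IsModeExpansion U α K v W ↔
    IsExpansion U (fun n : ℕ => (n : ℂ) * α) (fun n : ℕ => n) K (fun _ => v) W := by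
  have key : W 0 = 0 → ∀ n : ℕ, ∀ p, ∑ q ∈ antidiagonal n, Q (velocity (W q.1)) (W q.2) p =
      ∑ j ∈ Finset.Icc 1 (n - 1), Q (velocity (W j)) (W (n - j)) p := by
    intro h0 n p
    rw [Finset.Nat.sum_antidiagonal_eq_sum_range_succ
      (fun a b => Q (velocity (W a)) (W b) p) n]
    symm
    refine Finset.sum_subset (fun j hj => ?_) fun j hj hj' => ?_
    · rw [Finset.mem_Icc] at hj
      rw [Finset.mem_range]; omega
    · rw [Finset.mem_range] at hj
      rw [Finset.mem_Icc] at hj'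
      rcases Nat.eq_zero_or_pos j with rfl | hpos
      · rw [h0, Q_zero_left]
      · rw [show n - j = 0 by omega, h0, Q_zero_right]
  constructor
  · intro h
    refine ⟨fun i hi => ?_, fun i hi => ?_, h.admissible, fun i hi p => ?_⟩
    · change i = 0 at hi; rw [hi, h.zero]
    · change i = 1 at hi; rw [hi, h.one]
    · rw [key h.zero]; exact h.recurrence i hi p
  · intro h
    have h0 : W 0 = 0 := h.zero 0 rfl
    refine ⟨h0, h.one 1 rfl, h.admissible, fun n hn p => ?_⟩
    rw [← key h0]; exact h.recurrence n hn p

/-- The series solution generated by a multiple `c • v` of an eigenmode: the time of existence is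
limited only by the smallness of `exp (Re α T₀) |c|`. -/
theorem exists_seriesSolves (hα : 0 < α.re) (hv : IsAdmissible K v)
    (hmode : ∀ p, α * v p + linearized U v p = 0) (H1 : ResolventBound U α K) :
    ∃ B : ℝ, 0 ≤ B ∧ ∀ (c : ℂ) (T₀ : ℝ), Real.exp (α.re * T₀) * (B * ‖c‖) < 1 →
      SeriesSolves U α K (c • v) T₀ := by
  obtain ⟨r, hr, hfin⟩ := hv.analytic
  obtain ⟨ρ, hρ, B, hB, hbd⟩ := H1.exists_degSum_le hα hr
  set A := (Gen v r r).toReal with hA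
  have hA0 : 0 ≤ A := ENNReal.toReal_nonneg
  refine ⟨B * A, by positivity, fun c T₀ hT₀ => ?_⟩
  have hvs := hv.isSmoothPeriodic
  have hcv : IsAdmissible K (c • v) := hv.const_mul c
  have hs := isExponentSystem_nat α
  obtain ⟨W, hW⟩ := hs.exists_expansion (U := U) (seed := fun _ => c • v) hα H1 (fun _ _ => hcv)
  have hbound := hbd hs hW (‖c‖ * A) (by positivity) (by
    rw [degSum, tsum_eq_single 1 (fun n hn => if_neg hn), if_pos rfl]
    refine le_of_eq ((hvs.Gen_const_mul c r r).trans ?_)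
    rw [ENNReal.ofReal_mul (norm_nonneg _), ofReal_norm, hA, ENNReal.ofReal_toReal hfin])
  have hT₀' : Real.exp (α.re * T₀) * (B * (‖c‖ * A)) < 1 := by
    calc _ = Real.exp (α.re * T₀) * (B * A * ‖c‖) := by ring
      _ < 1 := hT₀
  obtain ⟨T, hT₀T, hT⟩ := exists_gt_exp_mul_lt hT₀'
  have hconv := hW.isConvergent hα hρ (by positivity) hB.le hbound hT
  have hseed : ∀ i : ℕ, i = 1 → ∀ p,
      (i : ℂ) * α * (c • v) p + linearized U (c • v) p = 0 := by
    rintro i rfl p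
    have h1 := hvs.linearized_const_mul U c p
    have h2 := hmode p
    change _ * (c * v p) + linearized U (fun p => c * v p) p = 0
    rw [h1]
    push_cast
    linear_combination c * h2
  refine ⟨W, isModeExpansion_iff.mpr hW, fun W' hW' =>
    hW.unique hs hα H1 (isModeExpansion_iff.mp hW'), ⟨ρ, hρ, fun t ht => ?_⟩, fun t ht p => ?_, ?_⟩
  · refine ne_top_of_le_ne_top ENNReal.ofReal_ne_top
      (hW.tsum_expWeight_le (by positivity) hB.le hbound (lt_of_le_of_lt ?_ hT₀'))
    gcongr
  · exact (hconv.summable_norm hα.le hs.re_lam (ht.trans_lt hT₀T) p).of_norm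
  · exact hW.isEulerPerturbation hα hs hseed hconv fun t ht => lt_of_le_of_lt ht hT₀T

theorem IsModeExpansion.im_eq_zero {W : ℕ → ℝ × ℝ → ℂ} (hα : 0 < α.re)
    (H1 : ResolventBound U α K) (hα' : α.im = 0) (hv : ∀ p, (v p).im = 0)
    (hW : IsModeExpansion U α K v W) (n : ℕ) (p : ℝ × ℝ) : (W n p).im = 0 := by
  rw [isModeExpansion_iff] at hW
  have h := hW.conj (AddEquiv.refl ℕ) (fun _ => rfl)
    (fun i => by
      rw [AddEquiv.refl_apply, map_mul, Complex.conj_natCast, Complex.conj_eq_iff_im.mpr hα'])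
    (fun i _ => by ext p; exact Complex.conj_eq_iff_im.mpr (hv p))
  have h2 := hW.unique (isExponentSystem_nat α) hα H1 h
  exact Complex.conj_eq_iff_im.mp (congrFun (congrFun h2 n) p)

/-- The pairs of indices with sum `(n, m)`. -/
instance instHasAntidiagonalNatProdNat : Finset.HasAntidiagonal (ℕ × ℕ) where
  antidiagonal i := (Finset.Iic i ×ˢ Finset.Iic i).filter fun q => q.1 + q.2 = i
  mem_antidiagonal := by
    intro i q
    simp only [Finset.mem_filter, Finset.mem_product, Finset.mem_Iic, and_iff_right_iff_imp]
    rintro rfl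
    exact ⟨le_self_add, le_add_self⟩

/-- The exponents generated by a mode and its complex conjugate. -/
theorem isExponentSystem_pair (α : ℂ) : IsExponentSystem α
    (fun i : ℕ × ℕ => i.1 * α + i.2 * (starRingEnd ℂ) α) (fun i : ℕ × ℕ => i.1 + i.2) where
  lam_add i j := by simp only [Prod.fst_add, Prod.snd_add]; push_cast; ring
  deg_add i j := by simp only [Prod.fst_add, Prod.snd_add]; ring
  re_lam i := by simp; ring
  norm_lam_le i := by
    refine (norm_add_le _ _).trans ?_
    rw [norm_mul, norm_mul, RCLike.norm_conj, Complex.norm_natCast, Complex.norm_natCast]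
    push_cast
    linarith

theorem IsEulerPerturbation.shift {I J : Set ℝ} {w : ℝ → ℝ × ℝ → ℂ}
    (h : IsEulerPerturbation U I w) (s : ℝ) (hJ : ∀ t ∈ J, t - s ∈ I) :
    IsEulerPerturbation U J fun t => w (t - s) where
  smooth := by
    have h1 : ContDiff ℝ ∞ fun q : ℝ × (ℝ × ℝ) => (q.1 - s, q.2) := by fun_prop
    exact h.smooth.comp h1.contDiffOn fun q hq => ⟨hJ q.1 hq.1, Set.mem_univ _⟩
  torusField t ht := h.torusField _ (hJ t ht)
  equation t ht p := by
    have h1 := h.equation _ (hJ t ht) p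
    have h2 : HasDerivWithinAt (fun t : ℝ => t - s) 1 J t :=
      ((hasDerivAt_id t).sub_const s).hasDerivWithinAt
    have h3 := h1.scomp t h2 hJ
    rw [one_smul] at h3
    exact h3

/-- The real solution generated by a small multiple of an eigenmode and its conjugate: it tends to
zero in an analytic norm as `t → -∞`, but does not vanish at `t = 0`. -/
theorem exists_real_solution (hα : 0 < α.re) (hv : IsAdmissible K v) (hne : v ≠ 0)
    (hmode : ∀ p, α * v p + linearized U v p = 0) (H1 : ResolventBound U α K) :
    ∃ w : ℝ → ℝ × ℝ → ℂ, IsEulerPerturbation U (Set.Iic 0) w ∧ (∀ t ≤ 0, ∀ p, (w t p).im = 0) ∧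
      w 0 ≠ 0 ∧ ∃ ρ : ℝ, 0 < ρ ∧ ∃ M : ℝ, 0 < M ∧
        ∀ t ≤ 0, Gen (w t) ρ ρ ≤ ENNReal.ofReal (Real.exp (α.re * t) * M) := by
  obtain ⟨p₀, hp₀⟩ : ∃ p₀, v p₀ ≠ 0 := by
    by_contra! h
    exact hne (funext h)
  obtain ⟨r, hr, hfin⟩ := hv.analytic
  obtain ⟨ρ, hρ, B, hB, hbd⟩ := H1.exists_degSum_le hα hr
  have hvs := hv.isSmoothPeriodic
  set A₀ := (Gen v r r).toReal with hA₀
  set V := ‖v p₀‖ with hV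
  have hV0 : 0 < V := norm_pos_iff.mpr hp₀
  have hVA : V ≤ A₀ := by
    rw [hV, ← toReal_enorm]
    exact ENNReal.toReal_mono hfin (hvs.enorm_le_Gen hr.le p₀)
  have hA₀0 : 0 < A₀ := hV0.trans_le hVA
  -- With this phase the two terms of degree one add up to `2 ε V²` at `p₀`; the terms of higher
  -- degree contribute `O(ε²)`.
  set ε : ℝ := 1 / (8 * B * A₀ ^ 2) with hε
  have hε0 : 0 < ε := by positivity
  set c : ℂ := ε * (starRingEnd ℂ) (v p₀) with hc
  have hcn : ‖c‖ = ε * V := by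
    rw [hc, norm_mul, RCLike.norm_conj, Complex.norm_real, Real.norm_of_nonneg hε0.le]
  have hcv : c * v p₀ = ((ε * V ^ 2 : ℝ) : ℂ) := by
    rw [hc, mul_assoc, mul_comm ((starRingEnd ℂ) (v p₀)), Complex.mul_conj,
      Complex.normSq_eq_norm_sq]
    push_cast; ring
  set A : ℝ := 2 * (‖c‖ * A₀) with hA
  have hBA : B * A = V / (4 * A₀) := by
    rw [hA, hcn, hε]; field_simp; norm_num
  have hBA4 : B * A ≤ 1 / 4 := by
    rw [hBA, div_le_div_iff₀ (by positivity) (by norm_num)]; linarith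
  have hA0 : 0 < A := by rw [hA, hcn]; positivity
  set lam : ℕ × ℕ → ℂ := fun i => i.1 * α + i.2 * (starRingEnd ℂ) α with hlam
  set deg : ℕ × ℕ → ℕ := fun i => i.1 + i.2 with hdeg
  set f : ℝ × ℝ → ℂ := fun p => c * v p with hf
  have hfadm : IsAdmissible K f := hv.const_mul c
  have hfs := hfadm.isSmoothPeriodic
  set seed : ℕ × ℕ → ℝ × ℝ → ℂ := fun i =>
    if i.1 = 1 then f else fun p => (starRingEnd ℂ) (f p) with hseed_def
  have hs : IsExponentSystem α lam deg := isExponentSystem_pair α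
  have hdeg1 : ∀ i : ℕ × ℕ, deg i = 1 → i = (1, 0) ∨ i = (0, 1) := by
    rintro ⟨a, b⟩ h
    simp only [hdeg] at h
    rcases a with _ | a
    · right; rw [show b = 1 by omega]
    · left; rw [show a = 0 by omega, show b = 0 by omega]
  have hseedadm : ∀ i, deg i = 1 → IsAdmissible K (seed i) := by
    intro i _
    simp only [hseed_def]
    split_ifs
    · exact hfadm
    · exact hfadm.conj
  obtain ⟨W, hW⟩ := hs.exists_expansion (U := U) (seed := seed) hα H1 hseedadm
  have hGf : Gen f r r = ENNReal.ofReal (‖c‖ * A₀) := by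
    rw [hf, hvs.Gen_const_mul, ENNReal.ofReal_mul (norm_nonneg _), ofReal_norm, hA₀,
      ENNReal.ofReal_toReal hfin]
  have hbound := hbd hs hW A hA0.le (by
    rw [degSum, tsum_eq_sum (s := {(1, 0), (0, 1)})]
    · rw [Finset.sum_pair (by simp), if_pos (by simp [hdeg]), if_pos (by simp [hdeg])]
      simp only [hseed_def, if_true, zero_ne_one, if_false]
      rw [hfs.Gen_conj, hGf,
        ← ENNReal.ofReal_add (by positivity) (by positivity), hA, two_mul]
    · intro i hi
      rw [if_neg]
      intro h
      rcases hdeg1 i h with rfl | rfl <;> simp at hi)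
  have h00 : Real.exp (α.re * 0) * (B * A) < 1 := by
    rw [mul_zero, Real.exp_zero, one_mul]; linarith
  obtain ⟨T, hT0, hT⟩ := exists_gt_exp_mul_lt h00
  have hconv := hW.isConvergent hα hρ hA0.le hB.le hbound hT
  have hmodef : ∀ p, α * f p + linearized U f p = 0 := by
    intro p
    rw [hf, hvs.linearized_const_mul]
    linear_combination c * hmode p
  have hseed : ∀ i, deg i = 1 → ∀ p, lam i * seed i p + linearized U (seed i) p = 0 := by
    intro i hi p
    rcases hdeg1 i hi with rfl | rfl
    · simpa [hseed_def, hlam] using hmodef p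
    · have := congrArg (starRingEnd ℂ) (hmodef p)
      rw [map_add, map_mul, ← hfs.linearized_conj, map_zero] at this
      simpa [hseed_def, hlam] using this
  have hWconj : ∀ i p, (starRingEnd ℂ) (W i p) = W i.swap p := by
    have h := hW.conj (AddEquiv.prodComm) (fun i => by simp [hdeg, add_comm])
      (fun i => by simp [hlam, add_comm]) (fun i hi => by
        rcases hdeg1 i hi with rfl | rfl <;> simp [hseed_def])
    have h2 := hW.unique hs hα H1 h
    intro i p
    have := congrFun (congrFun h2 i.swap) p
    simpa using this
  refine ⟨modeSum lam W, hW.isEulerPerturbation hα hs hseed hconv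
    (fun t ht => lt_of_le_of_lt ht hT0), fun t ht p => ?_, fun h0 => ?_, ρ, hρ, 2 * A,
    by positivity, fun t ht => ?_⟩
  · rw [← Complex.conj_eq_iff_im, modeSum, Complex.conj_tsum, ← (Equiv.prodComm ℕ ℕ).tsum_eq]
    refine tsum_congr fun i => ?_
    rw [map_mul, hWconj, ← Complex.exp_conj]
    simp [hlam, add_comm]
  · have hsum := (hconv.summable_norm hα.le hs.re_lam hT0 p₀).of_norm
    have hsplit := hsum.sum_add_tsum_compl (s := {(1, 0), (0, 1)})
    have hval : modeSum lam W 0 p₀ = 0 := by rw [h0]; rfl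
    rw [show ∑' i, Complex.exp (lam i * (0 : ℝ)) * W i p₀ = 0 from hval,
      Finset.sum_pair (by simp), hW.one _ (by simp [hdeg]), hW.one _ (by simp [hdeg])] at hsplit
    simp only [hseed_def, hf, if_pos, zero_ne_one, if_false, Complex.ofReal_zero, mul_zero,
      Complex.exp_zero, one_mul, map_mul] at hsplit
    have htail := tsum_expWeight_le_of_degSum_le (W := W) hA0.le hB.le hbound h00 1
    set R := ∑' i : ((({(1, 0), (0, 1)} : Finset (ℕ × ℕ)) : Set (ℕ × ℕ))ᶜ : Set (ℕ × ℕ)), W i p₀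
      with hR
    have hRle : ‖R‖ₑ ≤ ENNReal.ofReal (Real.exp (α.re * 0) * A *
        (Real.exp (α.re * 0) * (B * A)) ^ 1 / (1 - Real.exp (α.re * 0) * (B * A))) := by
      refine (enorm_tsum_le_tsum_enorm.trans ?_).trans htail
      refine le_trans (ENNReal.tsum_le_tsum fun i => ?_) (ENNReal.tsum_comp_le_tsum_of_injective
        (Subtype.val_injective) _)
      by_cases hi : 1 < deg i
      · rw [if_pos hi]
        have : expWeight α.re deg 0 i = 1 := by simp [expWeight]
        rw [this, one_mul]
        exact (hW.isSmoothPeriodic i).enorm_le_Gen hρ.le p₀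
      · have h1 : deg i ≠ 1 := by
          intro h1
          have hi' := i.2
          rcases hdeg1 i h1 with h2 | h2 <;> rw [h2] at hi' <;> simp at hi'
        rw [hW.zero i (by omega)]
        simp
    have hRn : ‖R‖ ≤ A * (B * A) / (1 - B * A) := by
      rw [mul_zero, Real.exp_zero, one_mul, one_mul, pow_one, ← ofReal_norm] at hRle
      refine (ENNReal.ofReal_le_ofReal_iff ?_).mp hRle
      have : 0 ≤ 1 - B * A := by linarith
      positivity
    have hval2 : ((2 * (ε * V ^ 2) : ℝ) : ℂ) = -R := by
      have e : (starRingEnd ℂ) c * (starRingEnd ℂ) (v p₀) = ((ε * V ^ 2 : ℝ) : ℂ) := by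
        rw [← map_mul, hcv, Complex.conj_ofReal]
      rw [hcv, e] at hsplit
      push_cast at hsplit ⊢
      linear_combination hsplit
    have hn : 2 * (ε * V ^ 2) = ‖R‖ := by
      rw [← norm_neg, ← hval2, Complex.norm_real, Real.norm_of_nonneg (by positivity)]
    have h3 : A * (B * A) / (1 - B * A) < 2 * (ε * V ^ 2) := by
      rw [div_lt_iff₀ (by linarith)]
      have h4 : A * (B * A) = ε * V ^ 2 / 2 := by
        rw [hBA, hA, hcn]; field_simp; norm_num
      rw [h4]
      have h5 : 0 < ε * V ^ 2 := by positivity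
      nlinarith
    linarith
  · have ht1 : Real.exp (α.re * t) ≤ 1 := by
      rw [Real.exp_le_one_iff]; exact mul_nonpos_of_nonneg_of_nonpos hα.le ht
    have hBA0 : 0 ≤ B * A := by positivity
    have h1 : Real.exp (α.re * t) * (B * A) ≤ 1 / 4 :=
      (mul_le_of_le_one_left hBA0 ht1).trans hBA4
    refine (hconv.Gen_modeSum_le hα hs.re_lam hs.norm_lam_le (ht.trans_lt hT0) ρ ρ).trans
      ((hW.tsum_expWeight_le hA0.le hB.le hbound (by linarith)).trans
        (ENNReal.ofReal_le_ofReal ?_))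
    rw [div_le_iff₀ (by linarith)]
    have h2 : 0 ≤ Real.exp (α.re * t) * A := by positivity
    nlinarith

/-- The translates in time of one real solution that tends to zero as `t → -∞`. -/
theorem nonlinearlyUnstable_of_eigenmode (hα : 0 < α.re) (hv : IsAdmissible K v) (hne : v ≠ 0)
    (hmode : ∀ p, α * v p + linearized U v p = 0) (H1 : ResolventBound U α K) :
    NonlinearlyUnstable U := by
  obtain ⟨w, hw, hreal, hw0, ρ, hρ, M, hM, hGen⟩ := exists_real_solution hα hv hne hmode H1
  have h0 : (0 : ℝ) ∈ Set.Iic (0 : ℝ) := Set.mem_Iic.mpr le_rfl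
  obtain ⟨p, hp⟩ : ∃ p, velocity (w 0) p ≠ 0 := by
    by_contra! h
    exact hw0 ((hw.torusField 0 h0).eq_zero_of_velocity h)
  have hb := multBound_pos
  refine ⟨‖velocity (w 0) p‖, norm_pos_iff.mpr hp, ρ, hρ, fun ε hε => ?_⟩
  set M' : ℝ := M * (1 + multBound) with hM'
  have hM'0 : 0 < M' := by positivity
  -- By `exp (-x) ≤ 1 / x`, the solution is `O(ε)` at this distance in time.
  set T : ℝ := M' / (ε * α.re) with hT
  have hT0 : 0 < T := by positivity
  have hsub : ∀ t ∈ Set.Icc 0 T, t - T ∈ Set.Iic (0 : ℝ) := fun t ht => sub_nonpos.mpr ht.2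
  have hexp : Real.exp (α.re * (0 - T)) * M' ≤ ε := by
    have e : α.re * (0 - T) = -(M' / ε) := by rw [hT]; field_simp; ring
    rw [e, Real.exp_neg, inv_mul_le_iff₀ (Real.exp_pos _)]
    have h1 : M' / ε ≤ Real.exp (M' / ε) := by
      have := Real.add_one_le_exp (M' / ε); linarith
    calc M' = M' / ε * ε := by field_simp
      _ ≤ _ := by gcongr
  have hmem : (0 : ℝ) - T ≤ 0 := by linarith
  have hG := hGen (0 - T) hmem
  have hG' : Gen (w (0 - T)) ρ ρ ≤ ENNReal.ofReal ε := by
    refine hG.trans (ENNReal.ofReal_le_ofReal (le_trans ?_ hexp))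
    gcongr
    rw [hM']; nlinarith
  have hws := (hw.torusField (0 - T) hmem).isSmoothPeriodic
  have hvel : ∀ m, IsMultiplier m → ∀ p, ‖mult m (w (0 - T)) p‖ ≤ ε := by
    intro m hm p
    have h1 := ((hm.isSmoothPeriodic hws).enorm_le_Gen (z₂ := ρ) hρ.le p).trans
      ((hm.Gen_mult_le hws ρ ρ).trans (mul_le_mul_right hG _))
    rw [← ENNReal.ofReal_mul hb.le, ← ofReal_norm] at h1
    have h2 := (ENNReal.ofReal_le_ofReal_iff (by positivity)).mp h1
    refine h2.trans (le_trans ?_ hexp)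
    have h3 : 0 ≤ Real.exp (α.re * (0 - T)) * M := by positivity
    rw [hM']; nlinarith
  refine ⟨T, hT0, fun t => w (t - T), hw.shift T hsub, fun t ht p => hreal _ (hsub t ht) p, hG',
    fun p => ?_, p, ?_⟩
  · rw [hws.velocity_eq]
    exact max_le (hvel _ isMultiplier_velMult₁ p) (hvel _ isMultiplier_velMult₂ p)
  · simp only [sub_self]; exact le_rfl

end Modes

end ShearFlow

end

theorem mainTheorem3 (U : ℝ → ℝ) (hU : ContDiff ℝ ∞ U) (hUper : Function.Periodic U (2 * Real.pi))
    (α : ℂ) (hα : 0 < α.re) (K : ℕ)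
    (v₁ : ℝ × ℝ → ℂ) (hv₁ : ShearFlow.IsAdmissible K v₁) (hne : v₁ ≠ 0)
    (hmode : ∀ p, α * v₁ p + ShearFlow.linearized U v₁ p = 0)
    (H1 : ShearFlow.ResolventBound U α K) :
    (∃ T₀ : ℝ, ShearFlow.SeriesSolves U α K v₁ T₀) ∧
    (∃ c₀ : ℝ, 0 < c₀ ∧ ∀ c : ℂ, ‖c‖ ≤ c₀ →
      ∃ T₀ : ℝ, 0 < T₀ ∧ ShearFlow.SeriesSolves U α K (c • v₁) T₀) ∧
    (α.im = 0 → (∀ p, (v₁ p).im = 0) →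
      ∀ W, ShearFlow.IsModeExpansion U α K v₁ W → ∀ n p, (W n p).im = 0) ∧
    ShearFlow.NonlinearlyUnstable U := by
  obtain ⟨B, hB, hsolve⟩ := ShearFlow.exists_seriesSolves hα hv₁ hmode H1
  refine ⟨?_, ?_, fun hα' hv W hW => hW.im_eq_zero hα H1 hα' hv,
    ShearFlow.nonlinearlyUnstable_of_eigenmode hα hv₁ hne hmode H1⟩
  · -- `exp (-x) ≤ 1 / (1 + x)` with `x = B`
    refine ⟨-B / α.re, ?_⟩
    have h := hsolve 1 (-B / α.re) (by
      rw [norm_one, mul_one, mul_div_cancel₀ _ hα.ne', Real.exp_neg,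
        inv_mul_lt_iff₀ (Real.exp_pos _), mul_one]
      have := Real.add_one_le_exp B
      linarith)
    rwa [one_smul] at h
  · refine ⟨1 / (Real.exp α.re * (B + 1)), by positivity, fun c hc => ⟨1, one_pos, hsolve c 1 ?_⟩⟩
    rw [mul_one]
    have hE := Real.exp_pos α.re
    calc Real.exp α.re * (B * ‖c‖) ≤ Real.exp α.re * (B * (1 / (Real.exp α.re * (B + 1)))) := by
          gcongr
      _ = B / (B + 1) := by field_simp
      _ < 1 := by rw [div_lt_one (by positivity)]; linarith
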